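/- Let $n\ge 1$, let $\Omega\subset\mathbb R^n$ be a nonempty bounded open connected set and let $s\in(0,1)$. For $1<p<\infty$ let $$W^{s,p}(\Omega)=\Big\{u\in L^p(\Omega): \tfrac{|u(x)-u(y)|}{|x-y|^{n/p+s}}\in L^p(\Omega\times\Omega)\Big\},\qquad [u]_{W^{s,p}(\Omega)}^p=\int_\Omega\int_\Omega\frac{|u(x)-u(y)|^p}{|x-y|^{n+sp}}\,dx\,dy,$$ $$\lambda_1(s,p)=\inf\Big\{\frac{[u]_{W^{s,p}(\Omega)}^p}{\int_\Omega|u|^p\,dx}: u\in \mathcal X_{s,p}\Big\},\qquad \mathcal X_{s,p}=\Big\{u\in W^{s,p}(\Omega): u\ne0,\ \int_\Omega|u|^{p-2}u\,dx=0\Big\}.$$ Let also $$W^{s,\infty}(\Omega)=\Big\{u\in L^\infty(\Omega): \tfrac{u(x)-u(y)}{|x-y|^{s}}\in L^\infty(\Omega\times\Omega)\Big\},\qquad [u]_{W^{s,\infty}(\Omega)}=\Big\|\tfrac{u(x)-u(y)}{|x-y|^{s}}\Big\|_{L^\infty(\Omega\times\Omega)},$$ $$\lambda_1(s,\infty)=\inf\Big\{\frac{[u]_{W^{s,\infty}(\Omega)}}{\|u\|_{L^\infty(\Omega)}}: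 u\in\mathcal A\Big\},\qquad \mathcal A=\Big\{u\in W^{s,\infty}(\Omega): u\neq0,\ \sup_\Omega u+\inf_\Omega u=0\Big\}$$ (essential supremum and infimum). Then $$\lim_{p\to\infty}\lambda_1(s,p)^{1/p}=\frac{2}{\operatorname{diam}(\Omega)^s}=\lambda_1(s,\infty).$$ Moreover, let $p_k\in(1,\infty)$ with $p_k\to\infty$, and for each $k$ let $u_k\in\mathcal X_{s,p_k}$ be a normalized minimizer of $\lambda_1(s,p_k)$, that is, $\|u_k\|_{L^{p_k}(\Omega)}=1$ and $[u_k]_{W^{s,p_k}(\Omega)}^{p_k}=\lambda_1(s,p_k)$. Then, along a subsequence, the $u_k$ have representatives that are continuous on $\Omega$ (and on $\overline\Omega$, whenever $u_k$ has a representative that is continuous on $\overline\Omega$) and that converge uniformly on $\overline\Omega$ to a function $u_\infty\in C(\overline\Omega)\cap W^{s,\infty}(\Omega)$ which is a minimizer of $\lambda_1(s,\infty)$, that is, $u_\infty\in\mathcal A$ and $[u_\infty]_{W^{s,\infty}(\Omega)}/\|u_\infty\|_{L^\infty(\Omega)}=\lambda_1(s,\infty)$. Moreover this $u_\infty$ is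 a viscosity solution in $\Omega$ of $$\begin{cases}\max\{\mathcal L_{s,\infty}u(x),\ \mathcal L^-_{s,\infty}u(x)+\lambda_1(s,\infty)u(x)\}=0 & \text{when } u(x)>0,\\ \mathcal L_{s,\infty}u(x)=0 & \text{when } u(x)=0,\\ \min\{\mathcal L_{s,\infty}u(x),\ \mathcal L^+_{s,\infty}u(x)+\lambda_1(s,\infty)u(x)\}=0 & \text{when } u(x)<0,\end{cases}$$ where $\mathcal L_{s,\infty}u=\mathcal L^+_{s,\infty}u+\mathcal L^-_{s,\infty}u$ and $$\mathcal L^+_{s,\infty}u(x)=\sup_{y\in\overline\Omega,\,y\ne x}\frac{u(y)-u(x)}{|y-x|^s},\qquad \mathcal L^-_{s,\infty}u(x)=\inf_{y\in\overline\Omega,\,y\ne x}\frac{u(y)-u(x)}{|y-x|^s}.$$ Here $u\in C(\Omega)$ is a viscosity super-solution (respectively sub-solution) if, for all $x_0\in\Omega$ and all $\varphi\in C^1(\overline\Omega)$ with $\varphi(x_0)=u(x_0)$ and $\varphi\le u$ (respectively $\varphi\ge u$) on $\overline\Omega$, the left-hand side of the equation, evaluated for $\varphi$ at $x_0$ with the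 case chosen by the sign of $\varphi(x_0)$, is $\le 0$ (respectively $\ge0$); a viscosity solution is both. The space $C^1(\overline\Omega)$ consists of the $\varphi\in C(\overline\Omega)$ that are differentiable in $\Omega$ with a gradient that extends continuously to $\overline\Omega$. -/

import Mathlib

open MeasureTheory Filter Topology Set

noncomputable section

namespace HolderInfinity

variable {n : ℕ}

/-- Lebesgue measure on `Ω`. Functions on `Ω` are represented by functions on `ℝⁿ`, and only
their values on `Ω` (or on its closure, where continuity is at stake) are ever used. -/
def vol (Ω : Set (EuclideanSpace ℝ (Fin n))) : Measure (EuclideanSpace ℝ (Fin n)) :=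
  volume.restrict Ω

/-- `u ∈ W^{s,p}(Ω)` for a finite exponent `p`. -/
def MemW (Ω : Set (EuclideanSpace ℝ (Fin n))) (s p : ℝ)
    (u : EuclideanSpace ℝ (Fin n) → ℝ) : Prop :=
  MemLp u (ENNReal.ofReal p) (vol Ω) ∧
    MemLp (fun z : EuclideanSpace ℝ (Fin n) × EuclideanSpace ℝ (Fin n) =>
      |u z.1 - u z.2| / ‖z.1 - z.2‖ ^ ((n : ℝ) / p + s)) (ENNReal.ofReal p) ((vol Ω).prod (vol Ω))

/-- The `p`-th power `[u]^p` of the Gagliardo seminorm of `W^{s,p}(Ω)`. -/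
def gagliardoEnergy (Ω : Set (EuclideanSpace ℝ (Fin n))) (s p : ℝ)
    (u : EuclideanSpace ℝ (Fin n) → ℝ) : ℝ :=
  ∫ y, ∫ x, |u x - u y| ^ p / ‖x - y‖ ^ ((n : ℝ) + s * p) ∂(vol Ω) ∂(vol Ω)

/-- The admissible class `𝒳_{s,p}`. -/
def admissible (Ω : Set (EuclideanSpace ℝ (Fin n))) (s p : ℝ) :
    Set (EuclideanSpace ℝ (Fin n) → ℝ) :=
  {u | MemW Ω s p u ∧ ¬ (u =ᵐ[vol Ω] 0) ∧ ∫ x, |u x| ^ (p - 2) * u x ∂(vol Ω) = 0}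

/-- The first non-zero Neumann eigenvalue `λ₁(s,p)`. -/
def eigenvalue (Ω : Set (EuclideanSpace ℝ (Fin n))) (s p : ℝ) : ℝ :=
  sInf ((fun u => gagliardoEnergy Ω s p u / ∫ x, |u x| ^ p ∂(vol Ω)) '' admissible Ω s p)

/-- `u` is a minimizer for `λ₁(s,p)` with `‖u‖_{L^p(Ω)} = 1`. -/
def IsNormalizedMinimizer (Ω : Set (EuclideanSpace ℝ (Fin n))) (s p : ℝ)
    (u : EuclideanSpace ℝ (Fin n) → ℝ) : Prop :=
  u ∈ admissible Ω s p ∧ ∫ x, |u x| ^ p ∂(vol Ω) = 1 ∧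
    gagliardoEnergy Ω s p u = eigenvalue Ω s p

/-- The Hölder quotient `(u(x) - u(y)) / |x - y|^s` as a function on pairs. -/
def holderQuotient (s : ℝ) (u : EuclideanSpace ℝ (Fin n) → ℝ)
    (z : EuclideanSpace ℝ (Fin n) × EuclideanSpace ℝ (Fin n)) : ℝ :=
  (u z.1 - u z.2) / ‖z.1 - z.2‖ ^ s

/-- `u ∈ W^{s,∞}(Ω)`. -/
def MemWInfty (Ω : Set (EuclideanSpace ℝ (Fin n))) (s : ℝ)
    (u : EuclideanSpace ℝ (Fin n) → ℝ) : Prop :=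
  MemLp u ⊤ (vol Ω) ∧ MemLp (holderQuotient s u) ⊤ ((vol Ω).prod (vol Ω))

/-- The seminorm `[u]_{W^{s,∞}(Ω)}`. -/
def seminormInfty (Ω : Set (EuclideanSpace ℝ (Fin n))) (s : ℝ)
    (u : EuclideanSpace ℝ (Fin n) → ℝ) : ℝ :=
  (eLpNorm (holderQuotient s u) ⊤ ((vol Ω).prod (vol Ω))).toReal

/-- The quotient `[u]_{W^{s,∞}(Ω)} / ‖u‖_{L^∞(Ω)}`. -/
def rayleighInfty (Ω : Set (EuclideanSpace ℝ (Fin n))) (s : ℝ)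
    (u : EuclideanSpace ℝ (Fin n) → ℝ) : ℝ :=
  seminormInfty Ω s u / (eLpNorm u ⊤ (vol Ω)).toReal

/-- The admissible class `𝒜`; supremum and infimum are the essential ones on `Ω`. -/
def admissibleInfty (Ω : Set (EuclideanSpace ℝ (Fin n))) (s : ℝ) :
    Set (EuclideanSpace ℝ (Fin n) → ℝ) :=
  {u | MemWInfty Ω s u ∧ ¬ (u =ᵐ[vol Ω] 0) ∧ essSup u (vol Ω) + essInf u (vol Ω) = 0}

/-- `λ₁(s,∞)`. -/
def eigenvalueInfty (Ω : Set (EuclideanSpace ℝ (Fin n))) (s : ℝ) : ℝ :=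
  sInf (rayleighInfty Ω s '' admissibleInfty Ω s)

/-- `u` is a minimizer for `λ₁(s,∞)`. -/
def IsMinimizerInfty (Ω : Set (EuclideanSpace ℝ (Fin n))) (s : ℝ)
    (u : EuclideanSpace ℝ (Fin n) → ℝ) : Prop :=
  u ∈ admissibleInfty Ω s ∧ rayleighInfty Ω s u = eigenvalueInfty Ω s

/-- `ℒ⁺_{s,∞} u(x)`. -/
def Lplus (Ω : Set (EuclideanSpace ℝ (Fin n))) (s : ℝ)
    (u : EuclideanSpace ℝ (Fin n) → ℝ) (x : EuclideanSpace ℝ (Fin n)) : ℝ :=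
  sSup ((fun y => (u y - u x) / ‖y - x‖ ^ s) '' (closure Ω \ {x}))

/-- `ℒ⁻_{s,∞} u(x)`. -/
def Lminus (Ω : Set (EuclideanSpace ℝ (Fin n))) (s : ℝ)
    (u : EuclideanSpace ℝ (Fin n) → ℝ) (x : EuclideanSpace ℝ (Fin n)) : ℝ :=
  sInf ((fun y => (u y - u x) / ‖y - x‖ ^ s) '' (closure Ω \ {x}))

/-- The Hölder `∞`-Laplacian `ℒ_{s,∞} u(x)`. -/
def holderLaplacian (Ω : Set (EuclideanSpace ℝ (Fin n))) (s : ℝ)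
    (u : EuclideanSpace ℝ (Fin n) → ℝ) (x : EuclideanSpace ℝ (Fin n)) : ℝ :=
  Lplus Ω s u x + Lminus Ω s u x

/-- `φ ∈ C¹(closure Ω)`: `φ` is differentiable in `Ω`, and `φ` and its derivative extend
continuously to the closure. -/
def IsC1Closure (Ω : Set (EuclideanSpace ℝ (Fin n)))
    (φ : EuclideanSpace ℝ (Fin n) → ℝ) : Prop :=
  ContinuousOn φ (closure Ω) ∧
    ∃ g : EuclideanSpace ℝ (Fin n) → EuclideanSpace ℝ (Fin n) →L[ℝ] ℝ,
      ContinuousOn g (closure Ω) ∧ ∀ x ∈ Ω, HasFDerivAt φ (g x) x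

/-- Viscosity super-solutions of the Hölder `∞`-Laplacian eigenvalue equation with
eigenvalue `Λ`. -/
def IsViscositySuper (Ω : Set (EuclideanSpace ℝ (Fin n))) (s Λ : ℝ)
    (u : EuclideanSpace ℝ (Fin n) → ℝ) : Prop :=
  ∀ x₀ ∈ Ω, ∀ φ : EuclideanSpace ℝ (Fin n) → ℝ, IsC1Closure Ω φ →
    φ x₀ = u x₀ → (∀ x ∈ closure Ω, φ x ≤ u x) →
    (0 < φ x₀ → max (holderLaplacian Ω s φ x₀) (Lminus Ω s φ x₀ + Λ * φ x₀) ≤ 0) ∧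
    (φ x₀ = 0 → holderLaplacian Ω s φ x₀ ≤ 0) ∧
    (φ x₀ < 0 → min (holderLaplacian Ω s φ x₀) (Lplus Ω s φ x₀ + Λ * φ x₀) ≤ 0)

/-- Viscosity sub-solutions of the same equation. -/
def IsViscositySub (Ω : Set (EuclideanSpace ℝ (Fin n))) (s Λ : ℝ)
    (u : EuclideanSpace ℝ (Fin n) → ℝ) : Prop :=
  ∀ x₀ ∈ Ω, ∀ φ : EuclideanSpace ℝ (Fin n) → ℝ, IsC1Closure Ω φ →
    φ x₀ = u x₀ → (∀ x ∈ closure Ω, u x ≤ φ x) →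
    (0 < φ x₀ → 0 ≤ max (holderLaplacian Ω s φ x₀) (Lminus Ω s φ x₀ + Λ * φ x₀)) ∧
    (φ x₀ = 0 → 0 ≤ holderLaplacian Ω s φ x₀) ∧
    (φ x₀ < 0 → 0 ≤ min (holderLaplacian Ω s φ x₀) (Lplus Ω s φ x₀ + Λ * φ x₀))

/-- Viscosity solutions. -/
def IsViscositySolution (Ω : Set (EuclideanSpace ℝ (Fin n))) (s Λ : ℝ)
    (u : EuclideanSpace ℝ (Fin n) → ℝ) : Prop :=
  ContinuousOn u Ω ∧ IsViscositySuper Ω s Λ u ∧ IsViscositySub Ω s Λ u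

end HolderInfinity

end

/-! Everything is read off from geometric growth rates in p. A quantity A^p times a bounded factor
contributes A after p-th roots, and a sum of such terms contributes the largest base. Write D = diam
Ω and Λ = 2 / D^s.

Value of the limit. From above, the smoothed cone (|x - x₀| + η)^s at one end of a nearly diametral
pair is s-Hölder with constant 1 and Lipschitz, so its energy is bounded uniformly in p. After any
shift it still has size almost D^s / 2 on one of two fixed balls (`eigenvalue_upper`). From below,
∂Ω has no regularity, so inequalities up to the boundary are replaced by mean values over finitely
many balls inside Ω. Two means differ by about D^s E^(1/p) at most, with E the energy, so all of
them lie within half of that from their midrange c. The constraint makes the passage from u - c to u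
free (`integral_rpow_le_energy`). For the sup-norm problem, balanced extrema force twice the sup
norm to be at most the seminorm times D^s, and a cone between diametral points of the closure
attains equality.

Compactness. The means of the minimizers over a countable family of balls converge along a
subsequence. Their limits are Hölder compatible with constant Λ and extend by a McShane formula to a
function f on the whole space. Chebyshev's inequality gives convergence to f in measure
(`exists_subseq_tendstoInMeasure`).

Uniform convergence up to an arbitrary boundary rests on the nonlocality of the operator. Minimality
tested with u + (w - u)₊ / 2 yields a comparison principle (`IsNormalizedMinimizer.comparison`).
Take for w a Lipschitz regularization of f minus δ. If w exceeded the minimizer at x, then close to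
x there would be a set of points, of measure bounded below, at which the minimizer is near f and so
much larger than at x. At a small enough scale this contribution has a larger base than every other
term (`eventually_sub_le`). The reflection u ↦ -u gives the other side.

The limit equation. The constraint and the normalization pass to the limit as balanced extrema of
size at least 1 (`limit_balanced`), so f is a minimizer. Sorting the Euler–Lagrange equation by
signs and taking roots leaves one inequality for functions φ touching f from below: max(ℒ⁺φ, Λφ₊) ≤
max(-ℒ⁻φ, Λφ₋) (`limit_touching`). The three cases of the supersolution property follow from the
sign of φ, and reflection gives the subsolution property. A Morrey argument with dyadic means
supplies representatives continuous inside Ω. -/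

noncomputable section

namespace HolderInfinity

/-! ### The odd power and elementary inequalities for powers -/

/-- The odd power `t ↦ |t|^{p-2} t`. -/
def oddPow (p t : ℝ) : ℝ := |t| ^ (p - 2) * t

lemma oddPow_neg (p t : ℝ) : oddPow p (-t) = -oddPow p t := by
  simp [oddPow]

lemma oddPow_mul_self {p : ℝ} (hp : 0 < p) (t : ℝ) : oddPow p t * t = |t| ^ p := by
  rcases eq_or_ne t 0 with rfl | ht
  · simp [oddPow, Real.zero_rpow hp.ne']
  · have h : 0 < |t| := abs_pos.2 ht
    rw [oddPow, mul_assoc, ← abs_mul_abs_self t, ← mul_assoc, ← Real.rpow_add_one h.ne',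
      ← Real.rpow_add_one h.ne']
    congr 1; ring

lemma abs_oddPow {p : ℝ} (hp : 1 < p) (t : ℝ) : |oddPow p t| = |t| ^ (p - 1) := by
  rcases eq_or_ne t 0 with rfl | ht
  · simp [oddPow, Real.zero_rpow (sub_pos.2 hp).ne']
  · have h : 0 < |t| := abs_pos.2 ht
    rw [oddPow, abs_mul, abs_of_nonneg (Real.rpow_nonneg h.le _), ← Real.rpow_add_one h.ne']
    congr 1; ring

lemma oddPow_nonneg {p t : ℝ} (ht : 0 ≤ t) : 0 ≤ oddPow p t :=
  mul_nonneg (Real.rpow_nonneg (abs_nonneg _) _) ht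

lemma oddPow_of_nonneg {p t : ℝ} (hp : 1 < p) (ht : 0 ≤ t) : oddPow p t = t ^ (p - 1) := by
  rw [← abs_of_nonneg (oddPow_nonneg (p := p) ht), abs_oddPow hp, abs_of_nonneg ht]

lemma oddPow_of_nonpos {p t : ℝ} (hp : 1 < p) (ht : t ≤ 0) : oddPow p t = -(-t) ^ (p - 1) := by
  rw [← oddPow_of_nonneg hp (neg_nonneg.2 ht), oddPow_neg, neg_neg]

lemma continuous_oddPow {p : ℝ} (hp : 2 ≤ p) : Continuous (oddPow p) :=
  (continuous_abs.rpow_const fun _ => Or.inr (by linarith)).mul continuous_id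

/-- The graph of `|·|^p` lies above its tangents. -/
lemma tangent_le_abs_rpow {p : ℝ} (hp : 1 < p) (a b : ℝ) :
    |a| ^ p + p * (oddPow p a * (b - a)) ≤ |b| ^ p := by
  have hp0 : 0 < p := by linarith
  -- Young's inequality for the product of `oddPow p a` and b is the tangent inequality in disguise,
  -- since the conjugate power of |a|^(p-1) is |a|^p.
  have h := Real.young_inequality (oddPow p a) b (Real.HolderConjugate.conjExponent hp).symm
  rw [abs_oddPow hp, ← Real.rpow_mul (abs_nonneg _)] at h
  have e : (p - 1) * p.conjExponent = p := by
    rw [Real.conjExponent]; field_simp [(sub_pos.2 hp).ne']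
  have e2 : (p.conjExponent)⁻¹ = (p - 1) / p := by
    rw [Real.conjExponent, inv_div]
  rw [e, div_eq_mul_inv _ p.conjExponent, e2] at h
  have h2 := mul_le_mul_of_nonneg_left h hp0.le
  have e3 : p * (|a| ^ p * ((p - 1) / p) + |b| ^ p / p) = (p - 1) * |a| ^ p + |b| ^ p := by
    field_simp
  rw [e3] at h2
  have h3 := oddPow_mul_self hp0 a
  have : p * (oddPow p a * (b - a)) = p * (oddPow p a * b) - p * |a| ^ p := by rw [← h3]; ring
  linarith

lemma oddPow_sub_mul_sub_nonneg {p : ℝ} (hp : 1 < p) (a b : ℝ) :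
    0 ≤ (oddPow p a - oddPow p b) * (a - b) := by
  have h1 := tangent_le_abs_rpow hp a b
  have h2 := tangent_le_abs_rpow hp b a
  have h3 : 0 ≤ p * ((oddPow p a - oddPow p b) * (a - b)) := by nlinarith
  exact nonneg_of_mul_nonneg_right h3 (by linarith)

lemma oddPow_mono {p : ℝ} (hp : 1 < p) : Monotone (oddPow p) := by
  intro a b hab
  rcases hab.eq_or_lt with rfl | h
  · exact le_rfl
  · have := oddPow_sub_mul_sub_nonneg hp b a
    exact sub_nonneg.1 (nonneg_of_mul_nonneg_left this (sub_pos.2 h))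

lemma oddPow_mul_left {p c t : ℝ} (hp : 1 < p) (hc : 0 ≤ c) :
    oddPow p (c * t) = c ^ (p - 1) * oddPow p t := by
  rcases le_total 0 t with h | h
  · rw [oddPow_of_nonneg hp (mul_nonneg hc h), oddPow_of_nonneg hp h, Real.mul_rpow hc h]
  · rw [oddPow_of_nonpos hp (mul_nonpos_of_nonneg_of_nonpos hc h), oddPow_of_nonpos hp h,
      ← mul_neg, Real.mul_rpow hc (neg_nonneg.2 h)]
    ring

/-- The number x + h is the convex combination of x/θ and h/(1-θ) with weights θ and 1-θ, so it is
at most one of them. There is no factor 2^(p-1), and as θ varies the loss can be moved to the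
summand that can afford it. -/
lemma add_rpow_le_of_split {x h θ p : ℝ} (hx : 0 ≤ x) (hh : 0 ≤ h) (h0 : 0 < θ) (h1 : θ < 1)
    (hp : 0 ≤ p) : (x + h) ^ p ≤ (x / θ) ^ p + (h / (1 - θ)) ^ p := by
  have h2 : 0 < 1 - θ := by linarith
  by_cases hc : x + h ≤ x / θ
  · exact (Real.rpow_le_rpow (by positivity) hc hp).trans (le_add_of_nonneg_right (by positivity))
  · refine (Real.rpow_le_rpow (by positivity) ?_ hp).trans (le_add_of_nonneg_left (by positivity))
    rw [not_le, div_lt_iff₀ h0] at hc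
    rw [le_div_iff₀ h2]
    nlinarith

/-- Replacing the smaller of a and b by the larger gives a crude form of Young's inequality; it
serves as an integrable majorant. -/
lemma abs_mul_rpow_sub_one_le {p a b : ℝ} (hp : 1 < p) (ha : 0 ≤ a) (hb : 0 ≤ b) :
    a ^ (p - 1) * b ≤ a ^ p + b ^ p := by
  have hp1 : 0 ≤ p - 1 := by linarith
  have key : ∀ c : ℝ, 0 ≤ c → c ^ (p - 1) * c = c ^ p := by
    intro c hc
    have := oddPow_mul_self (p := p) (by linarith) c
    rwa [oddPow_of_nonneg hp hc, abs_of_nonneg hc] at this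
  rcases le_total a b with h | h
  · calc a ^ (p - 1) * b ≤ b ^ (p - 1) * b := by gcongr
      _ = b ^ p := key b hb
      _ ≤ _ := le_add_of_nonneg_left (by positivity)
  · calc a ^ (p - 1) * b ≤ a ^ (p - 1) * a := by gcongr
      _ = a ^ p := key a ha
      _ ≤ _ := le_add_of_nonneg_right (by positivity)

/-- Subadditivity of `t ↦ t^s` in the form of a Hölder estimate. -/
lemma rpow_le_rpow_add_rpow {a b c s : ℝ} (ha : 0 ≤ a) (hb : 0 ≤ b) (hc : 0 ≤ c) (hs0 : 0 ≤ s)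
    (hs1 : s ≤ 1) (h : a ≤ b + c) : a ^ s ≤ b ^ s + c ^ s :=
  (Real.rpow_le_rpow ha h hs0).trans (Real.rpow_add_le_add_rpow hb hc hs0 hs1)

lemma rpow_sub_rpow_le {a b s : ℝ} (ha : 0 ≤ a) (hb : 0 ≤ b) (hs0 : 0 ≤ s) (hs1 : s ≤ 1) :
    a ^ s - b ^ s ≤ |a - b| ^ s := by
  have := rpow_le_rpow_add_rpow ha hb (abs_nonneg (a - b)) hs0 hs1
    (by linarith [le_abs_self (a - b)])
  linarith

/-- `t ↦ t^s` is Lipschitz on `[η, ∞)`. -/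
lemma rpow_sub_rpow_le_mul {a b s η : ℝ} (hη : 0 < η) (ha : η ≤ a) (hb : η ≤ b) (hs0 : 0 ≤ s)
    (hs1 : s ≤ 1) : a ^ s - b ^ s ≤ η ^ (s - 1) * |a - b| := by
  have hb0 : 0 < b := by linarith
  have ha0 : 0 < a := by linarith
  have h1 : (a / b) ^ s ≤ 1 + |a - b| / b := by
    have h2 : a / b ≤ 1 + |a - b| / b := by
      rw [div_le_iff₀ hb0, add_mul, div_mul_cancel₀ _ hb0.ne']
      linarith [le_abs_self (a - b)]
    have h3 : (1 : ℝ) ≤ 1 + |a - b| / b := le_add_of_nonneg_right (by positivity)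
    calc (a / b) ^ s ≤ (1 + |a - b| / b) ^ s := Real.rpow_le_rpow (by positivity) h2 hs0
      _ ≤ (1 + |a - b| / b) ^ (1 : ℝ) := Real.rpow_le_rpow_of_exponent_le h3 hs1
      _ = _ := Real.rpow_one _
  rw [Real.div_rpow ha0.le hb0.le, div_le_iff₀ (by positivity)] at h1
  have h4 : |a - b| / b * b ^ s = b ^ (s - 1) * |a - b| := by
    rw [Real.rpow_sub_one hb0.ne']; ring
  have h5 : b ^ (s - 1) ≤ η ^ (s - 1) :=
    Real.rpow_le_rpow_of_nonpos hη hb (by linarith)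
  have h6 : b ^ (s - 1) * |a - b| ≤ η ^ (s - 1) * |a - b| := by gcongr
  nlinarith

/-! ### Geometric growth and p-th roots -/

lemma tendsto_const_rpow_inv {C : ℝ} (hC : 0 < C) :
    Tendsto (fun p : ℝ => C ^ (1 / p)) atTop (𝓝 1) := by
  have h : Tendsto (fun p : ℝ => 1 / p) atTop (𝓝 0) := by
    simpa using tendsto_inv_atTop_zero (𝕜 := ℝ)
  have h2 := (Real.continuousAt_const_rpow hC.ne' (b := 0)).tendsto.comp h
  simpa [Function.comp_def] using h2

/-- Geometric growth with the larger base wins. -/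
lemma eventually_mul_rpow_lt {a b C c : ℝ} (ha : 0 < a) (hab : a < b) (hc : 0 < c) :
    ∀ᶠ p : ℝ in atTop, C * a ^ p < c * b ^ p := by
  have h : Tendsto (fun p : ℝ => (a / b) ^ p) atTop (𝓝 0) :=
    tendsto_rpow_atTop_of_base_lt_one _ (by linarith [div_pos ha (ha.trans hab)])
      ((div_lt_one (ha.trans hab)).2 hab)
  have h2 := (h.const_mul C).eventually_lt_const (u := c) (by simpa using hc)
  filter_upwards [h2] with p hp
  have hb : 0 < b := ha.trans hab
  rw [Real.div_rpow ha.le hb.le, ← mul_div_assoc, div_lt_iff₀ (by positivity)] at hp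
  exact hp

/-- Two-sided geometric bounds determine the limit of the `p`-th roots. -/
lemma tendsto_rpow_inv_of_geometric {f : ℝ → ℝ} {L : ℝ} (hL : 0 < L)
    (hup : ∀ b, L < b → ∃ C, 0 < C ∧ ∀ᶠ p in atTop, f p ≤ C * b ^ p)
    (hlo : ∀ b, 0 < b → b < L → ∃ c, 0 < c ∧ ∀ᶠ p in atTop, c * b ^ p ≤ f p) :
    Tendsto (fun p : ℝ => f p ^ (1 / p)) atTop (𝓝 L) := by
  have hroot : ∀ {C b p : ℝ}, 0 < C → 0 < b → 0 < p → (C * b ^ p) ^ (1 / p) = C ^ (1 / p) * b := by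
    intro C b p hC hb hp
    rw [Real.mul_rpow hC.le (by positivity), ← Real.rpow_mul hb.le, mul_one_div_cancel hp.ne',
      Real.rpow_one]
  obtain ⟨c0, hc0, hpos⟩ := hlo (L / 2) (by linarith) (by linarith)
  have hfpos : ∀ᶠ p in atTop, 0 < f p := by
    filter_upwards [hpos] with p hp
    exact lt_of_lt_of_le (by positivity) hp
  rw [tendsto_order]
  constructor
  · intro a ha
    obtain ⟨b, hb1, hb2⟩ := exists_between (max_lt ha hL)
    have hb0 : 0 < b := (le_max_right _ _).trans_lt hb1
    obtain ⟨c, hc, h⟩ := hlo b hb0 hb2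
    have h1 : Tendsto (fun p : ℝ => c ^ (1 / p) * b) atTop (𝓝 b) := by
      simpa using (tendsto_const_rpow_inv hc).mul_const b
    filter_upwards [h, h1.eventually_const_lt ((le_max_left _ _).trans_lt hb1),
      eventually_gt_atTop 0] with p h2 h3 hp
    rw [← hroot hc hb0 hp] at h3
    exact h3.trans_le (Real.rpow_le_rpow (by positivity) h2 (by positivity))
  · intro a ha
    obtain ⟨b, hb1, hb2⟩ := exists_between ha
    have hb0 : 0 < b := hL.trans hb1
    obtain ⟨c, hc, h⟩ := hup b hb1
    have h1 : Tendsto (fun p : ℝ => c ^ (1 / p) * b) atTop (𝓝 b) := by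
      simpa using (tendsto_const_rpow_inv hc).mul_const b
    filter_upwards [h, h1.eventually_lt_const hb2, eventually_gt_atTop 0, hfpos]
      with p h2 h3 hp h4
    rw [← hroot hc hb0 hp] at h3
    exact (Real.rpow_le_rpow h4.le h2 (by positivity)).trans_lt h3

/-! ### The space W^{s,p} and its energy -/

/-- Euclidean space, abbreviated. -/
abbrev Euc (n : ℕ) := EuclideanSpace ℝ (Fin n)

variable {n : ℕ} {Ω : Set (Euc n)} {s p : ℝ}

/-- The integrand of the Gagliardo energy. -/
def energyDensity (s p : ℝ) (u : Euc n → ℝ) (z : Euc n × Euc n) : ℝ :=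
  |u z.1 - u z.2| ^ p / ‖z.1 - z.2‖ ^ ((n : ℝ) + s * p)

lemma energyDensity_nonneg (s p : ℝ) (u : Euc n → ℝ) (z : Euc n × Euc n) :
    0 ≤ energyDensity s p u z := by
  unfold energyDensity; positivity

lemma isFiniteMeasure_vol (hbdd : Bornology.IsBounded Ω) : IsFiniteMeasure (vol Ω) :=
  ⟨by rw [vol, Measure.restrict_apply_univ]; exact hbdd.measure_lt_top⟩

instance : SFinite (vol Ω) := by unfold vol; infer_instance

lemma ae_mem_vol (hopen : IsOpen Ω) : ∀ᵐ x ∂(vol Ω), x ∈ Ω :=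
  ae_restrict_mem hopen.measurableSet

lemma ae_mem_prod_vol (hopen : IsOpen Ω) :
    ∀ᵐ z ∂((vol Ω).prod (vol Ω)), z.1 ∈ Ω ∧ z.2 ∈ Ω := by
  have h1 := Measure.quasiMeasurePreserving_fst (μ := vol Ω) (ν := vol Ω)
  have h2 := Measure.quasiMeasurePreserving_snd (μ := vol Ω) (ν := vol Ω)
  filter_upwards [h1.ae (ae_mem_vol hopen), h2.ae (ae_mem_vol hopen)] with z a b using ⟨a, b⟩

lemma aesm_diff {u : Euc n → ℝ} (hu : AEStronglyMeasurable u (vol Ω)) :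
    AEStronglyMeasurable (fun z : Euc n × Euc n => u z.1 - u z.2) ((vol Ω).prod (vol Ω)) :=
  hu.comp_fst.sub hu.comp_snd

lemma measurable_norm_diff_rpow (r : ℝ) :
    Measurable (fun z : Euc n × Euc n => ‖z.1 - z.2‖ ^ r) :=
  ((measurable_fst.sub measurable_snd).norm).pow_const r

lemma MemW.aesm {u : Euc n → ℝ} (hu : MemW Ω s p u) : AEStronglyMeasurable u (vol Ω) := hu.1.1

lemma MemW.integrable_rpow {u : Euc n → ℝ} (hu : MemW Ω s p u) (hp : 0 < p) :
    Integrable (fun x => |u x| ^ p) (vol Ω) := by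
  have h := hu.1.integrable_norm_rpow (by simpa using hp) ENNReal.ofReal_ne_top
  simpa [ENNReal.toReal_ofReal hp.le] using h

lemma MemW.integrable_energyDensity {u : Euc n → ℝ} (hu : MemW Ω s p u) (hp : 0 < p) :
    Integrable (energyDensity s p u) ((vol Ω).prod (vol Ω)) := by
  have h := hu.2.integrable_norm_rpow (by simpa using hp) ENNReal.ofReal_ne_top
  refine h.congr (Eventually.of_forall fun z => ?_)
  simp only [ENNReal.toReal_ofReal hp.le, Real.norm_eq_abs, abs_div, abs_abs, energyDensity]
  rw [abs_of_nonneg (Real.rpow_nonneg (norm_nonneg _) _),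
    Real.div_rpow (abs_nonneg _) (by positivity), ← Real.rpow_mul (norm_nonneg _)]
  congr 2
  field_simp

lemma MemW.gagliardoEnergy_eq {u : Euc n → ℝ} (hu : MemW Ω s p u) (hp : 0 < p) :
    gagliardoEnergy Ω s p u = ∫ z, energyDensity s p u z ∂((vol Ω).prod (vol Ω)) := by
  rw [integral_prod _ (hu.integrable_energyDensity hp), gagliardoEnergy]
  simp only [energyDensity]
  congr 1; ext y; congr 1; ext x
  rw [abs_sub_comm, norm_sub_rev]

lemma norm_sub_le_diam (hbdd : Bornology.IsBounded Ω) {x y : Euc n} (hx : x ∈ Ω) (hy : y ∈ Ω) :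
    ‖x - y‖ ≤ Metric.diam Ω := by
  rw [← dist_eq_norm]; exact Metric.dist_le_diam_of_mem hbdd hx hy

/-- A function controlled by one in `W^{s,p}` up to Lipschitz terms is in `W^{s,p}`. -/
lemma MemW.of_bound (hopen : IsOpen Ω) (hbdd : Bornology.IsBounded Ω)
    (hps : (n : ℝ) / p + s ≤ 1) {u v : Euc n → ℝ} {C : ℝ} (hu : MemW Ω s p u)
    (hv : AEStronglyMeasurable v (vol Ω)) (h1 : ∀ᵐ x ∂(vol Ω), |v x| ≤ C * (|u x| + 1))
    (h2 : ∀ᵐ z ∂((vol Ω).prod (vol Ω)), |v z.1 - v z.2| ≤ C * (|u z.1 - u z.2| + ‖z.1 - z.2‖)) :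
    MemW Ω s p v := by
  have := isFiniteMeasure_vol hbdd
  constructor
  · have h : MemLp (fun x => |u x| + 1) (ENNReal.ofReal p) (vol Ω) :=
      hu.1.abs.add (memLp_const 1)
    refine h.of_le_mul (c := C) hv ?_
    filter_upwards [h1] with x hx
    rwa [Real.norm_eq_abs, Real.norm_eq_abs, abs_of_nonneg (a := |u x| + 1) (by positivity)]
  · have hm : Measurable (fun z : Euc n × Euc n => ‖z.1 - z.2‖ ^ ((n : ℝ) / p + s)) :=
      measurable_norm_diff_rpow _
    -- The Lipschitz term costs the kernel 1 - (n/p + s) ≥ 0 powers of the distance, which is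
    -- bounded on Ω. This is where n/p + s ≤ 1, true for large p, enters.
    have hb : MemLp (fun z : Euc n × Euc n => ‖z.1 - z.2‖ / ‖z.1 - z.2‖ ^ ((n : ℝ) / p + s))
        (ENNReal.ofReal p) ((vol Ω).prod (vol Ω)) := by
      refine MemLp.of_bound (((measurable_fst.sub measurable_snd).norm.div hm)).aestronglyMeasurable
        (Metric.diam Ω ^ (1 - ((n : ℝ) / p + s))) ?_
      filter_upwards [ae_mem_prod_vol hopen] with z hz
      have hd := norm_sub_le_diam hbdd hz.1 hz.2
      rw [Real.norm_eq_abs, abs_of_nonneg (by positivity)]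
      rcases (norm_nonneg (z.1 - z.2)).eq_or_lt with h0 | h0
      · rw [← h0, zero_div]; exact Real.rpow_nonneg Metric.diam_nonneg _
      · have : ‖z.1 - z.2‖ / ‖z.1 - z.2‖ ^ ((n : ℝ) / p + s)
            = ‖z.1 - z.2‖ ^ (1 - ((n : ℝ) / p + s)) := by
          rw [Real.rpow_sub h0, Real.rpow_one]
        rw [this]
        exact Real.rpow_le_rpow h0.le hd (by linarith)
    refine (hu.2.add hb).of_le_mul (c := C) ?_ ?_
    · exact ((aesm_diff hv).norm.aemeasurable.div hm.aemeasurable).aestronglyMeasurable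
    · filter_upwards [h2] with z hz
      rw [Real.norm_eq_abs, Real.norm_eq_abs, abs_div, Pi.add_apply, ← add_div,
        abs_of_nonneg (Real.rpow_nonneg (norm_nonneg (z.1 - z.2)) _),
        abs_of_nonneg (a := (|u z.1 - u z.2| + ‖z.1 - z.2‖) / _) (by positivity),
        ← mul_div_assoc, abs_abs]
      gcongr

lemma memW_zero : MemW Ω s p (fun _ => 0) := by
  constructor
  · exact MemLp.zero'
  · simp

/-- Integrability of the first variation of the energy. -/
lemma MemW.integrable_form {u v : Euc n → ℝ} (hp : 2 ≤ p) (hu : MemW Ω s p u)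
    (hv : MemW Ω s p v) :
    Integrable (fun z : Euc n × Euc n => oddPow p (u z.1 - u z.2) * (v z.1 - v z.2) /
      ‖z.1 - z.2‖ ^ ((n : ℝ) + s * p)) ((vol Ω).prod (vol Ω)) := by
  have hp0 : 0 < p := by linarith
  refine ((hu.integrable_energyDensity hp0).add (hv.integrable_energyDensity hp0)).mono' ?_ ?_
  · exact ((((continuous_oddPow hp).comp_aestronglyMeasurable (aesm_diff hu.aesm)).mul
      (aesm_diff hv.aesm)).aemeasurable.div
      (measurable_norm_diff_rpow _).aemeasurable).aestronglyMeasurable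
  · refine Eventually.of_forall fun z => ?_
    rw [Real.norm_eq_abs, abs_div, abs_mul, abs_oddPow (by linarith),
      abs_of_nonneg (Real.rpow_nonneg (norm_nonneg (z.1 - z.2)) _), Pi.add_apply, energyDensity,
      energyDensity, ← add_div]
    gcongr
    exact abs_mul_rpow_sub_one_le (by linarith) (abs_nonneg _) (abs_nonneg _)

lemma integrable_oddPow_mul {u v : Euc n → ℝ} (hp : 2 ≤ p) (hu : MemW Ω s p u)
    (hv : MemW Ω s p v) : Integrable (fun x => oddPow p (u x) * v x) (vol Ω) := by
  have hp0 : 0 < p := by linarith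
  refine ((hu.integrable_rpow hp0).add (hv.integrable_rpow hp0)).mono' ?_ ?_
  · exact (((continuous_oddPow hp).comp_aestronglyMeasurable hu.aesm).mul hv.aesm)
  · refine Eventually.of_forall fun x => ?_
    rw [Real.norm_eq_abs, abs_mul, abs_oddPow (by linarith), Pi.add_apply]
    exact abs_mul_rpow_sub_one_le (by linarith) (abs_nonneg _) (abs_nonneg _)

lemma MemW.sub_const (hopen : IsOpen Ω) (hbdd : Bornology.IsBounded Ω)
    (hps : (n : ℝ) / p + s ≤ 1) {v : Euc n → ℝ} (hv : MemW Ω s p v) (c : ℝ) :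
    MemW Ω s p (fun x => v x - c) := by
  refine MemW.of_bound hopen hbdd hps (C := 1 + |c|) hv
    (hv.aesm.sub aestronglyMeasurable_const) (Eventually.of_forall fun x => ?_)
    (Eventually.of_forall fun z => ?_)
  · have := abs_sub (v x) c
    nlinarith [abs_nonneg (v x), abs_nonneg c]
  · simp only [sub_sub_sub_cancel_right]
    nlinarith [abs_nonneg (v z.1 - v z.2), abs_nonneg c, norm_nonneg (z.1 - z.2),
      mul_nonneg (abs_nonneg c) (abs_nonneg (v z.1 - v z.2)),
      mul_nonneg (abs_nonneg c) (norm_nonneg (z.1 - z.2))]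

/-- Bounded Lipschitz functions are in `W^{s,p}`. -/
lemma memW_of_lipschitz (hopen : IsOpen Ω) (hbdd : Bornology.IsBounded Ω)
    (hps : (n : ℝ) / p + s ≤ 1) {v : Euc n → ℝ} (hv : Continuous v) {L M : ℝ}
    (hM : ∀ x ∈ Ω, |v x| ≤ M) (hL : ∀ x ∈ Ω, ∀ y ∈ Ω, |v x - v y| ≤ L * ‖x - y‖) :
    MemW Ω s p v := by
  refine MemW.of_bound hopen hbdd hps (C := max L M) memW_zero
    hv.aestronglyMeasurable ?_ ?_
  · filter_upwards [ae_mem_vol hopen] with x hx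
    simpa using (hM x hx).trans (le_max_right L M)
  · filter_upwards [ae_mem_prod_vol hopen] with z hz
    simp only [sub_self, abs_zero, zero_add]
    exact (hL _ hz.1 _ hz.2).trans (by gcongr; exact le_max_left _ _)

/-! ### The constraint and the Rayleigh quotient -/

lemma vol_univ_pos (hopen : IsOpen Ω) (hne : Ω.Nonempty) : 0 < vol Ω univ := by
  rw [vol, Measure.restrict_apply_univ]; exact hopen.measure_pos _ hne

/-- Every function in `W^{s,p}` can be shifted into the constraint. -/
lemma exists_shift (hopen : IsOpen Ω) (hne : Ω.Nonempty) (hbdd : Bornology.IsBounded Ω)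
    (hp : 2 ≤ p) {v : Euc n → ℝ} (hv : MemW Ω s p v) :
    ∃ c : ℝ, ∫ x, oddPow p (v x - c) ∂(vol Ω) = 0 := by
  have := isFiniteMeasure_vol hbdd
  have hp1 : 1 < p := by linarith
  have hpos : 0 < (vol Ω).real univ :=
    ENNReal.toReal_pos (vol_univ_pos hopen hne).ne' (measure_ne_top _ _)
  -- Instead of letting the shift tend to ±∞, v is deformed on the compact interval [-1, 1] into the
  -- constants 1 (at t = -1) and -1 (at t = 1). A single dominating function then suffices. A zero
  -- of F has |t| < 1, and homogeneity of the odd power rescales it to the shift t / (1 - |t|).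
  set F : ℝ → ℝ := fun t => ∫ x, oddPow p ((1 - |t|) * v x - t) ∂(vol Ω) with hF
  have hb : Integrable (fun x => (|v x| + 1) ^ p) (vol Ω) := by
    have h : MemLp (fun x => |v x| + 1) (ENNReal.ofReal p) (vol Ω) :=
      hv.1.abs.add (memLp_const 1)
    have h2 := h.integrable_norm_rpow (by simpa using by linarith) ENNReal.ofReal_ne_top
    rw [ENNReal.toReal_ofReal (by linarith)] at h2
    refine h2.congr (Eventually.of_forall fun x => ?_)
    simp only [Real.norm_eq_abs]
    rw [abs_of_nonneg (a := |v x| + 1) (by positivity)]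
  have hcont : ContinuousOn F (Icc (-1) 1) := by
    refine continuousOn_of_dominated (bound := fun x => (|v x| + 1) ^ p) ?_ ?_ hb ?_
    · intro t _
      exact (continuous_oddPow hp).comp_aestronglyMeasurable
        ((hv.aesm.const_mul _).sub aestronglyMeasurable_const)
    · intro t ht
      refine Eventually.of_forall fun x => ?_
      have ht1 : |t| ≤ 1 := abs_le.2 ht
      rw [Real.norm_eq_abs, abs_oddPow hp1]
      have h1 : |(1 - |t|) * v x - t| ≤ |v x| + 1 := by
        calc |(1 - |t|) * v x - t| ≤ |(1 - |t|) * v x| + |t| := abs_sub _ _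
          _ = (1 - |t|) * |v x| + |t| := by rw [abs_mul, abs_of_nonneg (sub_nonneg.2 ht1)]
          _ ≤ _ := by nlinarith [abs_nonneg t, abs_nonneg (v x),
              mul_nonneg (abs_nonneg t) (abs_nonneg (v x))]
      calc |(1 - |t|) * v x - t| ^ (p - 1) ≤ (|v x| + 1) ^ (p - 1) :=
            Real.rpow_le_rpow (abs_nonneg _) h1 (by linarith)
        _ ≤ _ := Real.rpow_le_rpow_of_exponent_le (by linarith [abs_nonneg (v x)]) (by linarith)
    · refine Eventually.of_forall fun x => Continuous.continuousOn ?_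
      exact (continuous_oddPow hp).comp
        (((continuous_const.sub continuous_abs).mul continuous_const).sub continuous_id)
  have h1 : F 1 ≤ 0 := by
    simp only [hF, abs_one, sub_self, zero_mul, zero_sub, oddPow_neg]
    simp [oddPow]
  have h1' : F 1 ≠ 0 := by
    simp only [hF, abs_one, sub_self, zero_mul, zero_sub, oddPow_neg]
    simp [oddPow, hpos.ne']
  have h2 : 0 ≤ F (-1) := by
    simp only [hF, abs_neg, abs_one, sub_self, zero_mul, zero_sub, neg_neg]
    simp [oddPow]
  have h2' : F (-1) ≠ 0 := by
    simp only [hF, abs_neg, abs_one, sub_self, zero_mul, zero_sub, neg_neg]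
    simp [oddPow, hpos.ne']
  obtain ⟨t, ht, h0⟩ := intermediate_value_Icc' (by norm_num) hcont ⟨h1, h2⟩
  have htlt : |t| < 1 := by
    refine abs_lt.2 ⟨lt_of_le_of_ne ht.1 ?_, lt_of_le_of_ne ht.2 ?_⟩
    · rintro rfl; exact h2' h0
    · rintro rfl; exact h1' h0
  have hd : 0 < 1 - |t| := sub_pos.2 htlt
  refine ⟨t / (1 - |t|), ?_⟩
  have e : F t = (1 - |t|) ^ (p - 1) * ∫ x, oddPow p (v x - t / (1 - |t|)) ∂(vol Ω) := by
    simp only [hF]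
    rw [← integral_const_mul]
    congr 1; ext x
    rw [← oddPow_mul_left hp1 hd.le]
    congr 1; field_simp
  rw [h0] at e
  exact (mul_eq_zero.1 e.symm).resolve_left (by positivity)

lemma gagliardoEnergy_nonneg (Ω : Set (Euc n)) (s p : ℝ) (u : Euc n → ℝ) :
    0 ≤ gagliardoEnergy Ω s p u :=
  integral_nonneg fun _ => integral_nonneg fun _ => by positivity

lemma eigenvalue_nonneg (Ω : Set (Euc n)) (s p : ℝ) : 0 ≤ eigenvalue Ω s p := by
  refine Real.sInf_nonneg ?_
  rintro _ ⟨u, -, rfl⟩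
  exact div_nonneg (gagliardoEnergy_nonneg Ω s p u) (integral_nonneg fun _ => by positivity)

lemma MemW.integral_rpow_eq_zero_iff {u : Euc n → ℝ} (hu : MemW Ω s p u) (hp : 0 < p) :
    ∫ x, |u x| ^ p ∂(vol Ω) = 0 ↔ u =ᵐ[vol Ω] 0 := by
  rw [integral_eq_zero_iff_of_nonneg (fun _ => by positivity) (hu.integrable_rpow hp)]
  refine ⟨fun h => ?_, fun h => ?_⟩
  · filter_upwards [h] with x hx
    simpa using (Real.rpow_eq_zero (abs_nonneg _) hp.ne').1 hx
  · filter_upwards [h] with x hx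
    simp [hx, Real.zero_rpow hp.ne']

/-- The Rayleigh quotient bound without the non-triviality requirement. -/
lemma eigenvalue_mul_le (hp : 0 < p) {w : Euc n → ℝ} (hw : MemW Ω s p w)
    (h0 : ∫ x, oddPow p (w x) ∂(vol Ω) = 0) :
    eigenvalue Ω s p * ∫ x, |w x| ^ p ∂(vol Ω) ≤ gagliardoEnergy Ω s p w := by
  have hi : 0 ≤ ∫ x, |w x| ^ p ∂(vol Ω) := integral_nonneg fun _ => by positivity
  rcases hi.eq_or_lt with h | h
  · rw [← h, mul_zero]; exact gagliardoEnergy_nonneg Ω s p w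
  · rw [← le_div_iff₀ h]
    refine csInf_le ⟨0, ?_⟩ ⟨w, ⟨hw, fun h' => h.ne' ((hw.integral_rpow_eq_zero_iff hp).2 h'), h0⟩,
      rfl⟩
    rintro _ ⟨u, -, rfl⟩
    exact div_nonneg (gagliardoEnergy_nonneg Ω s p u) (integral_nonneg fun _ => by positivity)

lemma gagliardoEnergy_sub_const (Ω : Set (Euc n)) (s p : ℝ) (u : Euc n → ℝ) (c : ℝ) :
    gagliardoEnergy Ω s p (fun x => u x - c) = gagliardoEnergy Ω s p u := by
  simp [gagliardoEnergy]

lemma exists_eigenvalue_mul_le (hopen : IsOpen Ω) (hne : Ω.Nonempty)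
    (hbdd : Bornology.IsBounded Ω) (hp : 2 ≤ p) (hps : (n : ℝ) / p + s ≤ 1) {v : Euc n → ℝ}
    (hv : MemW Ω s p v) :
    ∃ c : ℝ, ∫ x, oddPow p (v x - c) ∂(vol Ω) = 0 ∧
      eigenvalue Ω s p * ∫ x, |v x - c| ^ p ∂(vol Ω) ≤ gagliardoEnergy Ω s p v := by
  obtain ⟨c, hc⟩ := exists_shift hopen hne hbdd hp hv
  refine ⟨c, hc, ?_⟩
  rw [← gagliardoEnergy_sub_const Ω s p v c]
  exact eigenvalue_mul_le (by linarith) (hv.sub_const hopen hbdd hps c) hc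

/-! ### First variation without differentiation -/

/-- Tangent inequality for the `L^p` norm at a constrained function. -/
lemma integral_rpow_add_le (hopen : IsOpen Ω) (hbdd : Bornology.IsBounded Ω) (hp : 2 ≤ p)
    (hps : (n : ℝ) / p + s ≤ 1) {u v : Euc n → ℝ} (hu : MemW Ω s p u) (hv : MemW Ω s p v)
    (h0 : ∫ x, oddPow p (u x) ∂(vol Ω) = 0) (c : ℝ) :
    ∫ x, |u x| ^ p ∂(vol Ω) + p * ∫ x, oddPow p (u x) * (v x - u x) ∂(vol Ω) ≤
      ∫ x, |v x - c| ^ p ∂(vol Ω) := by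
  have hp0 : 0 < p := by linarith
  have hvc := hv.sub_const hopen hbdd hps c
  have hone : MemW Ω s p (fun _ => c) :=
    memW_of_lipschitz hopen hbdd hps continuous_const (L := 0) (M := |c|) (by simp) (by simp)
  have i1 : Integrable (fun x => oddPow p (u x) * (v x - u x)) (vol Ω) := by
    simp only [mul_sub]
    exact (integrable_oddPow_mul hp hu hv).sub (integrable_oddPow_mul hp hu hu)
  have i2 : Integrable (fun x => oddPow p (u x) * c) (vol Ω) := integrable_oddPow_mul hp hu hone
  have i3 : Integrable (fun x => p * (oddPow p (u x) * (v x - u x) - oddPow p (u x) * c)) (vol Ω) :=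
    (i1.sub i2).const_mul p
  -- The constraint on u makes the first variation blind to constants, so c disappears from the
  -- tangent term.
  have e : ∫ x, oddPow p (u x) * (v x - u x) ∂(vol Ω)
      = ∫ x, oddPow p (u x) * (v x - u x) - oddPow p (u x) * c ∂(vol Ω) := by
    rw [integral_sub i1 i2, integral_mul_const, h0, zero_mul, sub_zero]
  rw [e, ← integral_const_mul, ← integral_add (hu.integrable_rpow hp0) i3]
  refine integral_mono ((hu.integrable_rpow hp0).add i3)
    (hvc.integrable_rpow hp0) fun x => ?_
  have := tangent_le_abs_rpow (p := p) (by linarith) (u x) (v x - c)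
  simp only
  calc _ = |u x| ^ p + p * (oddPow p (u x) * (v x - c - u x)) := by ring
    _ ≤ _ := this

/-- A one-sided Euler–Lagrange inequality for minimizers. -/
lemma IsNormalizedMinimizer.variation (hopen : IsOpen Ω) (hne : Ω.Nonempty)
    (hbdd : Bornology.IsBounded Ω) (hp : 2 ≤ p) (hps : (n : ℝ) / p + s ≤ 1) {u v : Euc n → ℝ}
    (hu : IsNormalizedMinimizer Ω s p u) (hv : MemW Ω s p v)
    (hd : MemW Ω s p (fun x => v x - u x)) :
    eigenvalue Ω s p * ∫ x, oddPow p (u x) * (v x - u x) ∂(vol Ω) ≤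
      ∫ z : Euc n × Euc n, oddPow p (v z.1 - v z.2) * ((v z.1 - u z.1) - (v z.2 - u z.2)) /
        ‖z.1 - z.2‖ ^ ((n : ℝ) + s * p) ∂((vol Ω).prod (vol Ω)) := by
  have hp0 : 0 < p := by linarith
  obtain ⟨⟨huW, -, hu0⟩, hu1, huE⟩ := hu
  obtain ⟨c, -, h1⟩ := exists_eigenvalue_mul_le hopen hne hbdd hp hps hv
  have h2 := integral_rpow_add_le hopen hbdd hp hps huW hv hu0 c
  have h3 := mul_le_mul_of_nonneg_left h2 (eigenvalue_nonneg Ω s p)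
  rw [hu1] at h3
  have h4 : eigenvalue Ω s p * (1 + p * ∫ x, oddPow p (u x) * (v x - u x) ∂(vol Ω)) ≤
      gagliardoEnergy Ω s p v := h3.trans h1
  have iF := hv.integrable_form hp hd
  have h5 : gagliardoEnergy Ω s p v ≤ gagliardoEnergy Ω s p u +
      p * ∫ z : Euc n × Euc n, oddPow p (v z.1 - v z.2) * ((v z.1 - u z.1) - (v z.2 - u z.2)) /
        ‖z.1 - z.2‖ ^ ((n : ℝ) + s * p) ∂((vol Ω).prod (vol Ω)) := by
    rw [hv.gagliardoEnergy_eq hp0, huW.gagliardoEnergy_eq hp0, ← integral_const_mul,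
      ← integral_add (huW.integrable_energyDensity hp0) (iF.const_mul p)]
    refine integral_mono (hv.integrable_energyDensity hp0)
      ((huW.integrable_energyDensity hp0).add (iF.const_mul p)) fun z => ?_
    -- The tangent is taken at v rather than at u. The operator thus appears evaluated at the
    -- competitor, which is the function under control in the comparison principle, and no
    -- difference quotient is needed.
    have := tangent_le_abs_rpow (p := p) (by linarith) (v z.1 - v z.2) (u z.1 - u z.2)
    simp only [energyDensity]
    rw [← mul_div_assoc, ← add_div]
    gcongr
    linarith
  rw [huE] at h5
  have h6 : p * (eigenvalue Ω s p * ∫ x, oddPow p (u x) * (v x - u x) ∂(vol Ω)) ≤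
    p * ∫ z : Euc n × Euc n, oddPow p (v z.1 - v z.2) * ((v z.1 - u z.1) - (v z.2 - u z.2)) /
        ‖z.1 - z.2‖ ^ ((n : ℝ) + s * p) ∂((vol Ω).prod (vol Ω)) := by linarith
  exact le_of_mul_le_mul_left h6 hp0

/-! ### Mean values and energy -/

/-- The mean value of `u` over `B ∩ Ω`. -/
def meanOn (Ω : Set (Euc n)) (u : Euc n → ℝ) (B : Set (Euc n)) : ℝ :=
  (∫ x in B, u x ∂(vol Ω)) / (vol Ω).real B

lemma MemW.integrable (hbdd : Bornology.IsBounded Ω) (hp : 1 ≤ p) {u : Euc n → ℝ}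
    (hu : MemW Ω s p u) : Integrable u (vol Ω) := by
  have := isFiniteMeasure_vol hbdd
  exact hu.1.integrable (by simpa using hp)

lemma MemW.integrable_const_sub_rpow (hbdd : Bornology.IsBounded Ω) (hp : 0 < p)
    {u : Euc n → ℝ} (hu : MemW Ω s p u) (c : ℝ) :
    Integrable (fun x => |c - u x| ^ p) (vol Ω) := by
  have := isFiniteMeasure_vol hbdd
  have h := ((memLp_const c).sub hu.1).integrable_norm_rpow (by simpa using hp)
    ENNReal.ofReal_ne_top
  simpa [ENNReal.toReal_ofReal hp.le] using h

/-- Jensen's inequality for `|c - ·|^p`. -/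
lemma MemW.jensen (hbdd : Bornology.IsBounded Ω) (hp : 1 < p) {u : Euc n → ℝ}
    (hu : MemW Ω s p u) {B : Set (Euc n)} (hB : 0 < (vol Ω).real B)
    (c : ℝ) : (vol Ω).real B * |c - meanOn Ω u B| ^ p ≤ ∫ x in B, |c - u x| ^ p ∂(vol Ω) := by
  have := isFiniteMeasure_vol hbdd
  set m := meanOn Ω u B with hm
  have hi := (hu.integrable hbdd hp.le).integrableOn (s := B)
  have hc : IntegrableOn (fun _ : Euc n => m) B (vol Ω) := integrable_const m
  have hsub : IntegrableOn (fun x => m - u x) B (vol Ω) := hc.sub hi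
  have hz : ∫ x in B, (m - u x) ∂(vol Ω) = 0 := by
    rw [integral_sub hc hi, setIntegral_const, smul_eq_mul, hm, meanOn,
      mul_div_cancel₀ _ hB.ne', sub_self]
  -- The linear term m - u integrates to zero over B, so the tangent at c - m may be added for free.
  have e : (vol Ω).real B * |c - m| ^ p =
      ∫ x in B, (|c - m| ^ p + p * oddPow p (c - m) * (m - u x)) ∂(vol Ω) := by
    rw [integral_add (integrable_const _) (hsub.const_mul _), integral_const_mul, hz,
      setIntegral_const, smul_eq_mul]
    ring
  rw [e]
  refine integral_mono ((integrable_const _).add (hsub.const_mul _))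
    (hu.integrable_const_sub_rpow hbdd (by linarith) c).integrableOn fun x => ?_
  have := tangent_le_abs_rpow hp (c - m) (c - u x)
  simp only
  calc _ = |c - m| ^ p + p * (oddPow p (c - m) * (c - u x - (c - m))) := by ring
    _ ≤ _ := this

/-- The deviation from a mean value is controlled by the energy. -/
lemma MemW.integral_sub_mean_le (hopen : IsOpen Ω) (hbdd : Bornology.IsBounded Ω) (hs : 0 < s)
    (hp : 1 < p) {u : Euc n → ℝ} (hu : MemW Ω s p u) {A B : Set (Euc n)} (hA : MeasurableSet A)
    (hB : MeasurableSet B) (hBpos : 0 < (vol Ω).real B) {d : ℝ}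
    (hd0 : 0 ≤ d) (hd : ∀ x ∈ A, x ∈ Ω → ∀ y ∈ B, y ∈ Ω → ‖x - y‖ ≤ d) :
    (vol Ω).real B * ∫ x in A, |u x - meanOn Ω u B| ^ p ∂(vol Ω) ≤
      d ^ ((n : ℝ) + s * p) * gagliardoEnergy Ω s p u := by
  have := isFiniteMeasure_vol hbdd
  have hp0 : 0 < p := by linarith
  have hE := hu.integrable_energyDensity hp0
  have hpw : ∀ᵐ x ∂((vol Ω).restrict A), (vol Ω).real B * |u x - meanOn Ω u B| ^ p ≤
      d ^ ((n : ℝ) + s * p) * ∫ y, energyDensity s p u (x, y) ∂(vol Ω) := by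
    filter_upwards [ae_restrict_mem hA, ae_restrict_of_ae (ae_mem_vol hopen),
      ae_restrict_of_ae hE.prod_right_ae] with x hxA hx hix
    refine (hu.jensen hbdd hp hBpos (u x)).trans ?_
    rw [← integral_const_mul]
    -- For pairs at distance at most d, the power of the distance in the kernel can be traded for
    -- d^(n+sp).
    have h1 : ∫ y in B, |u x - u y| ^ p ∂(vol Ω) ≤
        ∫ y in B, d ^ ((n : ℝ) + s * p) * energyDensity s p u (x, y) ∂(vol Ω) := by
      refine integral_mono_ae (hu.integrable_const_sub_rpow hbdd hp0 (u x)).integrableOn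
        (hix.const_mul _).integrableOn ?_
      filter_upwards [ae_restrict_mem hB, ae_restrict_of_ae (ae_mem_vol hopen)] with y hyB hy
      have hxy := hd x hxA hx y hyB hy
      simp only [energyDensity]
      rcases (norm_nonneg (x - y)).eq_or_lt with h0 | h0
      · have : x = y := by rw [← sub_eq_zero]; exact norm_eq_zero.1 h0.symm
        subst this
        simp [Real.zero_rpow hp0.ne']
      · rw [← mul_div_assoc, le_div_iff₀ (by positivity), mul_comm]
        gcongr
    refine h1.trans (setIntegral_le_integral (hix.const_mul _) (Eventually.of_forall fun y => ?_))
    exact mul_nonneg (Real.rpow_nonneg hd0 _) (energyDensity_nonneg _ _ _ _)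
  have hiA : Integrable (fun x => |u x - meanOn Ω u B| ^ p) (vol Ω) := by
    simpa [abs_sub_comm] using hu.integrable_const_sub_rpow hbdd hp0 (meanOn Ω u B)
  have hiI : Integrable (fun x => ∫ y, energyDensity s p u (x, y) ∂(vol Ω)) (vol Ω) :=
    hE.integral_prod_left
  rw [← integral_const_mul]
  refine (integral_mono_ae (hiA.const_mul _).integrableOn (hiI.const_mul _).integrableOn
    hpw).trans ?_
  rw [integral_const_mul, hu.gagliardoEnergy_eq hp0, integral_prod _ hE]
  exact mul_le_mul_of_nonneg_left (setIntegral_le_integral hiI (Eventually.of_forall fun x =>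
    integral_nonneg fun y => energyDensity_nonneg _ _ _ _)) (Real.rpow_nonneg hd0 _)

/-- Two mean values differ by at most the energy allows. -/
lemma MemW.mean_sub_mean_le (hopen : IsOpen Ω) (hbdd : Bornology.IsBounded Ω)
    (hs : 0 < s)
    (hp : 1 < p) {u : Euc n → ℝ} (hu : MemW Ω s p u) {A B : Set (Euc n)} (hA : MeasurableSet A)
    (hB : MeasurableSet B) (hApos : 0 < (vol Ω).real A) (hBpos : 0 < (vol Ω).real B) {d : ℝ}
    (hd0 : 0 ≤ d) (hd : ∀ x ∈ A, x ∈ Ω → ∀ y ∈ B, y ∈ Ω → ‖x - y‖ ≤ d) :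
    |meanOn Ω u A - meanOn Ω u B| ^ p ≤
      d ^ ((n : ℝ) + s * p) * gagliardoEnergy Ω s p u / ((vol Ω).real A * (vol Ω).real B) := by
  have h1 := hu.integral_sub_mean_le hopen hbdd hs hp hA hB hBpos hd0 hd
  have h2 := hu.jensen hbdd hp hApos (meanOn Ω u B)
  simp only [abs_sub_comm (meanOn Ω u B)] at h2
  rw [le_div_iff₀ (by positivity)]
  calc _ = (vol Ω).real B * ((vol Ω).real A * |meanOn Ω u A - meanOn Ω u B| ^ p) := by ring
    _ ≤ (vol Ω).real B * ∫ x in A, |u x - meanOn Ω u B| ^ p ∂(vol Ω) := by gcongr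
    _ ≤ _ := h1

lemma vol_real_ball_pos (hbdd : Bornology.IsBounded Ω) {q : Euc n} {r : ℝ} (hr : 0 < r)
    (h : Metric.ball q r ⊆ Ω) : 0 < (vol Ω).real (Metric.ball q r) := by
  have := isFiniteMeasure_vol hbdd
  refine ENNReal.toReal_pos ?_ (measure_ne_top _ _)
  rw [vol, Measure.restrict_apply Metric.isOpen_ball.measurableSet, inter_eq_left.2 h]
  exact (Metric.measure_ball_pos _ _ hr).ne'

/-! ### Countable families of balls with fine finite nets -/

/-- A sequence of balls in `Ω` that contains arbitrarily fine finite nets. -/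
structure BallNet (Ω : Set (Euc n)) where
  center : ℕ → Euc n
  radius : ℕ → ℝ
  center_mem : ∀ i, center i ∈ Ω
  radius_pos : ∀ i, 0 < radius i
  ball_subset : ∀ i, Metric.ball (center i) (radius i) ⊆ Ω
  exists_net : ∀ ε > 0, ∃ T : Finset ℕ, (∀ i ∈ T, radius i ≤ ε) ∧
    Ω ⊆ ⋃ i ∈ T, Metric.ball (center i) ε

/-- The balls of a net. -/
def BallNet.ball (N : BallNet Ω) (i : ℕ) : Set (Euc n) := Metric.ball (N.center i) (N.radius i)

lemma BallNet.measurableSet_ball (N : BallNet Ω) (i : ℕ) : MeasurableSet (N.ball i) :=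
  Metric.isOpen_ball.measurableSet

lemma BallNet.vol_pos (N : BallNet Ω) (hbdd : Bornology.IsBounded Ω) (i : ℕ) :
    0 < (vol Ω).real (N.ball i) :=
  vol_real_ball_pos hbdd (N.radius_pos i) (N.ball_subset i)

/-- Total boundedness gives a finite net at each scale 1/(m+1), and openness a small ball around
each of its points. Two radii play different roles: the small balls lie in Ω and carry the mean
values, while the ε-balls used for covering may leave Ω. No regularity of ∂Ω is needed. -/
lemma exists_ballNet (hopen : IsOpen Ω) (hne : Ω.Nonempty) (hbdd : Bornology.IsBounded Ω) :
    Nonempty (BallNet Ω) := by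
  have hr : ∀ (ε : ℝ), 0 < ε → ∀ x ∈ Ω, ∃ r, 0 < r ∧ r ≤ ε ∧ Metric.ball x r ⊆ Ω := by
    intro ε hε x hx
    obtain ⟨r, hr, h⟩ := Metric.isOpen_iff.1 hopen x hx
    exact ⟨min r ε, lt_min hr hε, min_le_right _ _,
      (Metric.ball_subset_ball (min_le_left _ _)).trans h⟩
  have htb : TotallyBounded Ω := hbdd.isCompact_closure.totallyBounded.subset subset_closure
  have hfin : ∀ m : ℕ, ∃ t ⊆ Ω, t.Finite ∧ Ω ⊆ ⋃ y ∈ t, Metric.ball y (1 / ((m : ℝ) + 1)) :=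
    fun m => Metric.finite_approx_of_totallyBounded htb _ (by positivity)
  choose t htΩ htf htc using hfin
  have hr' : ∀ (m : ℕ) (x : Euc n), ∃ r : ℝ, x ∈ Ω →
      (0 < r ∧ r ≤ 1 / ((m : ℝ) + 1) ∧ Metric.ball x r ⊆ Ω) := by
    intro m x
    by_cases hx : x ∈ Ω
    · obtain ⟨r, h⟩ := hr (1 / ((m : ℝ) + 1)) (by positivity) x hx
      exact ⟨r, fun _ => h⟩
    · exact ⟨0, fun h => absurd h hx⟩
  choose r hr'' using hr'
  set S : Set (Euc n × ℝ) := ⋃ m, (fun x => (x, r m x)) '' t m with hS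
  have hSc : S.Countable := countable_iUnion fun m => ((htf m).image _).countable
  have hSne : S.Nonempty := by
    obtain ⟨x, hx⟩ := hne
    obtain ⟨y, hy, -⟩ := mem_iUnion₂.1 (htc 0 hx)
    exact ⟨(y, r 0 y), mem_iUnion.2 ⟨0, y, hy, rfl⟩⟩
  obtain ⟨f, hf⟩ := hSc.exists_eq_range hSne
  have hfS : ∀ i, ∃ m, (f i).1 ∈ t m ∧ (f i).2 = r m (f i).1 := by
    intro i
    obtain ⟨m, x, hx, h⟩ := mem_iUnion.1 (hf ▸ mem_range_self i : f i ∈ S)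
    refine ⟨m, ?_⟩
    rw [← h]; exact ⟨hx, rfl⟩
  refine ⟨⟨fun i => (f i).1, fun i => (f i).2, fun i => ?_, fun i => ?_, fun i => ?_, ?_⟩⟩
  · obtain ⟨m, h, -⟩ := hfS i
    exact htΩ m h
  · obtain ⟨m, h, h'⟩ := hfS i
    rw [h']; exact (hr'' m _ (htΩ m h)).1
  · obtain ⟨m, h, h'⟩ := hfS i
    simp only [h']; exact (hr'' m _ (htΩ m h)).2.2
  · intro ε hε
    obtain ⟨m, hm⟩ := exists_nat_one_div_lt hε
    have hg : ∀ x : Euc n, ∃ i, x ∈ t m → f i = (x, r m x) := by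
      intro x
      by_cases hx : x ∈ t m
      · obtain ⟨i, hi⟩ := (hf ▸ mem_iUnion.2 ⟨m, x, hx, rfl⟩ : (x, r m x) ∈ range f)
        exact ⟨i, fun _ => hi⟩
      · exact ⟨0, fun h => absurd h hx⟩
    choose g hg using hg
    classical
    refine ⟨(htf m).toFinset.image g, ?_, ?_⟩
    · intro i hi
      obtain ⟨x, hx, rfl⟩ := Finset.mem_image.1 hi
      have hx' := (htf m).mem_toFinset.1 hx
      rw [hg x hx']
      exact (hr'' m x (htΩ m hx')).2.1.trans hm.le
    · intro x hx
      obtain ⟨y, hy, hxy⟩ := mem_iUnion₂.1 (htc m hx)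
      refine mem_iUnion₂.2 ⟨g y, Finset.mem_image_of_mem _ ((htf m).mem_toFinset.2 hy), ?_⟩
      rw [hg y hy]
      exact Metric.ball_subset_ball hm.le hxy

/-! ### Upper bound for the eigenvalues -/

lemma diam_pos (hn : 1 ≤ n) (hopen : IsOpen Ω) (hne : Ω.Nonempty)
    (hbdd : Bornology.IsBounded Ω) : 0 < Metric.diam Ω := by
  have : Nonempty (Fin n) := ⟨⟨0, hn⟩⟩
  have hnt : Ω.Nontrivial := by
    rw [← not_subsingleton_iff]
    exact fun h => (hopen.measure_pos volume hne).ne' (h.measure_zero volume)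
  exact Metric.diam_pos hnt hbdd

lemma exists_lt_norm_sub_rpow (hs0 : 0 < s) {γ : ℝ} (hγ0 : 0 ≤ γ)
    (hγ : γ < Metric.diam Ω ^ s) : ∃ x ∈ Ω, ∃ y ∈ Ω, γ < ‖y - x‖ ^ s := by
  by_contra! h
  have h1 : Metric.diam Ω ≤ γ ^ (1 / s) := by
    refine Metric.diam_le_of_forall_dist_le (by positivity) fun x hx y hy => ?_
    have := Real.rpow_le_rpow (by positivity) (h y hy x hx) (z := 1 / s) (by positivity)
    rwa [← Real.rpow_mul (norm_nonneg _), mul_one_div_cancel hs0.ne', Real.rpow_one,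
      ← dist_eq_norm] at this
  have h2 := Real.rpow_le_rpow Metric.diam_nonneg h1 hs0.le
  rw [← Real.rpow_mul hγ0, one_div_mul_cancel hs0.ne', Real.rpow_one] at h2
  linarith

/-- Interpolation between a Hölder and a Lipschitz bound. -/
lemma rpow_div_rpow_le {δ t H L q k : ℝ} (hs1 : s < 1) (hδ : 0 ≤ δ) (ht : 0 ≤ t) (hH : 0 ≤ H)
    (hL : 0 ≤ L) (h1 : δ ≤ H * t ^ s) (h2 : δ ≤ L * t) (hk : 0 ≤ k) (hq : k / (1 - s) ≤ q) :
    δ ^ q / t ^ (s * q + k) ≤ H ^ (q - k / (1 - s)) * L ^ (k / (1 - s)) := by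
  have hs : 0 < 1 - s := by linarith
  set m := k / (1 - s) with hm
  have hm0 : 0 ≤ m := by positivity
  have hmk : m * (1 - s) = k := by rw [hm]; field_simp
  rcases ht.eq_or_lt with rfl | ht
  · have hδ0 : δ = 0 := le_antisymm (by simpa using h2) hδ
    rcases eq_or_ne (s * q + k) 0 with h0 | h0
    · rw [h0, Real.rpow_zero, div_one]
      rcases eq_or_ne q 0 with rfl | hq0
      · have : m = 0 := le_antisymm hq hm0
        simp [this]
      · rw [hδ0, Real.zero_rpow hq0]; positivity
    · rw [Real.zero_rpow h0, div_zero]; positivity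
  · rcases hδ.eq_or_lt with rfl | hδ
    · rcases eq_or_ne q 0 with rfl | hq0
      · have h0 : m = 0 := le_antisymm hq hm0
        have : k = 0 := by rw [← hmk, h0, zero_mul]
        simp [h0, this]
      · rw [Real.zero_rpow hq0, zero_div]; positivity
    · rw [div_le_iff₀ (by positivity)]
      -- Only the fixed number m of factors is estimated by the Lipschitz bound. The value of m is
      -- chosen so that s(q-m) + m = sq + k, which cancels the singularity exactly; the growth rate
      -- in q is the Hölder constant H alone.
      calc δ ^ q = δ ^ (q - m) * δ ^ m := by rw [← Real.rpow_add hδ]; congr 1; ring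
        _ ≤ (H * t ^ s) ^ (q - m) * (L * t) ^ m := by
            gcongr
        _ = H ^ (q - m) * L ^ m * t ^ (s * q + k) := by
            rw [Real.mul_rpow hH (by positivity), Real.mul_rpow hL ht.le, ← Real.rpow_mul ht.le]
            have : t ^ (s * q + k) = t ^ (s * (q - m)) * t ^ m := by
              rw [← Real.rpow_add ht]; congr 1; rw [← hmk]; ring
            rw [this]; ring

/-- Shifting the cone by η keeps its argument away from 0, where t^s fails to be Lipschitz. -/
lemma norm_add_rpow_lipschitz {η : ℝ} (hη : 0 < η) (hs0 : 0 ≤ s) (hs1 : s ≤ 1) (x₀ x y : Euc n) :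
    |(‖x - x₀‖ + η) ^ s - (‖y - x₀‖ + η) ^ s| ≤ η ^ (s - 1) * ‖x - y‖ := by
  have key : ∀ x y : Euc n,
      (‖x - x₀‖ + η) ^ s - (‖y - x₀‖ + η) ^ s ≤ η ^ (s - 1) * ‖x - y‖ := by
    intro x y
    refine (rpow_sub_rpow_le_mul hη (by linarith [norm_nonneg (x - x₀)])
      (by linarith [norm_nonneg (y - x₀)]) hs0 hs1).trans ?_
    gcongr
    have h := abs_norm_sub_norm_le (x - x₀) (y - x₀)
    rw [sub_sub_sub_cancel_right] at h
    simpa using h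
  rw [abs_le]
  constructor
  · have := key y x
    rw [norm_sub_rev y x] at this
    linarith
  · exact key x y

/-- Subadditivity of t^s gives Hölder constant 1 whatever the shift; η = 0 is allowed, so the sharp
cone is included. -/
lemma norm_add_rpow_holder {η : ℝ} (hη : 0 ≤ η) (hs0 : 0 ≤ s) (hs1 : s ≤ 1) (x₀ x y : Euc n) :
    |(‖x - x₀‖ + η) ^ s - (‖y - x₀‖ + η) ^ s| ≤ ‖x - y‖ ^ s := by
  have key : ∀ x y : Euc n, (‖x - x₀‖ + η) ^ s - (‖y - x₀‖ + η) ^ s ≤ ‖x - y‖ ^ s := by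
    intro x y
    refine (rpow_sub_rpow_le (by positivity) (by positivity) hs0 hs1).trans ?_
    gcongr
    have h := abs_norm_sub_norm_le (x - x₀) (y - x₀)
    rw [sub_sub_sub_cancel_right] at h
    simpa using h
  rw [abs_le]
  constructor
  · have := key y x
    rw [norm_sub_rev y x] at this
    linarith
  · exact key x y

lemma eventually_exponent (n : ℕ) (hs1 : s < 1) (m : ℝ) :
    ∀ᶠ p : ℝ in atTop, 2 ≤ p ∧ (n : ℝ) / p + s ≤ 1 ∧ m ≤ p := by
  have h : Tendsto (fun p : ℝ => (n : ℝ) / p + s) atTop (𝓝 (0 + s)) :=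
    (tendsto_const_nhds.div_atTop tendsto_id).add tendsto_const_nhds
  filter_upwards [eventually_ge_atTop 2, h.eventually_le_const (u := 1) (by simpa using hs1),
    eventually_ge_atTop m] with p h1 h2 h3 using ⟨h1, h2, h3⟩

/-- Upper bound for the eigenvalues; it comes with admissible functions. -/
lemma eigenvalue_upper (hopen : IsOpen Ω) (hne : Ω.Nonempty)
    (hbdd : Bornology.IsBounded Ω) (hs0 : 0 < s) (hs1 : s < 1) {b : ℝ} (hD : 0 < Metric.diam Ω)
    (hb : 2 / Metric.diam Ω ^ s < b) :
    ∃ C, 0 < C ∧ ∀ᶠ p in atTop, (admissible Ω s p).Nonempty ∧ eigenvalue Ω s p ≤ C * b ^ p := by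
  have := isFiniteMeasure_vol hbdd
  have hDs : 0 < Metric.diam Ω ^ s := by positivity
  have hb0 : 0 < b := lt_trans (by positivity) hb
  -- The gap γ = 2/b is below D^s, so it is realized by two points of Ω, and half of it is exactly
  -- 1/b.
  have hγ : 2 / b < Metric.diam Ω ^ s := by
    rw [div_lt_iff₀ hDs] at hb; rw [div_lt_iff₀ hb0]; linarith
  obtain ⟨x₀, hx₀, y₀, hy₀, hxy⟩ := exists_lt_norm_sub_rpow hs0 (by positivity) hγ
  set γ := 2 / b with hγdef
  have hγ0 : 0 < γ := by positivity
  obtain ⟨η, hη, hηs⟩ : ∃ η : ℝ, 0 < η ∧ η ^ s < ‖y₀ - x₀‖ ^ s - γ := by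
    refine ⟨((‖y₀ - x₀‖ ^ s - γ) / 2) ^ (1 / s), Real.rpow_pos_of_pos (by linarith) _, ?_⟩
    rw [← Real.rpow_mul (by linarith), one_div_mul_cancel hs0.ne', Real.rpow_one]
    linarith
  set f : Euc n → ℝ := fun x => (‖x - x₀‖ + η) ^ s with hf
  have hfc : Continuous f :=
    Continuous.rpow_const ((continuous_id.sub continuous_const).norm.add continuous_const)
      fun _ => Or.inr hs0.le
  have hgap : γ < f y₀ - f x₀ := by
    simp only [hf, sub_self, norm_zero, zero_add]
    have : ‖y₀ - x₀‖ ^ s ≤ (‖y₀ - x₀‖ + η) ^ s := by gcongr; linarith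
    linarith
  obtain ⟨r, hr, hrΩx, hrΩy, hrf⟩ : ∃ r > 0, Metric.ball x₀ r ⊆ Ω ∧ Metric.ball y₀ r ⊆ Ω ∧
      ∀ x ∈ Metric.ball x₀ r, ∀ y ∈ Metric.ball y₀ r, γ < f y - f x := by
    have hcont : ContinuousAt (fun z : Euc n × Euc n => f z.2 - f z.1) (x₀, y₀) := by fun_prop
    have h1 := hcont.eventually (lt_mem_nhds hgap)
    rw [nhds_prod_eq] at h1
    obtain ⟨A, hA, B, hB, hAB⟩ := eventually_prod_iff.1 h1
    obtain ⟨r1, hr1, h1⟩ := Metric.eventually_nhds_iff_ball.1 (hA.and (hopen.mem_nhds hx₀))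
    obtain ⟨r2, hr2, h2⟩ := Metric.eventually_nhds_iff_ball.1 (hB.and (hopen.mem_nhds hy₀))
    refine ⟨min r1 r2, lt_min hr1 hr2, fun x hx => ?_, fun x hx => ?_, fun x hx y hy => ?_⟩
    · exact (h1 x (Metric.ball_subset_ball (min_le_left _ _) hx)).2
    · exact (h2 x (Metric.ball_subset_ball (min_le_right _ _) hx)).2
    · exact hAB (h1 x (Metric.ball_subset_ball (min_le_left _ _) hx)).1
        (h2 y (Metric.ball_subset_ball (min_le_right _ _) hy)).1
  set L := η ^ (s - 1) with hL
  have hL0 : 0 < L := by positivity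
  have hLip : ∀ x y, |f x - f y| ≤ L * ‖x - y‖ := norm_add_rpow_lipschitz hη hs0.le hs1.le x₀
  have hHol : ∀ x y, |f x - f y| ≤ 1 * ‖x - y‖ ^ s := fun x y => by
    rw [one_mul]; exact norm_add_rpow_holder hη.le hs0.le hs1.le x₀ x y
  set m := (n : ℝ) / (1 - s) with hm
  have hs' : 0 < 1 - s := by linarith
  set β := min ((vol Ω).real (Metric.ball x₀ r)) ((vol Ω).real (Metric.ball y₀ r)) with hβ
  have hβ0 : 0 < β := lt_min (vol_real_ball_pos hbdd hr hrΩx) (vol_real_ball_pos hbdd hr hrΩy)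
  set V := ((vol Ω).prod (vol Ω)).real univ with hV
  have hL' : 0 ≤ L ^ m * V := by positivity
  refine ⟨(L ^ m * V + 1) / β, by positivity, ?_⟩
  filter_upwards [eventually_exponent n hs1 m] with p ⟨hp2, hps, hpm⟩
  have hp0 : 0 < p := by linarith
  have hfW : MemW Ω s p f := by
    refine memW_of_lipschitz hopen hbdd hps hfc (L := L) (M := (Metric.diam Ω + η) ^ s) ?_
      fun x _ y _ => hLip x y
    intro x hx
    simp only [hf]
    rw [abs_of_nonneg (by positivity)]
    gcongr
    exact norm_sub_le_diam hbdd hx hx₀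
  obtain ⟨c, hc0, hc⟩ := exists_eigenvalue_mul_le hopen hne hbdd hp2 hps hfW
  -- Since the Hölder constant is 1, interpolation bounds the energy density by a constant
  -- independent of p.
  have hE : gagliardoEnergy Ω s p f ≤ L ^ m * V := by
    rw [hfW.gagliardoEnergy_eq hp0]
    calc _ ≤ ∫ _, L ^ m ∂((vol Ω).prod (vol Ω)) := by
          refine integral_mono (hfW.integrable_energyDensity hp0) (integrable_const _) fun z => ?_
          have := rpow_div_rpow_le (k := n) hs1 (abs_nonneg (f z.1 - f z.2))
            (norm_nonneg (z.1 - z.2)) zero_le_one hL0.le (hHol _ _) (hLip _ _) (by positivity) hpm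
          rw [Real.one_rpow, one_mul] at this
          simpa only [energyDensity, add_comm] using this
      _ = _ := by rw [integral_const, smul_eq_mul, mul_comm]
  have hi : Integrable (fun x => |f x - c| ^ p) (vol Ω) :=
    (hfW.sub_const hopen hbdd hps c).integrable_rpow hp0
  have hlow : β * (γ / 2) ^ p ≤ ∫ x, |f x - c| ^ p ∂(vol Ω) := by
    have aux : ∀ q, β ≤ (vol Ω).real (Metric.ball q r) →
        (∀ x ∈ Metric.ball q r, γ / 2 ≤ |f x - c|) →
        β * (γ / 2) ^ p ≤ ∫ x, |f x - c| ^ p ∂(vol Ω) := by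
      intro q hq h
      calc β * (γ / 2) ^ p ≤ (vol Ω).real (Metric.ball q r) * (γ / 2) ^ p := by gcongr
        _ = ∫ x in Metric.ball q r, (γ / 2) ^ p ∂(vol Ω) := by
            rw [setIntegral_const, smul_eq_mul]
        _ ≤ ∫ x in Metric.ball q r, |f x - c| ^ p ∂(vol Ω) := by
            refine setIntegral_mono_on (integrable_const _).integrableOn hi.integrableOn
              Metric.isOpen_ball.measurableSet fun x hx => ?_
            exact Real.rpow_le_rpow (by positivity) (h x hx) hp0.le
        _ ≤ _ := setIntegral_le_integral hi (Eventually.of_forall fun x => by positivity)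
    -- The shift c is unknown and depends on p, but it cannot be within γ/2 of values of f on both
    -- balls.
    by_cases hcase : ∀ x ∈ Metric.ball x₀ r, f x ≤ c - γ / 2
    · refine aux x₀ (min_le_left _ _) fun x hx => ?_
      rw [abs_sub_comm]
      exact le_trans (by linarith [hcase x hx]) (le_abs_self _)
    · push Not at hcase
      obtain ⟨x, hx, hxc⟩ := hcase
      refine aux y₀ (min_le_right _ _) fun y hy => ?_
      exact le_trans (by linarith [hrf x hx y hy]) (le_abs_self _)
  have hpos : 0 < β * (γ / 2) ^ p := by positivity
  refine ⟨⟨fun x => f x - c, hfW.sub_const hopen hbdd hps c, ?_, hc0⟩, ?_⟩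
  · intro h
    rw [← (hfW.sub_const hopen hbdd hps c).integral_rpow_eq_zero_iff hp0] at h
    linarith
  · have h1 : eigenvalue Ω s p * (β * (γ / 2) ^ p) ≤ L ^ m * V + 1 := by
      calc _ ≤ eigenvalue Ω s p * ∫ x, |f x - c| ^ p ∂(vol Ω) := by
            gcongr; exact eigenvalue_nonneg _ _ _
        _ ≤ _ := by linarith
    rw [← le_div_iff₀ hpos] at h1
    refine h1.trans (le_of_eq ?_)
    have : γ / 2 = b⁻¹ := by rw [hγdef]; field_simp
    rw [this, Real.inv_rpow hb0.le]
    field_simp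

/-! ### Lower bound for the eigenvalues and the first limit -/

lemma exists_pos_le_finset (T : Finset ℕ) {f : ℕ → ℝ} (hf : ∀ i, 0 < f i) :
    ∃ β, 0 < β ∧ ∀ i ∈ T, β ≤ f i := by
  rcases T.eq_empty_or_nonempty with rfl | h
  · exact ⟨1, one_pos, by simp⟩
  · obtain ⟨i, -, hi⟩ := T.exists_min_image f h
    exact ⟨f i, hf i, hi⟩

lemma integral_le_sum_of_cover {α : Type*} [MeasurableSpace α] {μ : Measure α} {T : Finset ℕ}
    {A : ℕ → Set α} (hA : ∀ i, MeasurableSet (A i)) (hcov : ∀ᵐ x ∂μ, ∃ i ∈ T, x ∈ A i)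
    {f : α → ℝ} (hf : Integrable f μ) (hf0 : ∀ x, 0 ≤ f x) :
    ∫ x, f x ∂μ ≤ ∑ i ∈ T, ∫ x in A i, f x ∂μ := by
  have h : ∀ i ∈ T, Integrable ((A i).indicator f) μ := fun i _ => hf.indicator (hA i)
  simp_rw [← integral_indicator (hA _)]
  rw [← integral_finsetSum _ h]
  refine integral_mono_ae hf (integrable_finsetSum _ h) ?_
  filter_upwards [hcov] with x ⟨i, hi, hx⟩
  calc f x = (A i).indicator f x := (indicator_of_mem hx f).symm
    _ ≤ ∑ i ∈ T, (A i).indicator f x :=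
      Finset.single_le_sum (f := fun i => (A i).indicator f x)
        (fun j _ => indicator_nonneg (fun y _ => hf0 y) x) hi

/-- Points of a covering ball are close to points of the corresponding ball of the net. -/
lemma BallNet.norm_sub_le (N : BallNet Ω) {i : ℕ} {ε : ℝ} (hr : N.radius i ≤ ε) {x y : Euc n}
    (hx : x ∈ Metric.ball (N.center i) ε) (hy : y ∈ N.ball i) : ‖x - y‖ ≤ 2 * ε := by
  have h1 := Metric.mem_ball.1 hx
  have h2 := Metric.mem_ball'.1 hy
  rw [← dist_eq_norm]
  linarith [dist_triangle x (N.center i) y]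

/-- A Poincaré inequality whose rate approaches the optimal D^s/2 as θ → 0. On each covering ball, u
is close to the mean over the corresponding small ball, and this mean is within half the oscillation
of the means from their midrange. The constant C depends on θ and Ω but not on p. -/
lemma integral_rpow_le_energy (hopen : IsOpen Ω) (hne : Ω.Nonempty)
    (hbdd : Bornology.IsBounded Ω) (hs0 : 0 < s) (hD : 0 < Metric.diam Ω) {θ : ℝ} (h0 : 0 < θ)
    (h1 : θ < 1) : ∃ C, 0 < C ∧ ∀ p, 2 ≤ p → (n : ℝ) / p + s ≤ 1 → ∀ u, MemW Ω s p u →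
      ∫ x, oddPow p (u x) ∂(vol Ω) = 0 →
      ∫ x, |u x| ^ p ∂(vol Ω) ≤
        C * (Metric.diam Ω ^ s / (2 * (1 - θ))) ^ p * gagliardoEnergy Ω s p u := by
  have := isFiniteMeasure_vol hbdd
  obtain ⟨N⟩ := exists_ballNet hopen hne hbdd
  set D := Metric.diam Ω with hDdef
  have h1' : 0 < 1 - θ := by linarith
  have hDs : 0 < D ^ s := by positivity
  -- Chosen so that (2ε)^s = θ D^s / 2: after division by θ in the splitting, the local deviation
  -- has base D^s/2, below that of the oscillation term.
  set ε := (θ * D ^ s / 2) ^ (1 / s) / 2 with hε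
  have hε0 : 0 < ε := by positivity
  have hεs : (2 * ε) ^ s = θ * D ^ s / 2 := by
    rw [hε, mul_div_cancel₀ _ two_ne_zero, ← Real.rpow_mul (by positivity),
      one_div_mul_cancel hs0.ne', Real.rpow_one]
  obtain ⟨T, hTr, hTc⟩ := N.exists_net ε hε0
  obtain ⟨β, hβ, hβT⟩ := exists_pos_le_finset T (N.vol_pos hbdd)
  have hTne : T.Nonempty := by
    obtain ⟨x, hx⟩ := hne
    obtain ⟨i, hi, -⟩ := mem_iUnion₂.1 (hTc hx)
    exact ⟨i, hi⟩
  set V := (vol Ω).real univ with hV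
  set R := D ^ s / (2 * (1 - θ)) with hR
  have hR0 : 0 < R := by positivity
  have hTcard : 0 < (T.card : ℝ) := by exact_mod_cast hTne.card_pos
  refine ⟨T.card * ((2 * ε) ^ (n : ℝ) / β + V * (D ^ (n : ℝ) / (β * β))), by positivity, ?_⟩
  intro p hp hps u hu hu0
  have hp0 : 0 < p := by linarith
  set E := gagliardoEnergy Ω s p u with hE
  have hE0 : 0 ≤ E := gagliardoEnergy_nonneg _ _ _ _
  set a : ℕ → ℝ := fun i => meanOn Ω u (N.ball i) with ha
  obtain ⟨i1, hi1, hmax⟩ := T.exists_max_image a hTne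
  obtain ⟨i2, hi2, hmin⟩ := T.exists_min_image a hTne
  -- The midrange of the means, rather than any single one of them, is what produces the factor 2 of
  -- the limit.
  set c := (a i1 + a i2) / 2 with hc
  set h := |a i1 - a i2| / 2 with hh
  have hac : ∀ i ∈ T, |a i - c| ≤ h := by
    intro i hi
    have e1 := hmax i hi
    have e2 := hmin i hi
    rw [hh, abs_of_nonneg (a := a i1 - a i2) (by linarith), abs_le, hc]
    constructor <;> linarith
  have hhp : (h / (1 - θ)) ^ p ≤ D ^ (n : ℝ) / (β * β) * R ^ p * E := by
    have e := hu.mean_sub_mean_le hopen hbdd hs0 (by linarith) (N.measurableSet_ball i1)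
      (N.measurableSet_ball i2) (N.vol_pos hbdd i1) (N.vol_pos hbdd i2) hD.le
      (fun x _ hx y _ hy => norm_sub_le_diam hbdd hx hy)
    have e1 : h / (1 - θ) = |a i1 - a i2| * (1 / (2 * (1 - θ))) := by rw [hh]; field_simp
    have e2 : D ^ ((n : ℝ) + s * p) = D ^ (n : ℝ) * (D ^ s) ^ p := by
      rw [Real.rpow_add hD, Real.rpow_mul hD.le]
    rw [e1, Real.mul_rpow (abs_nonneg _) (by positivity)]
    calc |a i1 - a i2| ^ p * (1 / (2 * (1 - θ))) ^ p
        ≤ (D ^ ((n : ℝ) + s * p) * E / (β * β)) * (1 / (2 * (1 - θ))) ^ p := by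
          gcongr
          refine e.trans ?_
          have := hβT i1 hi1
          have := hβT i2 hi2
          gcongr
      _ = _ := by
          rw [e2, hR, div_eq_mul_one_div (D ^ s) (2 * (1 - θ)),
            Real.mul_rpow (by positivity) (by positivity)]
          ring
  have hint : Integrable (fun x => |u x - c| ^ p) (vol Ω) :=
    (hu.sub_const hopen hbdd hps c).integrable_rpow hp0
  have hpiece : ∀ i ∈ T, ∫ x in Metric.ball (N.center i) ε, |u x - c| ^ p ∂(vol Ω) ≤
      ((2 * ε) ^ (n : ℝ) / β + V * (D ^ (n : ℝ) / (β * β))) * R ^ p * E := by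
    intro i hi
    have e := hu.integral_sub_mean_le hopen hbdd hs0 (by linarith)
      (A := Metric.ball (N.center i) ε) Metric.isOpen_ball.measurableSet
      (N.measurableSet_ball i) (N.vol_pos hbdd i) (by positivity : 0 ≤ 2 * ε)
      (fun x hx _ y hy _ => N.norm_sub_le (hTr i hi) hx hy)
    have hia : Integrable (fun x => |u x - a i| ^ p) (vol Ω) :=
      (hu.sub_const hopen hbdd hps (a i)).integrable_rpow hp0
    have e2 : (2 * ε) ^ ((n : ℝ) + s * p) = (2 * ε) ^ (n : ℝ) * (θ * D ^ s / 2) ^ p := by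
      rw [Real.rpow_add (by positivity), Real.rpow_mul (by positivity), hεs]
    have e3 : ∫ x in Metric.ball (N.center i) ε, |u x - a i| ^ p ∂(vol Ω) ≤
        (2 * ε) ^ ((n : ℝ) + s * p) * E / β := by
      rw [le_div_iff₀ hβ, mul_comm]
      refine le_trans ?_ e
      gcongr
      exact hβT i hi
    have e4 : ∫ x in Metric.ball (N.center i) ε, |u x - c| ^ p ∂(vol Ω) ≤
        ∫ x in Metric.ball (N.center i) ε, ((1 / θ) ^ p * |u x - a i| ^ p + (h / (1 - θ)) ^ p)
          ∂(vol Ω) := by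
      refine integral_mono hint.integrableOn
        ((hia.const_mul _).add (integrable_const _)).integrableOn fun x => ?_
      simp only
      rw [← Real.mul_rpow (by positivity) (abs_nonneg _), one_div_mul_eq_div]
      refine le_trans ?_ (add_rpow_le_of_split (abs_nonneg _) (by positivity) h0 h1 hp0.le)
      refine Real.rpow_le_rpow (abs_nonneg _) ?_ hp0.le
      calc |u x - c| = |(u x - a i) + (a i - c)| := by ring_nf
        _ ≤ |u x - a i| + |a i - c| := abs_add_le _ _
        _ ≤ _ := by gcongr; exact hac i hi
    refine e4.trans ?_
    rw [integral_add (hia.const_mul _).integrableOn (integrable_const _), integral_const_mul,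
      setIntegral_const, smul_eq_mul]
    have e5 : (vol Ω).real (Metric.ball (N.center i) ε) ≤ V := measureReal_mono (subset_univ _)
    have e6 : (1 / θ) ^ p * (θ * D ^ s / 2) ^ p ≤ R ^ p := by
      rw [← Real.mul_rpow (by positivity) (by positivity)]
      refine Real.rpow_le_rpow (by positivity) ?_ hp0.le
      rw [hR]
      calc 1 / θ * (θ * D ^ s / 2) = D ^ s / 2 := by field_simp
        _ ≤ _ := by gcongr; linarith
    calc _ ≤ (1 / θ) ^ p * ((2 * ε) ^ ((n : ℝ) + s * p) * E / β) +
          V * (D ^ (n : ℝ) / (β * β) * R ^ p * E) := by gcongr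
      _ = (2 * ε) ^ (n : ℝ) / β * ((1 / θ) ^ p * (θ * D ^ s / 2) ^ p) * E +
          V * (D ^ (n : ℝ) / (β * β) * R ^ p * E) := by rw [e2]; ring
      _ ≤ (2 * ε) ^ (n : ℝ) / β * R ^ p * E +
          V * (D ^ (n : ℝ) / (β * β) * R ^ p * E) := by gcongr
      _ = _ := by ring
  -- With v = u the tangent term vanishes: a function satisfying the constraint has the smallest
  -- p-norm among its translates by constants.
  have hle := integral_rpow_add_le hopen hbdd hp hps hu hu hu0 c
  simp only [sub_self, mul_zero, integral_zero, add_zero] at hle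
  refine hle.trans ((integral_le_sum_of_cover (T := T) (A := fun i => Metric.ball (N.center i) ε)
    (fun i => Metric.isOpen_ball.measurableSet) ?_ hint fun x => by positivity).trans ?_)
  · filter_upwards [ae_mem_vol hopen] with x hx
    obtain ⟨i, hi, h⟩ := mem_iUnion₂.1 (hTc hx)
    exact ⟨i, hi, h⟩
  · refine (Finset.sum_le_card_nsmul T _ _ hpiece).trans (le_of_eq ?_)
    rw [nsmul_eq_mul]; ring

/-- The first limit of the theorem. -/
theorem tendsto_eigenvalue (hn : 1 ≤ n) (hopen : IsOpen Ω) (hne : Ω.Nonempty)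
    (hbdd : Bornology.IsBounded Ω) (hs0 : 0 < s) (hs1 : s < 1) :
    Tendsto (fun p : ℝ => eigenvalue Ω s p ^ (1 / p)) atTop (𝓝 (2 / Metric.diam Ω ^ s)) := by
  have hD := diam_pos hn hopen hne hbdd
  have hDs : 0 < Metric.diam Ω ^ s := by positivity
  refine tendsto_rpow_inv_of_geometric (by positivity) ?_ ?_
  · intro b hb
    obtain ⟨C, hC, h⟩ := eigenvalue_upper hopen hne hbdd hs0 hs1 hD hb
    exact ⟨C, hC, h.mono fun p hp => hp.2⟩
  · intro b hb0 hb
    -- This value makes the rate in the Poincaré inequality equal to 1/b.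
    set θ := 1 - b * Metric.diam Ω ^ s / 2 with hθ
    have hθ0 : 0 < θ := by
      rw [lt_div_iff₀ hDs] at hb; linarith
    have hθ1 : θ < 1 := by
      have : 0 < b * Metric.diam Ω ^ s / 2 := by positivity
      linarith
    obtain ⟨C, hC, h⟩ := integral_rpow_le_energy hopen hne hbdd hs0 hD hθ0 hθ1
    have hR : Metric.diam Ω ^ s / (2 * (1 - θ)) = b⁻¹ := by rw [hθ]; field_simp; ring
    -- Used only for its admissible functions: a lower bound for an infimum in ℝ needs a nonempty
    -- set, as the infimum of the empty set has the default value 0.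
    obtain ⟨_, _, hA⟩ := eigenvalue_upper hopen hne hbdd hs0 hs1 hD
      (lt_add_one (2 / Metric.diam Ω ^ s))
    refine ⟨C⁻¹, by positivity, ?_⟩
    filter_upwards [eventually_exponent n hs1 0, hA] with p ⟨hp, hps, _⟩ hAp
    refine le_csInf (hAp.1.image _) ?_
    rintro _ ⟨u, ⟨huW, hune, hu0⟩, rfl⟩
    have hp0 : 0 < p := by linarith
    have hi : 0 < ∫ x, |u x| ^ p ∂(vol Ω) :=
      lt_of_le_of_ne (integral_nonneg fun _ => by positivity)
        fun h => hune ((huW.integral_rpow_eq_zero_iff hp0).1 h.symm)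
    have h2 := h p hp hps u huW hu0
    rw [hR, Real.inv_rpow hb0.le] at h2
    rw [le_div_iff₀ hi]
    have hbp : 0 < b ^ p := by positivity
    calc C⁻¹ * b ^ p * ∫ x, |u x| ^ p ∂(vol Ω)
        ≤ C⁻¹ * b ^ p * (C * (b ^ p)⁻¹ * gagliardoEnergy Ω s p u) := by gcongr
      _ = _ := by field_simp

/-! ### The limit problem λ₁(s,∞) -/

lemma ae_abs_le_toReal_eLpNorm {α : Type*} [MeasurableSpace α] {μ : Measure α} {f : α → ℝ}
    (hf : MemLp f ⊤ μ) : ∀ᵐ x ∂μ, |f x| ≤ (eLpNorm f ⊤ μ).toReal := by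
  have hfin : eLpNorm f ⊤ μ ≠ ⊤ := hf.2.ne
  rw [eLpNorm_exponent_top] at hfin ⊢
  filter_upwards [ae_le_eLpNormEssSup (f := f) (μ := μ)] with x hx
  rw [← Real.norm_eq_abs, ← toReal_enorm]
  exact ENNReal.toReal_mono hfin hx

lemma toReal_eLpNorm_top_le {α : Type*} [MeasurableSpace α] {μ : Measure α} {f : α → ℝ} {C : ℝ}
    (hC : 0 ≤ C) (h : ∀ᵐ x ∂μ, |f x| ≤ C) : (eLpNorm f ⊤ μ).toReal ≤ C := by
  rw [eLpNorm_exponent_top]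
  exact ENNReal.toReal_le_of_le_ofReal hC (eLpNormEssSup_le_of_ae_bound h)

section EssSup

variable {α : Type*} [MeasurableSpace α] {μ : Measure α} {f : α → ℝ} {C a : ℝ}

/-- The real-valued essential supremum is an infimum in a conditionally complete order. The absolute
bound and the nontriviality of μ keep the set of essential upper bounds bounded below. -/
lemma essSup_le_of_bound (hμ : μ ≠ 0) (hf : ∀ᵐ x ∂μ, |f x| ≤ C) (h : ∀ᵐ x ∂μ, f x ≤ a) :
    essSup f μ ≤ a := by
  have : (ae μ).NeBot := ae_neBot.2 hμ
  rw [essSup, limsup_eq]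
  refine csInf_le ⟨-C, fun b hb => ?_⟩ h
  obtain ⟨x, h1, h2⟩ := (hf.and hb).exists
  exact (neg_le_of_abs_le h1).trans h2

lemma ae_le_essSup_of_bound (hf : ∀ᵐ x ∂μ, |f x| ≤ C) : ∀ᵐ x ∂μ, f x ≤ essSup f μ :=
  ae_le_essSup ⟨C, eventually_map.2 (hf.mono fun _ h => (le_abs_self _).trans h)⟩

lemma essInf_eq_neg_essSup_neg : essInf f μ = -essSup (fun x => -f x) μ := by
  rw [essSup, limsup_eq, essInf, liminf_eq, Real.sInf_def, neg_neg]
  congr 1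
  ext b
  simp [neg_le_neg_iff]

end EssSup

lemma vol_ne_zero (hopen : IsOpen Ω) (hne : Ω.Nonempty) : vol Ω ≠ 0 := fun h => by
  have := vol_univ_pos hopen hne
  simp [h] at this

/-- On an open set, an almost everywhere bound for a continuous function holds everywhere. -/
lemma le_of_ae_le (hopen : IsOpen Ω) {f : Euc n → ℝ} (hf : ContinuousOn f Ω) {c : ℝ}
    (h : ∀ᵐ x ∂(vol Ω), f x ≤ c) {x : Euc n} (hx : x ∈ Ω) : f x ≤ c := by
  by_contra! hlt
  have hU : IsOpen (Ω ∩ f ⁻¹' Ioi c) := hf.isOpen_inter_preimage hopen isOpen_Ioi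
  have hpos := hU.measure_pos volume ⟨x, hx, hlt⟩
  have h0 : volume (Ω ∩ f ⁻¹' Ioi c) = 0 := by
    rw [vol, ae_restrict_iff' hopen.measurableSet] at h
    refine measure_mono_null ?_ h
    rintro y ⟨hy, hyc⟩ hcon
    exact absurd (hcon hy) (not_le.2 hyc)
  exact hpos.ne' h0

lemma essSup_eq_of_continuous (hopen : IsOpen Ω) (hne : Ω.Nonempty) {f : Euc n → ℝ}
    (hf : ContinuousOn f Ω) {c : ℝ} (hc : ∀ x ∈ Ω, |f x| ≤ c)
    (hsup : ∀ δ > 0, ∃ x ∈ Ω, c - δ < f x) : essSup f (vol Ω) = c := by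
  have hb : ∀ᵐ x ∂(vol Ω), |f x| ≤ c := (ae_mem_vol hopen).mono fun x hx => hc x hx
  refine le_antisymm (essSup_le_of_bound (vol_ne_zero hopen hne) hb
    (hb.mono fun x hx => (le_abs_self _).trans hx)) ?_
  refine le_of_forall_pos_lt_add fun δ hδ => ?_
  obtain ⟨x, hx, h⟩ := hsup δ hδ
  have := le_of_ae_le hopen hf (ae_le_essSup_of_bound hb) hx
  linarith

lemma holderQuotient_abs_le {f : Euc n → ℝ} {H : ℝ} (hH : 0 ≤ H) {z : Euc n × Euc n}
    (h : |f z.1 - f z.2| ≤ H * ‖z.1 - z.2‖ ^ s) : |holderQuotient s f z| ≤ H := by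
  rw [holderQuotient, abs_div, abs_of_nonneg (a := ‖z.1 - z.2‖ ^ s) (by positivity)]
  exact div_le_of_le_mul₀ (by positivity) hH h

/-- Hölder continuous functions with balanced extrema are admissible for `λ₁(s,∞)`. -/
lemma mem_admissibleInfty_of_holder (hopen : IsOpen Ω) (hne : Ω.Nonempty)
    (hbdd : Bornology.IsBounded Ω) {f : Euc n → ℝ} (hf : Continuous f) {H c : ℝ} (hH : 0 ≤ H)
    (hhol : ∀ x ∈ Ω, ∀ y ∈ Ω, |f x - f y| ≤ H * ‖x - y‖ ^ s) (hc0 : 0 < c)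
    (hc : ∀ x ∈ Ω, |f x| ≤ c) (hsup : ∀ δ > 0, ∃ x ∈ Ω, c - δ < f x)
    (hinf : ∀ δ > 0, ∃ x ∈ Ω, f x < -c + δ) :
    f ∈ admissibleInfty Ω s ∧ rayleighInfty Ω s f ≤ H / c := by
  have := isFiniteMeasure_vol hbdd
  have hb : ∀ᵐ x ∂(vol Ω), |f x| ≤ c := (ae_mem_vol hopen).mono fun x hx => hc x hx
  have hq : ∀ᵐ z ∂((vol Ω).prod (vol Ω)), |holderQuotient s f z| ≤ H :=
    (ae_mem_prod_vol hopen).mono fun z hz => holderQuotient_abs_le hH (hhol _ hz.1 _ hz.2)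
  have hqm : Measurable (holderQuotient s f) :=
    ((hf.comp continuous_fst).sub (hf.comp continuous_snd)).measurable.div
      (measurable_norm_diff_rpow s)
  have hL : MemLp f ⊤ (vol Ω) := MemLp.of_bound hf.aestronglyMeasurable c hb
  have hlow : c ≤ (eLpNorm f ⊤ (vol Ω)).toReal := by
    refine le_of_forall_pos_lt_add fun δ hδ => ?_
    obtain ⟨x, hx, h⟩ := hsup δ hδ
    have := le_of_ae_le hopen hf.continuousOn
      ((ae_abs_le_toReal_eLpNorm hL).mono fun x hx => (le_abs_self _).trans hx) hx
    linarith
  refine ⟨⟨⟨hL, MemLp.of_bound hqm.aestronglyMeasurable H hq⟩, ?_, ?_⟩, ?_⟩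
  · intro h0
    rw [eLpNorm_congr_ae h0] at hlow
    simp at hlow
    linarith
  · rw [essInf_eq_neg_essSup_neg, essSup_eq_of_continuous hopen hne hf.continuousOn hc hsup,
      essSup_eq_of_continuous (f := fun x => -f x) hopen hne hf.neg.continuousOn (by simpa using hc)]
    · ring
    · intro δ hδ
      obtain ⟨x, hx, h⟩ := hinf δ hδ
      exact ⟨x, hx, by linarith⟩
  · rw [rayleighInfty]
    exact div_le_div₀ hH (toReal_eLpNorm_top_le hH hq) hc0 hlow

/-- The lower bound for the `L^∞` Rayleigh quotient. -/
lemma le_rayleighInfty (hopen : IsOpen Ω) (hne : Ω.Nonempty) (hbdd : Bornology.IsBounded Ω)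
    (hs0 : 0 < s) (hD : 0 < Metric.diam Ω) {u : Euc n → ℝ} (hu : u ∈ admissibleInfty Ω s) :
    2 / Metric.diam Ω ^ s ≤ rayleighInfty Ω s u := by
  obtain ⟨⟨hL, hQ⟩, hne0, hbal⟩ := hu
  have hμ := vol_ne_zero hopen hne
  set S := essSup u (vol Ω) with hS
  set M := (eLpNorm u ⊤ (vol Ω)).toReal with hM
  set q := seminormInfty Ω s u with hq
  have hDs : 0 < Metric.diam Ω ^ s := by positivity
  have hb : ∀ᵐ x ∂(vol Ω), |u x| ≤ M := ae_abs_le_toReal_eLpNorm hL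
  have hb' : ∀ᵐ x ∂(vol Ω), |-u x| ≤ M := by simpa using hb
  -- Balanced extrema say that u and -u have the same essential supremum, which therefore bounds
  -- |u|.
  have hS' : essSup (fun x => -u x) (vol Ω) = S := by
    rw [essInf_eq_neg_essSup_neg] at hbal; linarith
  have hq0 : 0 ≤ q := ENNReal.toReal_nonneg
  have hMpos : 0 < M := by
    refine ENNReal.toReal_pos (fun h => hne0 ?_) hL.2.ne
    exact (eLpNorm_eq_zero_iff hL.1 (by simp)).1 h
  have habs : ∀ᵐ x ∂(vol Ω), |u x| ≤ S := by
    filter_upwards [ae_le_essSup_of_bound hb, ae_le_essSup_of_bound hb'] with x h1 h2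
    rw [hS'] at h2
    exact abs_le.2 ⟨by linarith, h1⟩
  have : (ae (vol Ω)).NeBot := ae_neBot.2 hμ
  have hS0 : 0 ≤ S := by
    obtain ⟨x, hx⟩ := habs.exists
    exact (abs_nonneg _).trans hx
  have hMS : M ≤ S := toReal_eLpNorm_top_le hS0 habs
  have hpair : ∀ᵐ x ∂(vol Ω), ∀ᵐ y ∂(vol Ω), u x - u y ≤ q * Metric.diam Ω ^ s := by
    have h1 := ae_abs_le_toReal_eLpNorm hQ
    have h2 := Measure.ae_ae_of_ae_prod (h1.and (ae_mem_prod_vol hopen))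
    filter_upwards [h2] with x hx
    filter_upwards [hx] with y ⟨hy, hxΩ, hyΩ⟩
    have hd := norm_sub_le_diam hbdd hxΩ hyΩ
    rcases (norm_nonneg (x - y)).eq_or_lt with h0 | h0
    · have : x = y := by rw [← sub_eq_zero]; exact norm_eq_zero.1 h0.symm
      rw [this, sub_self]; positivity
    · have h3 : (u x - u y) / ‖x - y‖ ^ s ≤ q := (le_abs_self _).trans hy
      rw [div_le_iff₀ (by positivity)] at h3
      refine h3.trans ?_
      gcongr
  -- The bound for pairs is turned into one for extrema by taking essential suprema successively in
  -- y and in x.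
  have h2S : 2 * S ≤ q * Metric.diam Ω ^ s := by
    have h1 : ∀ᵐ x ∂(vol Ω), u x ≤ q * Metric.diam Ω ^ s - S := by
      filter_upwards [hpair] with x hx
      have h2 : ∀ᵐ y ∂(vol Ω), -u y ≤ q * Metric.diam Ω ^ s - u x := by
        filter_upwards [hx] with y hy
        linarith
      have h3 := essSup_le_of_bound hμ hb' h2
      rw [hS'] at h3
      linarith
    have h3 := essSup_le_of_bound hμ hb h1
    linarith
  rw [rayleighInfty, div_le_div_iff₀ hDs hMpos]
  linarith

lemma exists_diam_eq (hne : Ω.Nonempty) (hbdd : Bornology.IsBounded Ω) :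
    ∃ x ∈ closure Ω, ∃ y ∈ closure Ω, ‖y - x‖ = Metric.diam Ω := by
  have hc : IsCompact (closure Ω ×ˢ closure Ω) :=
    hbdd.isCompact_closure.prod hbdd.isCompact_closure
  obtain ⟨z, hz, hmax⟩ := hc.exists_isMaxOn (hne.closure.prod hne.closure)
    (f := fun z : Euc n × Euc n => ‖z.2 - z.1‖) (by fun_prop)
  refine ⟨z.1, hz.1, z.2, hz.2, le_antisymm ?_ ?_⟩
  · rw [← Metric.diam_closure]
    exact norm_sub_le_diam hbdd.closure hz.2 hz.1
  · refine Metric.diam_le_of_forall_dist_le (norm_nonneg _) fun x hx y hy => ?_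
    rw [dist_eq_norm]
    exact hmax (a := (y, x)) ⟨subset_closure hy, subset_closure hx⟩

/-- The value of `λ₁(s,∞)`. -/
theorem eigenvalueInfty_eq (hn : 1 ≤ n) (hopen : IsOpen Ω) (hne : Ω.Nonempty)
    (hbdd : Bornology.IsBounded Ω) (hs0 : 0 < s) (hs1 : s < 1) :
    eigenvalueInfty Ω s = 2 / Metric.diam Ω ^ s := by
  have hD := diam_pos hn hopen hne hbdd
  have hDs : 0 < Metric.diam Ω ^ s := by positivity
  obtain ⟨x₀, hx₀, y₀, hy₀, hxy⟩ := exists_diam_eq hne hbdd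
  set D := Metric.diam Ω with hDdef
  -- The centred cone at one of two diametral points of the closure. Its extreme values ±D^s/2 may
  -- be attained only on ∂Ω, hence the approximation by points of Ω below.
  set f : Euc n → ℝ := fun x => ‖x - x₀‖ ^ s - D ^ s / 2 with hf
  have hfc : Continuous f :=
    (Continuous.rpow_const (continuous_id.sub continuous_const).norm
      fun _ => Or.inr hs0.le).sub continuous_const
  have hdense : ∀ z ∈ closure Ω, ∀ δ > 0, ∃ x ∈ Ω, |f x - f z| < δ := by
    intro z hz δ hδ
    have h1 : ∀ᶠ x in 𝓝 z, |f x - f z| < δ := by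
      have := hfc.continuousAt.eventually (Metric.ball_mem_nhds (f z) hδ)
      filter_upwards [this] with x hx using by simpa [Real.dist_eq] using hx
    obtain ⟨x, hx, h⟩ := mem_closure_iff_nhds.1 hz _ h1
    exact ⟨x, h, hx⟩
  have hfx : f x₀ = -(D ^ s / 2) := by simp [hf, Real.zero_rpow hs0.ne']
  have hfy : f y₀ = D ^ s / 2 := by simp only [hf, hxy]; ring
  have h := mem_admissibleInfty_of_holder (s := s) (H := 1) (c := D ^ s / 2) hopen hne hbdd hfc
    zero_le_one ?_ (by positivity) ?_ ?_ ?_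
  · refine le_antisymm ?_ ?_
    · have h1 : eigenvalueInfty Ω s ≤ rayleighInfty Ω s f := by
        refine csInf_le ⟨2 / D ^ s, ?_⟩ ⟨f, h.1, rfl⟩
        rintro _ ⟨u, hu, rfl⟩
        exact le_rayleighInfty hopen hne hbdd hs0 hD hu
      exact h1.trans (h.2.trans (le_of_eq (by field_simp)))
    · refine le_csInf ⟨_, f, h.1, rfl⟩ ?_
      rintro _ ⟨u, hu, rfl⟩
      exact le_rayleighInfty hopen hne hbdd hs0 hD hu
  · intro x _ y _
    have := norm_add_rpow_holder (le_refl (0 : ℝ)) hs0.le hs1.le x₀ x y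
    simpa [hf] using this
  · intro x hx
    have h1 : ‖x - x₀‖ ^ s ≤ D ^ s := by
      gcongr
      rw [hDdef, ← Metric.diam_closure]
      exact norm_sub_le_diam hbdd.closure (subset_closure hx) hx₀
    have h2 : 0 ≤ ‖x - x₀‖ ^ s := by positivity
    simp only [hf]
    rw [abs_le]
    constructor <;> linarith
  · intro δ hδ
    obtain ⟨x, hx, h⟩ := hdense y₀ hy₀ δ hδ
    exact ⟨x, hx, by linarith [(abs_lt.1 h).1]⟩
  · intro δ hδ
    obtain ⟨x, hx, h⟩ := hdense x₀ hx₀ δ hδ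
    exact ⟨x, hx, by linarith [(abs_lt.1 h).2]⟩

/-! ### Eigenvalue bounds, Hölder extension and regularization -/

lemma eventually_eigenvalue_le (hn : 1 ≤ n) (hopen : IsOpen Ω) (hne : Ω.Nonempty)
    (hbdd : Bornology.IsBounded Ω) (hs0 : 0 < s) (hs1 : s < 1) {b : ℝ}
    (hb : 2 / Metric.diam Ω ^ s < b) : ∀ᶠ p in atTop, eigenvalue Ω s p ≤ b ^ p := by
  filter_upwards [(tendsto_eigenvalue hn hopen hne hbdd hs0 hs1).eventually_lt_const hb,
    eventually_gt_atTop 0] with p h hp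
  have h1 := Real.rpow_le_rpow (Real.rpow_nonneg (eigenvalue_nonneg _ _ _) _) h.le hp.le
  rwa [← Real.rpow_mul (eigenvalue_nonneg _ _ _), one_div_mul_cancel hp.ne', Real.rpow_one] at h1

lemma eventually_le_eigenvalue (hn : 1 ≤ n) (hopen : IsOpen Ω) (hne : Ω.Nonempty)
    (hbdd : Bornology.IsBounded Ω) (hs0 : 0 < s) (hs1 : s < 1) {b : ℝ} (hb0 : 0 ≤ b)
    (hb : b < 2 / Metric.diam Ω ^ s) : ∀ᶠ p in atTop, b ^ p ≤ eigenvalue Ω s p := by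
  filter_upwards [(tendsto_eigenvalue hn hopen hne hbdd hs0 hs1).eventually_const_lt hb,
    eventually_gt_atTop 0] with p h hp
  have h1 := Real.rpow_le_rpow hb0 h.le hp.le
  rwa [← Real.rpow_mul (eigenvalue_nonneg _ _ _), one_div_mul_cancel hp.ne', Real.rpow_one] at h1

lemma ciInf_le_ciInf_add {ι : Type*} [Nonempty ι] {g h : ι → ℝ} {M : ℝ}
    (hg : BddBelow (range g)) (hgh : ∀ i, g i ≤ h i + M) : ⨅ i, g i ≤ (⨅ i, h i) + M := by
  rw [← sub_le_iff_le_add]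
  exact le_ciInf fun i => by linarith [ciInf_le hg i, hgh i]

/-- `s`-Hölder continuity with constant `H` on the whole space. -/
def IsHolder (s H : ℝ) (f : Euc n → ℝ) : Prop := ∀ x y, f x ≤ f y + H * ‖x - y‖ ^ s

lemma IsHolder.abs_sub_le {H : ℝ} {f : Euc n → ℝ} (h : IsHolder s H f) (x y : Euc n) :
    |f x - f y| ≤ H * ‖x - y‖ ^ s := by
  have h1 := h x y
  have h2 := h y x
  rw [norm_sub_rev] at h2
  rw [abs_le]
  constructor <;> linarith

lemma IsHolder.neg {H : ℝ} {f : Euc n → ℝ} (h : IsHolder s H f) :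
    IsHolder s H (fun x => -f x) := fun x y => by
  have := h y x
  rw [norm_sub_rev] at this
  linarith

lemma IsHolder.continuous {H : ℝ} {f : Euc n → ℝ} (hs0 : 0 < s) (h : IsHolder s H f) :
    Continuous f := by
  rw [continuous_iff_continuousAt]
  intro x
  rw [ContinuousAt, tendsto_iff_dist_tendsto_zero]
  have h1 : Tendsto (fun y => H * ‖y - x‖ ^ s) (𝓝 x) (𝓝 0) := by
    have hc : Continuous fun y : Euc n => H * ‖y - x‖ ^ s :=
      continuous_const.mul (Continuous.rpow_const (continuous_id.sub continuous_const).norm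
        fun _ => Or.inr hs0.le)
    have := hc.tendsto x
    simpa [Real.zero_rpow hs0.ne'] using this
  exact squeeze_zero (fun _ => dist_nonneg) (fun y => h.abs_sub_le y x) h1

/-- A McShane-type extension of compatible data on a sequence of balls. -/
lemma exists_holder_extension (hs0 : 0 < s) (hs1 : s < 1) {H : ℝ} (hH : 0 ≤ H) {q : ℕ → Euc n}
    {r : ℕ → ℝ} (hr : ∀ i, 0 < r i) {α : ℕ → ℝ}
    (hα : ∀ i l, |α i - α l| ≤ H * (‖q i - q l‖ + r i + r l) ^ s) :
    ∃ f : Euc n → ℝ, IsHolder s H f ∧ ∀ i x, |f x - α i| ≤ H * (‖x - q i‖ + r i) ^ s := by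
  -- Compatibility of the data together with subadditivity of t^s. It makes the infimum finite and
  -- also gives the lower half of the estimate for f - α i.
  have hlow : ∀ x i l, α i - H * (‖x - q i‖ + r i) ^ s ≤ α l + H * (‖x - q l‖ + r l) ^ s := by
    intro x i l
    have h1 := (abs_le.1 (hα i l)).2
    have h2 : (‖q i - q l‖ + r i + r l) ^ s ≤ (‖x - q i‖ + r i) ^ s + (‖x - q l‖ + r l) ^ s := by
      have hi := hr i
      have hl := hr l
      refine rpow_le_rpow_add_rpow (by positivity) (by positivity) (by positivity) hs0.le hs1.le ?_
      have := norm_sub_le_norm_sub_add_norm_sub (q i) x (q l)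
      rw [norm_sub_rev (q i) x] at this
      linarith
    have h3 := mul_le_mul_of_nonneg_left h2 hH
    linarith
  have hbd : ∀ x, BddBelow (range fun i => α i + H * (‖x - q i‖ + r i) ^ s) := by
    intro x
    refine ⟨α 0 - H * (‖x - q 0‖ + r 0) ^ s, ?_⟩
    rintro _ ⟨l, rfl⟩
    exact hlow x 0 l
  refine ⟨fun x => ⨅ i, α i + H * (‖x - q i‖ + r i) ^ s, ?_, ?_⟩
  · intro x y
    refine ciInf_le_ciInf_add (hbd x) fun i => ?_
    have h1 := (abs_le.1 (norm_add_rpow_holder (hr i).le hs0.le hs1.le (q i) x y)).2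
    have h3 := mul_le_mul_of_nonneg_left h1 hH
    linarith
  · intro i x
    have h1 := ciInf_le (hbd x) i
    have h2 := le_ciInf (hlow x i)
    rw [abs_le]
    constructor <;> linarith

/-- A Lipschitz regularization of a Hölder function from above, with the same Hölder constant. -/
lemma IsHolder.exists_regularization (hs0 : 0 < s) (hs1 : s < 1) {H : ℝ} (hH : 0 ≤ H)
    {f : Euc n → ℝ} (hf : IsHolder s H f) {η : ℝ} (hη : 0 < η) :
    ∃ g : Euc n → ℝ, IsHolder s H g ∧
      (∀ x y, |g x - g y| ≤ H * η ^ (s - 1) * ‖x - y‖) ∧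
      ∀ x, f x ≤ g x ∧ g x ≤ f x + H * η ^ s := by
  have hlow : ∀ x y, f x ≤ f y + H * (‖x - y‖ + η) ^ s := by
    intro x y
    refine (hf x y).trans ?_
    gcongr
    linarith
  have hbd : ∀ x, BddBelow (range fun y => f y + H * (‖x - y‖ + η) ^ s) := by
    intro x
    refine ⟨f x, ?_⟩
    rintro _ ⟨l, rfl⟩
    exact hlow x l
  have hLip : ∀ x y, (⨅ z, f z + H * (‖x - z‖ + η) ^ s) ≤
      (⨅ z, f z + H * (‖y - z‖ + η) ^ s) + H * η ^ (s - 1) * ‖x - y‖ := by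
    intro x y
    refine ciInf_le_ciInf_add (hbd x) fun z => ?_
    have h1 := (abs_le.1 (norm_add_rpow_lipschitz hη hs0.le hs1.le z x y)).2
    have h3 := mul_le_mul_of_nonneg_left h1 hH
    linarith
  -- An infimal convolution with the smoothed cone: every competitor is both s-Hölder with constant
  -- H and Lipschitz, and both properties pass to infima.
  refine ⟨fun x => ⨅ y, f y + H * (‖x - y‖ + η) ^ s, ?_, ?_, ?_⟩
  · intro x y
    refine ciInf_le_ciInf_add (hbd x) fun z => ?_
    have h1 := (abs_le.1 (norm_add_rpow_holder hη.le hs0.le hs1.le z x y)).2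
    have h3 := mul_le_mul_of_nonneg_left h1 hH
    linarith
  · intro x y
    have h1 := hLip x y
    have h2 := hLip y x
    rw [norm_sub_rev y x] at h2
    rw [abs_le]
    constructor <;> linarith
  · intro x
    refine ⟨le_ciInf (hlow x), ?_⟩
    have := ciInf_le (hbd x) x
    simpa using this

/-! ### Compactness: convergence in measure -/

lemma IsNormalizedMinimizer.memW {u : Euc n → ℝ} (h : IsNormalizedMinimizer Ω s p u) :
    MemW Ω s p u := h.1.1

/-- The bound depends on the ball but not on p, so all sequences of means lie in one product of
compact intervals. -/
lemma IsNormalizedMinimizer.abs_mean_le (hbdd : Bornology.IsBounded Ω) (hp : 1 < p)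
    {u : Euc n → ℝ} (h : IsNormalizedMinimizer Ω s p u) {B : Set (Euc n)}
    (hB : 0 < (vol Ω).real B) : |meanOn Ω u B| ≤ max 1 (1 / (vol Ω).real B) := by
  have h1 := h.memW.jensen hbdd hp hB 0
  simp only [zero_sub, abs_neg] at h1
  have h2 : ∫ x in B, |u x| ^ p ∂(vol Ω) ≤ 1 := by
    rw [← h.2.1]
    exact setIntegral_le_integral (h.memW.integrable_rpow (by linarith))
      (Eventually.of_forall fun x => by positivity)
  by_cases hm : |meanOn Ω u B| ≤ 1
  · exact hm.trans (le_max_left _ _)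
  · refine le_trans ?_ (le_max_right _ _)
    rw [le_div_iff₀ hB]
    calc |meanOn Ω u B| * (vol Ω).real B
        ≤ |meanOn Ω u B| ^ p * (vol Ω).real B := by
          gcongr
          have := Real.rpow_le_rpow_of_exponent_le (le_of_not_ge hm) hp.le
          rwa [Real.rpow_one] at this
      _ ≤ 1 := by linarith

/-- Minimizers subconverge in measure to a Hölder function with the optimal constant. -/
theorem exists_subseq_tendstoInMeasure (hn : 1 ≤ n) (hopen : IsOpen Ω) (hne : Ω.Nonempty)
    (hbdd : Bornology.IsBounded Ω) (hs0 : 0 < s) (hs1 : s < 1) {p : ℕ → ℝ}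
    {u : ℕ → Euc n → ℝ} (hp1 : ∀ k, 1 < p k) (hp : Tendsto p atTop atTop)
    (hu : ∀ k, IsNormalizedMinimizer Ω s (p k) (u k)) :
    ∃ (j : ℕ → ℕ) (f : Euc n → ℝ), StrictMono j ∧ IsHolder s (2 / Metric.diam Ω ^ s) f ∧
      ∀ δ > 0, Tendsto (fun k => (vol Ω).real {x | x ∈ Ω ∧ δ ≤ |u (j k) x - f x|}) atTop
        (𝓝 0) := by
  have := isFiniteMeasure_vol hbdd
  have hD := diam_pos hn hopen hne hbdd
  set Λ := 2 / Metric.diam Ω ^ s with hΛ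
  have hΛ0 : 0 < Λ := by positivity
  obtain ⟨N⟩ := exists_ballNet hopen hne hbdd
  set a : ℕ → ℕ → ℝ := fun k i => meanOn Ω (u k) (N.ball i) with ha
  -- Tychonoff's theorem replaces the diagonal argument: one subsequence serves for all balls.
  have hcomp : IsCompact (Set.pi univ fun i => Icc (-(max 1 (1 / (vol Ω).real (N.ball i))))
      (max 1 (1 / (vol Ω).real (N.ball i)))) := isCompact_univ_pi fun i => isCompact_Icc
  obtain ⟨α, -, j, hj, hlim⟩ := hcomp.tendsto_subseq (x := a) fun k i _ =>
    abs_le.1 ((hu k).abs_mean_le hbdd (hp1 k) (N.vol_pos hbdd i))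
  have hlim' : ∀ i, Tendsto (fun k => a (j k) i) atTop (𝓝 (α i)) := fun i =>
    (tendsto_pi_nhds.1 hlim) i
  have hpj : Tendsto (fun k => p (j k)) atTop atTop := hp.comp hj.tendsto_atTop
  have hα : ∀ i l, |α i - α l| ≤ Λ * (‖N.center i - N.center l‖ + N.radius i + N.radius l) ^ s := by
    intro i l
    set d := ‖N.center i - N.center l‖ + N.radius i + N.radius l with hd
    have hi := N.radius_pos i
    have hl := N.radius_pos l
    have hd0 : 0 < d := by positivity
    have hds : 0 < d ^ s := by positivity
    -- Taking p-th roots of the estimate for two means, the volume factors tend to 1 and the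
    -- eigenvalue contributes at most b.
    have key : ∀ b > Λ, |α i - α l| ≤ b * d ^ s := by
      intro b hb
      have hb0 : 0 < b := hΛ0.trans hb
      set C := d ^ (n : ℝ) / ((vol Ω).real (N.ball i) * (vol Ω).real (N.ball l)) with hC
      have hC0 : 0 < C := by
        have := N.vol_pos hbdd i
        have := N.vol_pos hbdd l
        positivity
      have ht1 : Tendsto (fun k => |a (j k) i - a (j k) l|) atTop (𝓝 |α i - α l|) :=
        ((hlim' i).sub (hlim' l)).abs
      have ht2 : Tendsto (fun k => C ^ (1 / p (j k)) * (b * d ^ s)) atTop (𝓝 (b * d ^ s)) := by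
        simpa using ((tendsto_const_rpow_inv hC0).comp hpj).mul_const (b * d ^ s)
      refine le_of_tendsto_of_tendsto ht1 ht2 ?_
      filter_upwards [hpj.eventually (eventually_eigenvalue_le hn hopen hne hbdd hs0 hs1 hb)]
        with k hk
      have hpk : 0 < p (j k) := by linarith [hp1 (j k)]
      have h1 := (hu (j k)).memW.mean_sub_mean_le hopen hbdd hs0 (hp1 (j k))
        (N.measurableSet_ball i) (N.measurableSet_ball l) (N.vol_pos hbdd i) (N.vol_pos hbdd l)
        hd0.le (fun x hx _ y hy _ => by
          have e1 := Metric.mem_ball.1 hx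
          have e2 := Metric.mem_ball'.1 hy
          have e3 := dist_triangle4 x (N.center i) (N.center l) y
          rw [dist_eq_norm x y, dist_eq_norm (N.center i)] at e3
          linarith)
      rw [(hu (j k)).2.2] at h1
      have h2 : |a (j k) i - a (j k) l| ^ p (j k) ≤ C * (b * d ^ s) ^ p (j k) := by
        refine h1.trans ?_
        rw [Real.rpow_add hd0, Real.rpow_mul hd0.le, Real.mul_rpow hb0.le hds.le, hC]
        have := N.vol_pos hbdd i
        have := N.vol_pos hbdd l
        calc _ ≤ d ^ (n : ℝ) * (d ^ s) ^ p (j k) * b ^ p (j k) /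
            ((vol Ω).real (N.ball i) * (vol Ω).real (N.ball l)) := by gcongr
          _ = _ := by ring
      have h3 := Real.rpow_le_rpow (by positivity) h2 (z := 1 / p (j k)) (by positivity)
      rwa [← Real.rpow_mul (abs_nonneg _), mul_one_div_cancel hpk.ne', Real.rpow_one,
        Real.mul_rpow hC0.le (by positivity), ← Real.rpow_mul (by positivity),
        mul_one_div_cancel hpk.ne', Real.rpow_one] at h3
    have h4 : |α i - α l| / d ^ s ≤ Λ :=
      le_of_forall_gt_imp_ge_of_dense fun b hb => (div_le_iff₀ hds).2 (key b hb)
    exact (div_le_iff₀ hds).1 h4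
  obtain ⟨f, hf, hfα⟩ := exists_holder_extension hs0 hs1 hΛ0.le N.radius_pos hα
  refine ⟨j, f, hj, hf, fun δ hδ => ?_⟩
  -- Here (2ε)^s = κ and (Λ+1)κ = δ/4. Against the threshold δ/2, Chebyshev's inequality leaves the
  -- factor (1/2)^p.
  set κ := δ / (4 * (Λ + 1)) with hκ
  have hκ0 : 0 < κ := by positivity
  set ε := κ ^ (1 / s) / 2 with hε
  have hε0 : 0 < ε := by positivity
  have hεs : (2 * ε) ^ s = κ := by
    rw [hε, mul_div_cancel₀ _ two_ne_zero, ← Real.rpow_mul hκ0.le, one_div_mul_cancel hs0.ne',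
      Real.rpow_one]
  have hκΛ : (Λ + 1) * κ = δ / 4 := by rw [hκ]; field_simp
  obtain ⟨T, hTr, hTc⟩ := N.exists_net ε hε0
  obtain ⟨β, hβ, hβT⟩ := exists_pos_le_finset T (N.vol_pos hbdd)
  have hev : ∀ᶠ k in atTop, ∀ i ∈ T, |a (j k) i - α i| < δ / 4 := by
    rw [Filter.eventually_all_finset]
    intro i _
    have := (hlim' i).eventually (Metric.ball_mem_nhds (α i) (by positivity : 0 < δ / 4))
    filter_upwards [this] with k hk using by simpa [Real.dist_eq] using hk
  have hgeo : Tendsto (fun k => T.card * ((2 * ε) ^ (n : ℝ) / β) * (1 / 2 : ℝ) ^ p (j k)) atTop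
      (𝓝 0) := by
    have h := (tendsto_rpow_atTop_of_base_lt_one (1 / 2 : ℝ) (by norm_num) (by norm_num)).comp hpj
    simpa using h.const_mul (T.card * ((2 * ε) ^ (n : ℝ) / β))
  refine squeeze_zero' (Eventually.of_forall fun k => measureReal_nonneg) ?_ hgeo
  filter_upwards [hev, hpj.eventually (eventually_eigenvalue_le hn hopen hne hbdd hs0 hs1
    (lt_add_one Λ))] with k hk hlam
  have hpk : 0 < p (j k) := by linarith [hp1 (j k)]
  -- Of the error δ, one quarter goes to the limit of the mean and one quarter to f near the ball,
  -- so the deviation of u from its mean must account for δ/2.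
  have hsub : {x | x ∈ Ω ∧ δ ≤ |u (j k) x - f x|} ⊆
      ⋃ i ∈ T, ({x | (δ / 2) ^ p (j k) ≤ |u (j k) x - a (j k) i| ^ p (j k)} ∩
        Metric.ball (N.center i) ε) := by
    rintro x ⟨hx, hxδ⟩
    obtain ⟨i, hi, hxi⟩ := mem_iUnion₂.1 (hTc hx)
    refine mem_iUnion₂.2 ⟨i, hi, ?_, hxi⟩
    refine Real.rpow_le_rpow (by positivity) ?_ hpk.le
    have e1 : |f x - α i| ≤ δ / 4 := by
      refine (hfα i x).trans ?_
      have hri := N.radius_pos i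
      calc Λ * (‖x - N.center i‖ + N.radius i) ^ s ≤ (Λ + 1) * (2 * ε) ^ s := by
            gcongr
            · linarith
            · have := Metric.mem_ball.1 hxi
              rw [dist_eq_norm] at this
              linarith [hTr i hi]
        _ = δ / 4 := by rw [hεs, hκΛ]
    have e2 := (hk i hi).le
    have e3 : |u (j k) x - f x| ≤ |u (j k) x - a (j k) i| + |a (j k) i - α i| + |f x - α i| := by
      rw [abs_sub_comm (f x)]
      calc |u (j k) x - f x|
          = |(u (j k) x - a (j k) i) + (a (j k) i - α i) + (α i - f x)| := by ring_nf
        _ ≤ _ := (abs_add_le _ _).trans (by gcongr; exact abs_add_le _ _)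
    linarith
  refine (measureReal_mono hsub (measure_ne_top _ _)).trans ((measureReal_biUnion_finset_le _ _).trans ?_)
  refine (Finset.sum_le_card_nsmul T _ ((2 * ε) ^ (n : ℝ) / β * (1 / 2 : ℝ) ^ p (j k))
    fun i hi => ?_).trans (le_of_eq (by rw [nsmul_eq_mul]; ring))
  rw [← measureReal_restrict_apply' Metric.isOpen_ball.measurableSet]
  have hia : Integrable (fun x => |u (j k) x - a (j k) i| ^ p (j k)) (vol Ω) := by
    simpa [abs_sub_comm] using (hu (j k)).memW.integrable_const_sub_rpow hbdd hpk (a (j k) i)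
  have h1 := mul_meas_ge_le_integral_of_nonneg
    (μ := (vol Ω).restrict (Metric.ball (N.center i) ε))
    (f := fun x => |u (j k) x - a (j k) i| ^ p (j k)) (Eventually.of_forall fun x => by positivity)
    hia.integrableOn ((δ / 2) ^ p (j k))
  have h2 := (hu (j k)).memW.integral_sub_mean_le hopen hbdd hs0 (hp1 (j k))
      (A := Metric.ball (N.center i) ε) Metric.isOpen_ball.measurableSet
      (N.measurableSet_ball i) (N.vol_pos hbdd i) (by positivity : 0 ≤ 2 * ε)
      (fun x hx _ y hy _ => N.norm_sub_le (hTr i hi) hx hy)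
  rw [(hu (j k)).2.2] at h2
  have h3 : β * ((δ / 2) ^ p (j k) * ((vol Ω).restrict (Metric.ball (N.center i) ε)).real
      {x | (δ / 2) ^ p (j k) ≤ |u (j k) x - a (j k) i| ^ p (j k)}) ≤
      (2 * ε) ^ ((n : ℝ) + s * p (j k)) * (Λ + 1) ^ p (j k) := by
    calc _ ≤ (vol Ω).real (N.ball i) * ∫ x in Metric.ball (N.center i) ε,
          |u (j k) x - a (j k) i| ^ p (j k) ∂(vol Ω) := by
            gcongr
            exact hβT i hi
      _ ≤ _ := h2
      _ ≤ _ := by gcongr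
  rw [Real.rpow_add (by positivity), Real.rpow_mul (by positivity), hεs] at h3
  have h4 : κ ^ p (j k) * (Λ + 1) ^ p (j k) = (δ / 2) ^ p (j k) * (1 / 2 : ℝ) ^ p (j k) := by
    rw [← Real.mul_rpow hκ0.le (by positivity), ← Real.mul_rpow (by positivity) (by positivity),
      mul_comm κ, hκΛ]
    congr 1; ring
  rw [mul_assoc, h4] at h3
  have h5 : 0 < (δ / 2) ^ p (j k) := by positivity
  rw [div_mul_eq_mul_div, le_div_iff₀ hβ]
  refine le_of_mul_le_mul_left ?_ h5
  calc _ = _ := by ring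
    _ ≤ _ := h3
    _ = _ := by ring

/-- The pointwise inequality behind the comparison principle. Here `a`, `b` are the values of
`(w - u)₊` at two points, `P` and `Q` the differences of `u` and of `w`. -/
lemma oddPow_variation_le {P Q a b K X Y : ℝ} (hp : 1 < p) (ha : 0 ≤ a) (hb : 0 ≤ b) (hK : 0 ≤ K)
    (hab : 0 < a → 0 < b → Q = P + (a - b))
    (hX : 0 < a → 0 < b → oddPow p Q * K ≤ X) (hY : 0 < a → 0 < b → oddPow p (-Q) * K ≤ Y)
    (hX0 : 0 < a → b = 0 → oddPow p (P + a / 2) * K ≤ X)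
    (hY0 : 0 < b → a = 0 → oddPow p (-P + b / 2) * K ≤ Y) :
    oddPow p (P + (a - b) / 2) * (a - b) * K ≤ X * a + Y * b := by
  rcases ha.eq_or_lt with rfl | ha <;> rcases hb.eq_or_lt with rfl | hb
  · simp
  · have h := mul_le_mul_of_nonneg_right (hY0 hb rfl) hb.le
    have e : oddPow p (P + (0 - b) / 2) = -oddPow p (-P + b / 2) := by
      rw [← oddPow_neg]; congr 1; ring
    rw [e]
    calc _ = oddPow p (-P + b / 2) * K * b := by ring
      _ ≤ _ := by linarith
  · have h := mul_le_mul_of_nonneg_right (hX0 ha rfl) ha.le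
    simp only [sub_zero, mul_zero, add_zero]
    calc _ = oddPow p (P + a / 2) * K * a := by ring
      _ ≤ _ := h
  · have hQ := hab ha hb
    -- If both points lie where w > u, the competitor's difference is the midpoint of P and Q;
    -- monotonicity of the odd power in the direction a - b moves it to Q, the difference of w.
    have h1 := oddPow_sub_mul_sub_nonneg hp Q (P + (a - b) / 2)
    have h2 : oddPow p (P + (a - b) / 2) * (a - b) ≤ oddPow p Q * (a - b) := by
      rw [hQ] at h1 ⊢
      nlinarith
    have h3 := mul_le_mul_of_nonneg_right (hX ha hb) ha.le
    have h4 := mul_le_mul_of_nonneg_right (hY ha hb) hb.le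
    calc _ ≤ oddPow p Q * (a - b) * K := by gcongr
      _ = oddPow p Q * K * a + oddPow p (-Q) * K * b := by rw [oddPow_neg]; ring
      _ ≤ _ := add_le_add h3 h4

/-- Comparison principle: `w` lies below the minimizer `u` if, wherever it does not, the operator
evaluated at `w` is too small. The operator is estimated by the constant `C`, improved to `-γ x`
for pairs `(x, y)` in `G`. -/
lemma IsNormalizedMinimizer.comparison (hopen : IsOpen Ω) (hne : Ω.Nonempty)
    (hbdd : Bornology.IsBounded Ω) (hp : 2 ≤ p) (hps : (n : ℝ) / p + s ≤ 1) {u w : Euc n → ℝ}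
    (hu : IsNormalizedMinimizer Ω s p u) {S : Set (Euc n)}
    (hw : AEStronglyMeasurable w (vol Ω)) {L M : ℝ} (hM : ∀ x ∈ S, x ∈ Ω → |w x| ≤ M)
    (hL : ∀ x ∈ S, x ∈ Ω → ∀ y ∈ Ω, |w x - w y| ≤ L * ‖x - y‖)
    (hoff : ∀ᵐ x ∂(vol Ω), x ∉ S → w x ≤ u x) {C : ℝ}
    (hC : ∀ x ∈ S, x ∈ Ω → ∀ y ∈ Ω, oddPow p (w x - w y) / ‖x - y‖ ^ ((n : ℝ) + s * p) ≤ C)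
    {G : Set (Euc n × Euc n)} (hG : MeasurableSet G) {γ : Euc n → ℝ}
    (hγint : MemW Ω s p (fun x => max (w x - u x) 0) →
      Integrable (fun x => γ x * max (w x - u x) 0) (vol Ω))
    (hgain : ∀ x ∈ S, x ∈ Ω → ∀ y ∈ Ω, (x, y) ∈ G → u x < w x →
      (u y < w y → oddPow p (w x - w y) / ‖x - y‖ ^ ((n : ℝ) + s * p) ≤ C - γ x) ∧
      (w y ≤ u y → oddPow p (u x + (w x - u x) / 2 - u y) / ‖x - y‖ ^ ((n : ℝ) + s * p) ≤
        C - γ x))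
    (hlt : ∀ x ∈ S, x ∈ Ω → u x < w x →
      2 * (C * (vol Ω).real univ - γ x * (vol Ω).real {y | (x, y) ∈ G}) <
        eigenvalue Ω s p * oddPow p (u x)) :
    ∀ᵐ x ∂(vol Ω), w x ≤ u x := by
  have := isFiniteMeasure_vol hbdd
  have hp1 : 1 < p := by linarith
  set ψ : Euc n → ℝ := fun x => max (w x - u x) 0 with hψ
  have hψ0 : ∀ x, 0 ≤ ψ x := fun x => le_max_right _ _
  have hψpos : ∀ x, 0 < ψ x → u x < w x := fun x hx => by
    by_contra! h
    exact hx.ne' (max_eq_right (by linarith))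
  have hψeq : ∀ x, u x < w x → ψ x = w x - u x := fun x hx => max_eq_left (by linarith)
  have hψz : ∀ x, w x ≤ u x → ψ x = 0 := fun x hx => max_eq_right (by linarith)
  have hψz' : ∀ x, ψ x = 0 → w x ≤ u x := fun x hx => by
    by_contra! h
    have := hψeq x h
    linarith
  have hψm : AEStronglyMeasurable ψ (vol Ω) := (hw.sub hu.memW.aesm).sup aestronglyMeasurable_const
  set A := 1 + |L| + |M| with hA
  have hA1 : 1 ≤ A := by linarith [abs_nonneg L, abs_nonneg M]
  have hψS : ∀ᵐ x ∂(vol Ω), x ∉ S → ψ x = 0 := hoff.mono fun x hx h => hψz x (hx h)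
  have hψS2 : ∀ᵐ z ∂((vol Ω).prod (vol Ω)), (z.1 ∉ S → ψ z.1 = 0) ∧ (z.2 ∉ S → ψ z.2 = 0) := by
    filter_upwards [(Measure.quasiMeasurePreserving_fst (μ := vol Ω) (ν := vol Ω)).ae hψS,
      (Measure.quasiMeasurePreserving_snd (μ := vol Ω) (ν := vol Ω)).ae hψS] with z a b
      using ⟨a, b⟩
  have hb1 : ∀ᵐ x ∂(vol Ω), |ψ x| ≤ A * (|u x| + 1) := by
    filter_upwards [hψS, ae_mem_vol hopen] with x hx hxΩ
    by_cases hxS : x ∈ S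
    · have h1 : |ψ x| ≤ |w x - u x| := by
        rw [abs_of_nonneg (hψ0 x)]; exact max_le (le_abs_self _) (abs_nonneg _)
      have h2 := abs_sub (w x) (u x)
      have h3 := (hM x hxS hxΩ).trans (le_abs_self M)
      nlinarith [abs_nonneg (u x), abs_nonneg L, abs_nonneg M,
        mul_nonneg (by linarith : 0 ≤ A - 1) (abs_nonneg (u x))]
    · rw [hx hxS, abs_zero]; positivity
  have hb2 : ∀ᵐ z ∂((vol Ω).prod (vol Ω)),
      |ψ z.1 - ψ z.2| ≤ A * (|u z.1 - u z.2| + ‖z.1 - z.2‖) := by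
    have key : ∀ x ∈ S, x ∈ Ω → ∀ y ∈ Ω, |ψ x - ψ y| ≤ A * (|u x - u y| + ‖x - y‖) := by
      intro x hx hxΩ y hy
      have h1 : |ψ x - ψ y| ≤ |(w x - u x) - (w y - u y)| := abs_max_sub_max_le_abs _ _ _
      have h2 : |(w x - u x) - (w y - u y)| ≤ |w x - w y| + |u x - u y| := by
        have := abs_sub (w x - w y) (u x - u y)
        calc _ = |(w x - w y) - (u x - u y)| := by ring_nf
          _ ≤ _ := this
      have h3 := hL x hx hxΩ y hy
      have h4 : L * ‖x - y‖ ≤ |L| * ‖x - y‖ := by gcongr; exact le_abs_self L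
      nlinarith [norm_nonneg (x - y), abs_nonneg (u x - u y), abs_nonneg M,
        mul_nonneg (by linarith : 0 ≤ A - 1) (abs_nonneg (u x - u y)),
        mul_nonneg (by linarith [abs_nonneg M] : 0 ≤ A - |L|) (norm_nonneg (x - y))]
    filter_upwards [hψS2, ae_mem_prod_vol hopen] with z hz hzΩ
    by_cases h1 : z.1 ∈ S
    · exact key _ h1 hzΩ.1 _ hzΩ.2
    · by_cases h2 : z.2 ∈ S
      · rw [abs_sub_comm (ψ z.1), abs_sub_comm (u z.1), norm_sub_rev]
        exact key _ h2 hzΩ.2 _ hzΩ.1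
      · rw [hz.1 h1, hz.2 h2, sub_self, abs_zero]; positivity
  have hψW : MemW Ω s p ψ := hu.memW.of_bound hopen hbdd hps hψm hb1 hb2
  -- The competitor moves u only halfway to max(u, w). Towards points with w ≤ u its difference then
  -- keeps a term -(w - u)/2, so the gain can grow with the overshoot w - u; going all the way would
  -- lose it.
  have hvW : MemW Ω s p (fun x => u x + ψ x / 2) := by
    refine hu.memW.of_bound hopen hbdd hps (C := A + 1)
      (hu.memW.aesm.add (hψm.aemeasurable.div_const 2).aestronglyMeasurable) ?_ ?_
    · filter_upwards [hb1] with x hx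
      have h1 := abs_add_le (u x) (ψ x / 2)
      rw [abs_div, abs_two] at h1
      linarith [abs_nonneg (ψ x)]
    · filter_upwards [hb2] with z hz
      have h1 := abs_add_le (u z.1 - u z.2) ((ψ z.1 - ψ z.2) / 2)
      rw [abs_div, abs_two] at h1
      have h2 : u z.1 + ψ z.1 / 2 - (u z.2 + ψ z.2 / 2) =
        (u z.1 - u z.2) + (ψ z.1 - ψ z.2) / 2 := by ring
      rw [h2]
      linarith [abs_nonneg (ψ z.1 - ψ z.2), norm_nonneg (z.1 - z.2)]
  have hdW : MemW Ω s p (fun x => u x + ψ x / 2 - u x) := by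
    refine hψW.of_bound hopen hbdd hps (C := 1) ((hu.memW.aesm.add (hψm.aemeasurable.div_const 2).aestronglyMeasurable).sub
      hu.memW.aesm) (Eventually.of_forall fun x => ?_) (Eventually.of_forall fun z => ?_)
    · rw [add_sub_cancel_left, abs_div, abs_two]
      linarith [abs_nonneg (ψ x)]
    · rw [add_sub_cancel_left, add_sub_cancel_left, ← sub_div, abs_div, abs_two]
      linarith [abs_nonneg (ψ z.1 - ψ z.2), norm_nonneg (z.1 - z.2)]
  have hvar := hu.variation hopen hne hbdd hp hps hvW hdW
  have hform := hvW.integrable_form hp hdW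
  simp only [add_sub_cancel_left] at hvar hform
  -- the estimate for the first variation
  set F : Euc n × Euc n → ℝ := fun z => (C - G.indicator (fun _ => γ z.1) z) * ψ z.1 with hF
  have hψi : Integrable ψ (vol Ω) := hψW.integrable hbdd (by linarith)
  have hγi := hγint hψW
  have hFeq : F = fun z => C * ψ z.1 - G.indicator (fun z => γ z.1 * ψ z.1) z := by
    ext z
    by_cases hz : z ∈ G <;> simp [hF, hz]; ring
  have hi1 : Integrable (fun z : Euc n × Euc n => C * ψ z.1) ((vol Ω).prod (vol Ω)) :=
    (hψi.comp_fst (vol Ω)).const_mul C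
  have hi2 : Integrable (G.indicator (fun z : Euc n × Euc n => γ z.1 * ψ z.1))
      ((vol Ω).prod (vol Ω)) := (hγi.comp_fst (vol Ω)).indicator hG
  have hFi : Integrable F ((vol Ω).prod (vol Ω)) := by rw [hFeq]; exact hi1.sub hi2
  have hFs : Integrable (fun z => F z.swap) ((vol Ω).prod (vol Ω)) := hFi.swap
  -- The form is bounded by terms carrying ψ at one point each. Symmetrization then turns the double
  -- integral into a weighted integral of ψ over Ω.
  have hpw : ∀ᵐ z ∂((vol Ω).prod (vol Ω)),
      oddPow p (u z.1 + ψ z.1 / 2 - (u z.2 + ψ z.2 / 2)) * (ψ z.1 / 2 - ψ z.2 / 2) /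
        ‖z.1 - z.2‖ ^ ((n : ℝ) + s * p) ≤ (F z + F z.swap) / 2 := by
    filter_upwards [hψS2, ae_mem_prod_vol hopen] with z hz hzΩ
    obtain ⟨x, y⟩ := z
    simp only at hz hzΩ ⊢
    set K := (‖x - y‖ ^ ((n : ℝ) + s * p))⁻¹ with hK
    have hK0 : 0 ≤ K := by positivity
    have hKs : (‖y - x‖ ^ ((n : ℝ) + s * p))⁻¹ = K := by rw [norm_sub_rev]
    have hbound : ∀ x ∈ Ω, ∀ y ∈ Ω, (x ∉ S → ψ x = 0) → 0 < ψ x →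
        (0 < ψ y → oddPow p (w x - w y) * (‖x - y‖ ^ ((n : ℝ) + s * p))⁻¹ ≤
          C - G.indicator (fun _ => γ x) (x, y)) ∧
        (ψ y = 0 → oddPow p (u x - u y + ψ x / 2) * (‖x - y‖ ^ ((n : ℝ) + s * p))⁻¹ ≤
          C - G.indicator (fun _ => γ x) (x, y)) := by
      intro x hxΩ y hyΩ hxS hx
      have hxS' : x ∈ S := by
        by_contra h
        exact hx.ne' (hxS h)
      have hxw := hψpos x hx
      have e : u x - u y + ψ x / 2 = u x + (w x - u x) / 2 - u y := by rw [hψeq x hxw]; ring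
      rw [e, ← div_eq_mul_inv, ← div_eq_mul_inv]
      by_cases hxy : (x, y) ∈ G
      · rw [indicator_of_mem hxy]
        have h := hgain x hxS' hxΩ y hyΩ hxy hxw
        exact ⟨fun hy => h.1 (hψpos y hy), fun hy => h.2 (hψz' y hy)⟩
      · rw [indicator_of_notMem hxy, sub_zero]
        have h := hC x hxS' hxΩ y hyΩ
        refine ⟨fun _ => h, fun hy => le_trans ?_ h⟩
        have := hψz' y hy
        gcongr
        exact oddPow_mono hp1 (by linarith)
    have h1 := hbound x hzΩ.1 y hzΩ.2 hz.1
    have h2 := hbound y hzΩ.2 x hzΩ.1 hz.2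
    rw [hKs] at h2
    have := oddPow_variation_le (P := u x - u y) (Q := w x - w y) (a := ψ x) (b := ψ y) (K := K)
      (X := C - G.indicator (fun _ => γ x) (x, y)) (Y := C - G.indicator (fun _ => γ y) (y, x))
      hp1 (hψ0 x) (hψ0 y) hK0
      (fun ha hb => by rw [hψeq x (hψpos x ha), hψeq y (hψpos y hb)]; ring)
      (fun ha hb => (h1 ha).1 hb) (fun ha hb => by rw [neg_sub]; exact (h2 hb).1 ha)
      (fun ha hb => (h1 ha).2 hb) (fun hb ha => by rw [neg_sub]; exact (h2 hb).2 ha)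
    have e1 : u x + ψ x / 2 - (u y + ψ y / 2) = u x - u y + (ψ x - ψ y) / 2 := by ring
    rw [e1, div_eq_mul_inv _ (‖x - y‖ ^ _), ← hK]
    simp only [hF, Prod.swap_prod_mk]
    calc _ = oddPow p (u x - u y + (ψ x - ψ y) / 2) * (ψ x - ψ y) * K / 2 := by ring
      _ ≤ _ := by gcongr
  have hint := integral_mono_ae hform ((hFi.add hFs).div_const 2) hpw
  have hswap : ∫ z, F z.swap ∂((vol Ω).prod (vol Ω)) = ∫ z, F z ∂((vol Ω).prod (vol Ω)) :=
    integral_prod_swap F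
  have hrhs : ∫ z, (F z + F z.swap) / 2 ∂((vol Ω).prod (vol Ω)) =
      ∫ z, F z ∂((vol Ω).prod (vol Ω)) := by
    rw [integral_div, integral_add hFi hFs, hswap]; ring
  have hFint : ∫ z, F z ∂((vol Ω).prod (vol Ω)) =
      ∫ x, (C * (vol Ω).real univ - γ x * (vol Ω).real {y | (x, y) ∈ G}) * ψ x ∂(vol Ω) := by
    rw [integral_prod _ hFi]
    congr 1; ext x
    have hsec : MeasurableSet {y | (x, y) ∈ G} := measurable_prodMk_left hG
    have e : (fun y => F (x, y)) =
        fun y => C * ψ x - {y | (x, y) ∈ G}.indicator (fun _ => γ x * ψ x) y := by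
      rw [hFeq]; rfl
    rw [e, integral_sub (integrable_const _) ((integrable_const _).indicator hsec),
      integral_indicator hsec, setIntegral_const, integral_const, smul_eq_mul, smul_eq_mul]
    ring
  have hGi : Integrable (fun x => (C * (vol Ω).real univ -
      γ x * (vol Ω).real {y | (x, y) ∈ G}) * ψ x) (vol Ω) := by
    refine hFi.integral_prod_left.congr (Eventually.of_forall fun x => ?_)
    have hsec : MeasurableSet {y | (x, y) ∈ G} := measurable_prodMk_left hG
    have e : (fun y => F (x, y)) =
        fun y => C * ψ x - {y | (x, y) ∈ G}.indicator (fun _ => γ x * ψ x) y := by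
      rw [hFeq]; rfl
    simp only
    rw [e, integral_sub (integrable_const _) ((integrable_const _).indicator hsec),
      integral_indicator hsec, setIntegral_const, integral_const, smul_eq_mul, smul_eq_mul]
    ring
  have hJi := integrable_oddPow_mul hp hu.memW hψW
  have hlhs : ∫ x, oddPow p (u x) * (ψ x / 2) ∂(vol Ω) =
      (∫ x, oddPow p (u x) * ψ x ∂(vol Ω)) / 2 := by
    rw [← integral_div]; congr 1; ext x; ring
  have hfinal : ∫ x, (eigenvalue Ω s p * (oddPow p (u x) * ψ x) - 2 * ((C * (vol Ω).real univ -
      γ x * (vol Ω).real {y | (x, y) ∈ G}) * ψ x)) ∂(vol Ω) ≤ 0 := by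
    rw [integral_sub (hJi.const_mul _) (hGi.const_mul _), integral_const_mul, integral_const_mul,
      ← hFint]
    rw [hlhs] at hvar
    have := hvar.trans (hint.trans hrhs.le)
    linarith
  -- The integrand is nonnegative, and strictly positive where ψ > 0. As its integral is at most 0,
  -- ψ vanishes almost everywhere.
  have hnn : 0 ≤ᵐ[vol Ω] fun x => eigenvalue Ω s p * (oddPow p (u x) * ψ x) -
      2 * ((C * (vol Ω).real univ - γ x * (vol Ω).real {y | (x, y) ∈ G}) * ψ x) := by
    filter_upwards [hψS, ae_mem_vol hopen] with x hx hxΩ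
    rcases (hψ0 x).eq_or_lt with h0 | h0
    · simp [← h0]
    · have hxS : x ∈ S := by
        by_contra h
        exact h0.ne' (hx h)
      have := hlt x hxS hxΩ (hψpos x h0)
      have h2 := mul_le_mul_of_nonneg_right this.le h0.le
      simp only [Pi.zero_apply]
      linarith
  have hzero := (integral_eq_zero_iff_of_nonneg_ae hnn
    ((hJi.const_mul _).sub (hGi.const_mul _))).1 (le_antisymm hfinal (integral_nonneg_of_ae hnn))
  filter_upwards [hψS, ae_mem_vol hopen, hzero] with x hx hxΩ h
  by_contra! hcon
  have h0 : 0 < ψ x := by rw [hψeq x hcon]; linarith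
  have hxS : x ∈ S := by
    by_contra h
    exact h0.ne' (hx h)
  have := mul_lt_mul_of_pos_right (hlt x hxS hxΩ hcon) h0
  simp only [Pi.zero_apply] at h
  linarith

/-! ### Uniform convergence up to the boundary -/

/-- The positive part of the operator is bounded for functions with a one-sided Hölder bound and a
Lipschitz bound. -/
lemma oddPow_div_le {d t H L : ℝ} (hs0 : 0 < s) (hs1 : s < 1) (hp : 1 < p)
    (hpm : ((n : ℝ) + s) / (1 - s) ≤ p - 1) (ht : 0 ≤ t) (hH : 0 ≤ H) (hL : 0 ≤ L)
    (h1 : d ≤ H * t ^ s) (h2 : d ≤ L * t) :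
    oddPow p d / t ^ ((n : ℝ) + s * p) ≤
      H ^ (p - 1 - ((n : ℝ) + s) / (1 - s)) * L ^ (((n : ℝ) + s) / (1 - s)) := by
  rcases le_total d 0 with hd | hd
  · refine le_trans (div_nonpos_of_nonpos_of_nonneg ?_ (by positivity)) (by positivity)
    rw [oddPow_of_nonpos hp hd]
    exact neg_nonpos.2 (Real.rpow_nonneg (by linarith) _)
  · rw [oddPow_of_nonneg hp hd]
    have := rpow_div_rpow_le (k := (n : ℝ) + s) hs1 hd ht hH hL h1 h2 (by positivity) hpm
    have e : s * (p - 1) + ((n : ℝ) + s) = (n : ℝ) + s * p := by ring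
    rwa [e] at this

set_option maxHeartbeats 1000000 in
/-- Minimizers are eventually bounded below by their limit in measure, up to a small error. -/
theorem eventually_sub_le (hn : 1 ≤ n) (hopen : IsOpen Ω) (hne : Ω.Nonempty)
    (hbdd : Bornology.IsBounded Ω) (hs0 : 0 < s) (hs1 : s < 1) {p : ℕ → ℝ}
    {u : ℕ → Euc n → ℝ} (hp : Tendsto p atTop atTop)
    (hu : ∀ k, IsNormalizedMinimizer Ω s (p k) (u k)) {f : Euc n → ℝ}
    (hf : IsHolder s (2 / Metric.diam Ω ^ s) f)
    (hmeas : ∀ δ > 0, Tendsto (fun k => (vol Ω).real {x | x ∈ Ω ∧ δ ≤ |u k x - f x|}) atTop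
        (𝓝 0)) {δ : ℝ} (hδ : 0 < δ) :
    ∀ᶠ k in atTop, ∀ᵐ x ∂(vol Ω), f x - δ ≤ u k x := by
  have := isFiniteMeasure_vol hbdd
  have hD := diam_pos hn hopen hne hbdd
  set Λ := 2 / Metric.diam Ω ^ s with hΛ
  have hΛ0 : 0 < Λ := by positivity
  have hs' : 0 < 1 - s := by linarith
  -- the barrier
  set η := (δ / (8 * Λ)) ^ (1 / s) with hη
  have hη0 : 0 < η := by positivity
  have hηs : Λ * η ^ s = δ / 8 := by
    rw [hη, ← Real.rpow_mul (by positivity), one_div_mul_cancel hs0.ne', Real.rpow_one]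
    field_simp
  -- The regularization lies above f by at most δ/8, so g - δ is a Lipschitz barrier that still ends
  -- up above f - δ.
  obtain ⟨g, hgH, hgL, hgf⟩ := hf.exists_regularization hs0 hs1 hΛ0.le hη0
  rw [hηs] at hgf
  set L := Λ * η ^ (s - 1) with hL
  have hL0 : 0 < L := by positivity
  have hgc : Continuous g := hgH.continuous hs0
  set w : Euc n → ℝ := fun x => g x - δ with hw
  have hwc : Continuous w := hgc.sub continuous_const
  obtain ⟨M, hM⟩ := hbdd.isCompact_closure.exists_bound_of_continuousOn hwc.continuousOn
  have hMΩ : ∀ x ∈ Ω, |w x| ≤ M := fun x hx => hM x (subset_closure hx)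
  have hM0 : 0 ≤ M := by
    obtain ⟨x, hx⟩ := hne
    exact (abs_nonneg _).trans (hMΩ x hx)
  set b := Λ + 1 with hb
  have hb1 : 1 ≤ b := by linarith
  -- the scale
  obtain ⟨t, ht0, ht1, ht2, ht3⟩ : ∃ t : ℝ, 0 < t ∧ Λ * t ≤ δ / 8 ∧ 4 * b * t ≤ 1 ∧
      4 * b * (1 + M) * t ≤ δ := by
    refine ⟨min (δ / (8 * Λ)) (min (1 / (4 * b)) (δ / (4 * b * (1 + M)))), by positivity, ?_, ?_,
      ?_⟩
    · calc _ ≤ Λ * (δ / (8 * Λ)) := by gcongr; exact min_le_left _ _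
        _ = _ := by field_simp
    · calc _ ≤ 4 * b * (1 / (4 * b)) := by
            gcongr; exact (min_le_right _ _).trans (min_le_left _ _)
        _ = _ := by field_simp
    · calc _ ≤ 4 * b * (1 + M) * (δ / (4 * b * (1 + M))) := by
            gcongr; exact (min_le_right _ _).trans (min_le_right _ _)
        _ = _ := by field_simp
  set ε := t ^ (1 / s) / 2 with hε
  have hε0 : 0 < ε := by positivity
  have hεs : (2 * ε) ^ s = t := by
    rw [hε, mul_div_cancel₀ _ two_ne_zero, ← Real.rpow_mul ht0.le, one_div_mul_cancel hs0.ne',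
      Real.rpow_one]
  obtain ⟨N⟩ := exists_ballNet hopen hne hbdd
  obtain ⟨T, hTr, hTc⟩ := N.exists_net ε hε0
  obtain ⟨β, hβ, hβT⟩ := exists_pos_le_finset T (N.vol_pos hbdd)
  set m := ((n : ℝ) + s) / (1 - s) with hm
  have hm0 : 0 ≤ m := by positivity
  set V := (vol Ω).real univ with hV
  set C₃ := (L / Λ) ^ m with hC₃
  -- In units of Z^(q-1), with Z defined below, the losses stay bounded while the gain grows like
  -- 2^q.
  have hgrow : ∀ᶠ q : ℝ in atTop,
      (2 * V * C₃ + b) * 1 ^ q < β / ((2 * ε) ^ (n : ℝ) * t) / 2 * 2 ^ q :=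
    eventually_mul_rpow_lt one_pos one_lt_two (by positivity)
  filter_upwards [(hmeas (δ / 4) (by positivity)).eventually_lt_const (by positivity : 0 < β / 2),
    hp.eventually (eventually_exponent n hs1 (m + 1)), hp.eventually hgrow,
    hp.eventually (eventually_eigenvalue_le hn hopen hne hbdd hs0 hs1 (lt_add_one Λ))]
    with k hk ⟨hp2, hps, hpm⟩ hgr hlam
  set P := p k with hP
  have hp1 : 1 < P := by linarith
  set Bad : Set (Euc n) := {x | x ∈ Ω ∧ δ / 4 ≤ |u k x - f x|} with hBad
  -- The measurable hull has the measure of the bad set and makes G measurable.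
  set A : Set (Euc n) := (toMeasurable (vol Ω) Bad)ᶜ with hA
  have hAm : MeasurableSet A := (measurableSet_toMeasurable _ _).compl
  have hAu : ∀ y ∈ A, y ∈ Ω → f y - δ / 4 < u k y := by
    intro y hyA hyΩ
    have h1 : ¬ (δ / 4 ≤ |u k y - f y|) := fun h => hyA (subset_toMeasurable _ _ ⟨hyΩ, h⟩)
    have := (abs_lt.1 (not_le.1 h1)).1
    linarith
  -- A point x is paired with the good points of a nearby ball inside Ω. Every x in Ω, however close
  -- to the boundary, sees at least measure β/2 of them at distance at most 2ε.
  set G : Set (Euc n × Euc n) := ⋃ i ∈ T, Metric.ball (N.center i) ε ×ˢ (N.ball i ∩ A) with hG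
  have hGm : MeasurableSet G := Finset.measurableSet_biUnion _ fun i _ =>
    Metric.isOpen_ball.measurableSet.prod ((N.measurableSet_ball i).inter hAm)
  set κ := ((2 * ε) ^ ((n : ℝ) + s * P))⁻¹ with hκ
  have hκ0 : 0 < κ := by positivity
  set C := Λ ^ (P - 1 - m) * L ^ m with hC
  have hC0 : 0 < C := by positivity
  have hCeq : C = C₃ * Λ ^ (P - 1) := by
    rw [hC, hC₃, Real.div_rpow hL0.le hΛ0.le, Real.rpow_sub hΛ0]; ring
  have hdiff : ∀ x y, w x - w y = g x - g y := fun x y => by simp [hw]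
  have hmain : ∀ᵐ x ∂(vol Ω), w x ≤ u k x := by
    refine (hu k).comparison hopen hne hbdd hp2 hps (S := univ) (L := L) (M := M) (C := C)
      (G := G) (γ := fun x => κ * ((δ + (w x - u k x)) / 2) ^ (P - 1) )
      hwc.aestronglyMeasurable (fun x _ hx => hMΩ x hx) ?_ (Eventually.of_forall fun x h =>
        absurd (mem_univ x) h) ?_ hGm ?_ ?_ ?_
    · intro x _ _ y _
      rw [hdiff]; exact hgL x y
    · intro x _ _ y _
      refine oddPow_div_le hs0 hs1 hp1 (by linarith) (norm_nonneg _) hΛ0.le hL0.le ?_ ?_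
      · rw [hdiff]; exact (le_abs_self _).trans (hgH.abs_sub_le x y)
      · rw [hdiff]; exact (le_abs_self _).trans (hgL x y)
    · intro hψ
      have h1 : MemLp (fun x => (δ + max (w x - u k x) 0) / 2) (ENNReal.ofReal P) (vol Ω) := by
        have h := ((memLp_const δ).add hψ.1).mul_const (2⁻¹ : ℝ)
        refine (memLp_congr_ae (Eventually.of_forall fun x => ?_)).1 h
        simp [div_eq_mul_inv]
      have h2 := h1.integrable_norm_rpow (by simpa using by linarith) ENNReal.ofReal_ne_top
      rw [ENNReal.toReal_ofReal (by linarith)] at h2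
      have h3 := hψ.integrable_rpow (by linarith : 0 < P)
      refine ((h2.add h3).const_mul κ).mono' ?_ (Eventually.of_forall fun x => ?_)
      · have hm1 : AEMeasurable (fun x => w x - u k x) (vol Ω) :=
          hwc.aemeasurable.sub (hu k).memW.aesm.aemeasurable
        exact (((hm1.const_add δ).div_const 2).pow_const (P - 1) |>.const_mul κ |>.mul
          (hm1.max aemeasurable_const)).aestronglyMeasurable
      · rcases le_total (w x - u k x) 0 with h | h
        · rw [max_eq_right h, mul_zero, norm_zero, Pi.add_apply]
          positivity
        · rw [max_eq_left h, Pi.add_apply, Real.norm_eq_abs, max_eq_left h, Real.norm_eq_abs,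
            abs_of_nonneg (a := (δ + (w x - u k x)) / 2) (by positivity), abs_of_nonneg h,
            abs_of_nonneg (by positivity), mul_assoc]
          gcongr
          exact abs_mul_rpow_sub_one_le hp1 (by positivity) h
    · intro x _ hxΩ y hyΩ hxy hxw
      obtain ⟨i, hi, hxi, hyi, hyA⟩ := by simpa only [hG, mem_iUnion₂, mem_prod, mem_inter_iff,
        exists_prop] using hxy
      have hyu := hAu y hyA hyΩ
      have hfg := hgf y
      have hwy : w y < u k y := by
        simp only [hw]; linarith
      -- At good points y the minimizer exceeds the barrier, so only the halfway competitor matters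
      -- there.
      refine ⟨fun h => absurd h (not_lt.2 hwy.le), fun _ => ?_⟩
      have hnorm := N.norm_sub_le (hTr i hi) hxi hyi
      have hxyne : x ≠ y := by
        rintro rfl
        linarith
      have hpos : 0 < ‖x - y‖ := norm_pos_iff.2 (sub_ne_zero.2 hxyne)
      have hfxy : f x - f y ≤ δ / 8 := by
        have h1 := (le_abs_self _).trans (hf.abs_sub_le x y)
        have h2 : ‖x - y‖ ^ s ≤ t := by rw [← hεs]; gcongr
        have h3 := mul_le_mul_of_nonneg_left h2 hΛ0.le
        linarith
      have hle : u k x + (w x - u k x) / 2 - u k y ≤ -((δ + (w x - u k x)) / 2) := by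
        have := (hgf x).2
        have e : w x = g x - δ := rfl
        linarith
      have h1 : oddPow P (u k x + (w x - u k x) / 2 - u k y) ≤
          -((δ + (w x - u k x)) / 2) ^ (P - 1) := by
        refine (oddPow_mono hp1 hle).trans ?_
        rw [oddPow_neg, oddPow_of_nonneg hp1 (by linarith)]
      have h2 : κ ≤ (‖x - y‖ ^ ((n : ℝ) + s * P))⁻¹ := by
        rw [hκ]; gcongr
      have hXp : 0 ≤ ((δ + (w x - u k x)) / 2) ^ (P - 1) :=
        Real.rpow_nonneg (by linarith) _
      rw [div_eq_mul_inv]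
      calc _ ≤ -((δ + (w x - u k x)) / 2) ^ (P - 1) * (‖x - y‖ ^ ((n : ℝ) + s * P))⁻¹ := by
            gcongr
        _ ≤ -(κ * ((δ + (w x - u k x)) / 2) ^ (P - 1)) := by
            have := mul_le_mul_of_nonneg_right h2 hXp
            linarith
        _ ≤ _ := by linarith
    · intro x _ hxΩ hxw
      set a := w x - u k x with ha
      have ha0 : 0 < a := by linarith
      -- measure of the section
      have hsec : β / 2 ≤ (vol Ω).real {y | (x, y) ∈ G} := by
        obtain ⟨i, hi, hxi⟩ := mem_iUnion₂.1 (hTc hxΩ)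
        have h1 : N.ball i ⊆ {y | (x, y) ∈ G} ∪ toMeasurable (vol Ω) Bad := by
          intro y hy
          by_cases hyA : y ∈ A
          · left
            simp only [hG, mem_ofPred_eq, mem_iUnion₂, mem_prod, mem_inter_iff]
            exact ⟨i, hi, hxi, hy, hyA⟩
          · right
            simpa [hA] using hyA
        have h2 := (measureReal_mono (μ := vol Ω) h1).trans (measureReal_union_le _ _)
        have h3 : (vol Ω).real (toMeasurable (vol Ω) Bad) = (vol Ω).real Bad := by
          rw [measureReal_def, measure_toMeasurable, measureReal_def]
        rw [h3] at h2
        linarith [hβT i hi]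
      set Z := b * (1 + M + a) with hZ
      have hZ0 : 0 < Z := by positivity
      have hZ1 : b ≤ Z := by rw [hZ]; nlinarith
      have hP1 : 0 ≤ P - 1 := by linarith
      -- the gain
      have hκeq : κ = (t ^ (P - 1))⁻¹ / ((2 * ε) ^ (n : ℝ) * t) := by
        rw [hκ, Real.rpow_add (by positivity), Real.rpow_mul (by positivity), hεs,
          Real.rpow_sub_one ht0.ne']
        field_simp
      -- This is the choice of t: 4b(1+M+a)t ≤ δ + a. It holds for every overshoot a because both
      -- sides are affine in a.
      have hgain : (2 : ℝ) ^ (P - 1) * Z ^ (P - 1) ≤ (t ^ (P - 1))⁻¹ * ((δ + a) / 2) ^ (P - 1) := by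
        rw [← Real.mul_rpow zero_le_two hZ0.le, ← Real.inv_rpow ht0.le,
          ← Real.mul_rpow (by positivity) (by positivity)]
        refine Real.rpow_le_rpow (by positivity) ?_ hP1
        rw [inv_mul_eq_div, le_div_iff₀ ht0, hZ]
        nlinarith
      -- No lower bound for the minimizer is known yet, so it is estimated through the overshoot:
      -- |u| ≤ |w| + a.
      have hloss : -(b * Z ^ (P - 1)) ≤ eigenvalue Ω s P * oddPow P (u k x) := by
        have h1 : -(|u k x| ^ (P - 1)) ≤ oddPow P (u k x) := by
          rw [← abs_oddPow hp1]; exact neg_abs_le _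
        have h2 : |u k x| ≤ 1 + M + a := by
          have e : u k x = w x - a := by rw [ha]; ring
          rw [e]
          have := abs_sub (w x) a
          rw [abs_of_pos ha0] at this
          linarith [hMΩ x hxΩ]
        have h3 : eigenvalue Ω s P * |u k x| ^ (P - 1) ≤ b ^ P * (1 + M + a) ^ (P - 1) := by
          gcongr
        have h4 : b ^ P * (1 + M + a) ^ (P - 1) = b * Z ^ (P - 1) := by
          rw [hZ, Real.mul_rpow (by linarith) (by positivity), ← mul_assoc]
          congr 1
          rw [Real.rpow_sub_one (by linarith)]
          field_simp
        have h5 := mul_le_mul_of_nonneg_left h1 (eigenvalue_nonneg Ω s P)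
        linarith
      have hCZ : C ≤ C₃ * Z ^ (P - 1) := by
        rw [hCeq]
        gcongr
        linarith
      have hgr' : 2 * V * C₃ + b < β / ((2 * ε) ^ (n : ℝ) * t) * 2 ^ (P - 1) := by
        rw [Real.one_rpow, mul_one] at hgr
        refine hgr.trans_le (le_of_eq ?_)
        rw [Real.rpow_sub_one two_ne_zero]; ring
      have hZp : 0 < Z ^ (P - 1) := by positivity
      have hV0 : 0 ≤ V := measureReal_nonneg
      have hXp : 0 ≤ ((δ + a) / 2) ^ (P - 1) := Real.rpow_nonneg (by linarith) _
      have hfin : 2 * C * V + b * Z ^ (P - 1) < β * (κ * ((δ + a) / 2) ^ (P - 1)) := by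
        calc 2 * C * V + b * Z ^ (P - 1) ≤ 2 * (C₃ * Z ^ (P - 1)) * V + b * Z ^ (P - 1) := by
              gcongr
          _ = (2 * V * C₃ + b) * Z ^ (P - 1) := by ring
          _ < β / ((2 * ε) ^ (n : ℝ) * t) * 2 ^ (P - 1) * Z ^ (P - 1) := by gcongr
          _ = β / ((2 * ε) ^ (n : ℝ) * t) * (2 ^ (P - 1) * Z ^ (P - 1)) := by ring
          _ ≤ β / ((2 * ε) ^ (n : ℝ) * t) * ((t ^ (P - 1))⁻¹ * ((δ + a) / 2) ^ (P - 1)) := by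
              gcongr
          _ = _ := by rw [hκeq]; ring
      have hsec' := mul_le_mul_of_nonneg_left hsec
        (by positivity : 0 ≤ κ * ((δ + a) / 2) ^ (P - 1))
      linarith
  filter_upwards [hmain] with x hx
  have := (hgf x).1
  have e : w x = g x - δ := rfl
  linarith

lemma MemW.neg {u : Euc n → ℝ} (hu : MemW Ω s p u) : MemW Ω s p (fun x => -u x) := by
  refine ⟨hu.1.neg, ?_⟩
  have e : ∀ z : Euc n × Euc n, |-u z.1 - -u z.2| = |u z.1 - u z.2| := fun z => by
    rw [← abs_neg]; congr 1; ring
  simp only [e]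
  exact hu.2

lemma IsNormalizedMinimizer.neg {u : Euc n → ℝ} (hu : IsNormalizedMinimizer Ω s p u) :
    IsNormalizedMinimizer Ω s p (fun x => -u x) := by
  obtain ⟨⟨hW, hne, h0⟩, h1, hE⟩ := hu
  refine ⟨⟨hW.neg, fun h => hne ?_, ?_⟩, by simpa using h1, ?_⟩
  · filter_upwards [h] with x hx
    simpa using hx
  · simp only [abs_neg, mul_neg, integral_neg, h0, neg_zero]
  · rw [← hE, gagliardoEnergy, gagliardoEnergy]
    have e : ∀ x y, |-u x - -u y| = |u x - u y| := fun x y => by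
      rw [← abs_neg]; congr 1; ring
    simp only [e]

/-- Minimizers converge uniformly to their limit in measure. -/
theorem eventually_abs_sub_le (hn : 1 ≤ n) (hopen : IsOpen Ω) (hne : Ω.Nonempty)
    (hbdd : Bornology.IsBounded Ω) (hs0 : 0 < s) (hs1 : s < 1) {p : ℕ → ℝ}
    {u : ℕ → Euc n → ℝ} (hp : Tendsto p atTop atTop)
    (hu : ∀ k, IsNormalizedMinimizer Ω s (p k) (u k)) {f : Euc n → ℝ}
    (hf : IsHolder s (2 / Metric.diam Ω ^ s) f)
    (hmeas : ∀ δ > 0, Tendsto (fun k => (vol Ω).real {x | x ∈ Ω ∧ δ ≤ |u k x - f x|}) atTop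
        (𝓝 0)) {δ : ℝ} (hδ : 0 < δ) :
    ∀ᶠ k in atTop, ∀ᵐ x ∂(vol Ω), |u k x - f x| ≤ δ := by
  have h1 := eventually_sub_le hn hopen hne hbdd hs0 hs1 hp hu hf hmeas hδ
  have h2 := eventually_sub_le hn hopen hne hbdd hs0 hs1 hp (u := fun k x => -u k x)
    (fun k => (hu k).neg) hf.neg (fun δ hδ => by
      have e : ∀ k x, |-u k x - -f x| = |u k x - f x| := fun k x => by
        rw [← abs_neg]; congr 1; ring
      simp only [e]
      exact hmeas δ hδ) hδ
  filter_upwards [h1, h2] with k hk1 hk2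
  filter_upwards [hk1, hk2] with x hx1 hx2
  rw [abs_le]
  constructor <;> linarith

/-! ### The limit is a minimizer -/

/-- The uniform limit of minimizers has balanced extrema of size at least one. -/
theorem limit_balanced (hopen : IsOpen Ω) (hne : Ω.Nonempty)
    (hbdd : Bornology.IsBounded Ω) {p : ℕ → ℝ}
    {u : ℕ → Euc n → ℝ} (hp : Tendsto p atTop atTop)
    (hu : ∀ k, IsNormalizedMinimizer Ω s (p k) (u k)) {f : Euc n → ℝ} (hf : Continuous f)
    (hunif : ∀ δ > 0, ∀ᶠ k in atTop, ∀ᵐ x ∂(vol Ω), |u k x - f x| ≤ δ) :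
    ∃ c, 1 ≤ c ∧ (∀ x ∈ Ω, |f x| ≤ c) ∧ (∀ δ > 0, ∃ x ∈ Ω, c - δ < f x) ∧
      ∀ δ > 0, ∃ x ∈ Ω, f x < -c + δ := by
  have := isFiniteMeasure_vol hbdd
  set V := (vol Ω).real univ with hV
  have hV0 : 0 < V := ENNReal.toReal_pos (vol_univ_pos hopen hne).ne' (measure_ne_top _ _)
  obtain ⟨M, hM⟩ := hbdd.isCompact_closure.exists_bound_of_continuousOn hf.continuousOn
  have hMΩ : ∀ x ∈ Ω, |f x| ≤ M := fun x hx => hM x (subset_closure hx)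
  have hbd : BddAbove ((fun x => |f x|) '' Ω) := ⟨M, by rintro _ ⟨x, hx, rfl⟩; exact hMΩ x hx⟩
  set c := sSup ((fun x => |f x|) '' Ω) with hc
  have hcΩ : ∀ x ∈ Ω, |f x| ≤ c := fun x hx => le_csSup hbd ⟨x, hx, rfl⟩
  have hc0 : 0 ≤ c := by
    obtain ⟨x, hx⟩ := hne
    exact (abs_nonneg _).trans (hcΩ x hx)
  have hc1 : 1 ≤ c := by
    by_contra! hlt
    obtain ⟨c', h1, h2⟩ := exists_between hlt
    -- If |f| stayed below 1, the p-norms of the minimizers would decay, against the normalization.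
    have hgr : ∀ᶠ q : ℝ in atTop, V * c' ^ q < 1 * 1 ^ q :=
      eventually_mul_rpow_lt (hc0.trans_lt h1) h2 one_pos
    obtain ⟨k, hk, hpk, hk1⟩ := ((hunif (c' - c) (by linarith)).and ((hp.eventually hgr).and
      (hp.eventually (eventually_gt_atTop 0)))).exists
    rw [Real.one_rpow, mul_one] at hpk
    have h3 : ∫ x, |u k x| ^ p k ∂(vol Ω) ≤ ∫ _, c' ^ p k ∂(vol Ω) := by
      refine integral_mono_ae ((hu k).memW.integrable_rpow hk1) (integrable_const _) ?_
      filter_upwards [hk, ae_mem_vol hopen] with x hx hxΩ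
      refine Real.rpow_le_rpow (abs_nonneg _) ?_ hk1.le
      have e1 := hcΩ x hxΩ
      have e2 := abs_sub_abs_le_abs_sub (u k x) (f x)
      linarith
    rw [(hu k).2.1, integral_const, smul_eq_mul] at h3
    linarith
  -- one-sided statement, applied to the sequence and its negative
  have key : ∀ (u : ℕ → Euc n → ℝ) (f : Euc n → ℝ), Continuous f →
      (∀ k, IsNormalizedMinimizer Ω s (p k) (u k)) →
      (∀ δ > 0, ∀ᶠ k in atTop, ∀ᵐ x ∂(vol Ω), |u k x - f x| ≤ δ) → (∀ x ∈ Ω, |f x| ≤ c) →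
      (∀ δ > 0, ∃ x ∈ Ω, c - δ < f x) → ∀ δ > 0, ∃ x ∈ Ω, f x < -c + δ := by
    intro u f hf hu hunif hcΩ hsup δ hδ
    by_contra! hcon
    set τ := min δ c / 8 with hτ
    have hτ0 : 0 < τ := by have : 0 < min δ c := lt_min hδ (by linarith); positivity
    have hτδ : 8 * τ ≤ δ := by rw [hτ]; linarith [min_le_left δ c]
    have hτc : 8 * τ ≤ c := by rw [hτ]; linarith [min_le_right δ c]
    obtain ⟨x₀, hx₀, hx₀c⟩ := hsup τ hτ0
    obtain ⟨r, hr, hrx⟩ := Metric.eventually_nhds_iff_ball.1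
      ((hf.continuousAt.eventually (lt_mem_nhds hx₀c)).and (hopen.mem_nhds hx₀))
    have hball : Metric.ball x₀ r ⊆ Ω := fun x hx => (hrx x hx).2
    set β := (vol Ω).real (Metric.ball x₀ r) with hβ
    have hβ0 : 0 < β := vol_real_ball_pos hbdd hr hball
    have hgr : ∀ᶠ q : ℝ in atTop, V * (c - 4 * τ) ^ q < β * (c - 2 * τ) ^ q :=
      eventually_mul_rpow_lt (by linarith) (by linarith) hβ0
    have hp1 : Tendsto (fun k => p k - 1) atTop atTop := tendsto_atTop_add_const_right _ _ hp
    obtain ⟨k, hk, hgrk, hk2⟩ := ((hunif τ hτ0).and ((hp1.eventually hgr).and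
      (hp.eventually (eventually_ge_atTop 2)))).exists
    have hk1 : 1 < p k := by linarith
    have hJi : Integrable (fun x => oddPow (p k) (u k x)) (vol Ω) := by
      refine (((hu k).memW.integrable_rpow (by linarith)).add (integrable_const (1 : ℝ))).mono'
        ((continuous_oddPow hk2).comp_aestronglyMeasurable (hu k).memW.aesm)
        (Eventually.of_forall fun x => ?_)
      rw [Real.norm_eq_abs, abs_oddPow hk1]
      have := abs_mul_rpow_sub_one_le hk1 (abs_nonneg (u k x)) zero_le_one
      simpa using this
    have h0 : ∫ x, oddPow (p k) (u k x) ∂(vol Ω) = 0 := (hu k).1.2.2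
    -- The constraint balances odd powers. Values near c on a fixed ball contribute at the rate c -
    -- 2τ, which values above -(c - 4τ) cannot compensate.
    have hlow : ∀ᵐ x ∂(vol Ω), (Metric.ball x₀ r).indicator (fun _ => (c - 2 * τ) ^ (p k - 1)) x -
        (c - 4 * τ) ^ (p k - 1) ≤ oddPow (p k) (u k x) := by
      filter_upwards [hk, ae_mem_vol hopen] with x hx hxΩ
      have hx' := abs_le.1 hx
      have hpos : 0 ≤ (c - 4 * τ) ^ (p k - 1) := Real.rpow_nonneg (by linarith) _
      by_cases hxb : x ∈ Metric.ball x₀ r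
      · rw [indicator_of_mem hxb]
        have h1 : c - 2 * τ ≤ u k x := by linarith [(hrx x hxb).1]
        have h2 := oddPow_mono hk1 h1
        rw [oddPow_of_nonneg hk1 (by linarith)] at h2
        linarith
      · rw [indicator_of_notMem hxb, zero_sub]
        have h1 : -(c - 4 * τ) ≤ u k x := by linarith [hcon x hxΩ]
        have h2 := oddPow_mono hk1 h1
        rw [oddPow_neg, oddPow_of_nonneg hk1 (by linarith)] at h2
        exact h2
    have hind : Integrable ((Metric.ball x₀ r).indicator
        (fun _ : Euc n => (c - 2 * τ) ^ (p k - 1))) (vol Ω) :=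
      (integrable_const _).indicator Metric.isOpen_ball.measurableSet
    have h3 := integral_mono_ae (hind.sub (integrable_const _)) hJi hlow
    rw [h0] at h3
    simp only [Pi.sub_apply] at h3
    rw [integral_sub hind (integrable_const _),
      integral_indicator Metric.isOpen_ball.measurableSet, setIntegral_const, integral_const,
      smul_eq_mul, smul_eq_mul] at h3
    linarith
  have hcs : ∀ δ > 0, ∃ x ∈ Ω, c - δ < |f x| := by
    intro δ hδ
    obtain ⟨_, ⟨x, hx, rfl⟩, h⟩ := exists_lt_of_lt_csSup (hne.image _) (by linarith : c - δ < c)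
    exact ⟨x, hx, h⟩
  have hneg : (∀ δ > 0, ∀ᶠ k in atTop, ∀ᵐ x ∂(vol Ω), |-u k x - -f x| ≤ δ) := by
    have e : ∀ k x, |-u k x - -f x| = |u k x - f x| := fun k x => by
      rw [← abs_neg]; congr 1; ring
    simpa only [e] using hunif
  by_cases hsup : ∀ δ > 0, ∃ x ∈ Ω, c - δ < f x
  · exact ⟨c, hc1, hcΩ, hsup, key u f hf hu hunif hcΩ hsup⟩
  · have hinf : ∀ δ > 0, ∃ x ∈ Ω, c - δ < -f x := by
      push Not at hsup
      obtain ⟨δ₀, hδ₀, hsup⟩ := hsup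
      intro δ hδ
      obtain ⟨x, hx, h⟩ := hcs (min δ δ₀) (lt_min hδ hδ₀)
      refine ⟨x, hx, ?_⟩
      have h1 := hsup x hx
      have h2 := min_le_left δ δ₀
      have h3 := min_le_right δ δ₀
      rcases abs_cases (f x) with h4 | h4 <;> linarith
    have h1 := key (fun k x => -u k x) (fun x => -f x) hf.neg (fun k => (hu k).neg) hneg
      (by simpa using hcΩ) hinf
    refine ⟨c, hc1, hcΩ, fun δ hδ => ?_, fun δ hδ => ?_⟩
    · obtain ⟨x, hx, h⟩ := h1 δ hδ
      exact ⟨x, hx, by linarith⟩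
    · obtain ⟨x, hx, h⟩ := hinf δ hδ
      exact ⟨x, hx, by linarith⟩

/-- The uniform limit of minimizers minimizes `λ₁(s,∞)`. -/
theorem isMinimizerInfty_of_limit (hn : 1 ≤ n) (hopen : IsOpen Ω) (hne : Ω.Nonempty)
    (hbdd : Bornology.IsBounded Ω) (hs0 : 0 < s) (hs1 : s < 1) {p : ℕ → ℝ}
    {u : ℕ → Euc n → ℝ} (hp : Tendsto p atTop atTop)
    (hu : ∀ k, IsNormalizedMinimizer Ω s (p k) (u k)) {f : Euc n → ℝ}
    (hf : IsHolder s (2 / Metric.diam Ω ^ s) f)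
    (hunif : ∀ δ > 0, ∀ᶠ k in atTop, ∀ᵐ x ∂(vol Ω), |u k x - f x| ≤ δ) :
    IsMinimizerInfty Ω s f := by
  have hD := diam_pos hn hopen hne hbdd
  have hΛ0 : 0 < 2 / Metric.diam Ω ^ s := by positivity
  have hfc := hf.continuous hs0
  obtain ⟨c, hc1, hcΩ, hsup, hinf⟩ := limit_balanced hopen hne hbdd hp hu hfc hunif
  obtain ⟨h1, h2⟩ := mem_admissibleInfty_of_holder (s := s) hopen hne hbdd hfc hΛ0.le
    (fun x _ y _ => hf.abs_sub_le x y) (by linarith) hcΩ hsup hinf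
  refine ⟨h1, ?_⟩
  rw [eigenvalueInfty_eq hn hopen hne hbdd hs0 hs1]
  -- The quotient is at most Λ/c ≤ Λ because c ≥ 1; combined with the lower bound Λ this also forces
  -- c = 1.
  exact le_antisymm (h2.trans (div_le_self hΛ0.le hc1))
    (le_rayleighInfty hopen hne hbdd hs0 hD h1)

/-! ### Interior Morrey embedding -/

lemma vol_restrict_of_subset {B : Set (Euc n)} (hB : MeasurableSet B) (h : B ⊆ Ω) :
    (vol Ω).restrict B = volume.restrict B := by
  rw [vol, Measure.restrict_restrict hB, inter_eq_left.2 h]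

lemma vol_real_of_subset {B : Set (Euc n)} (hB : MeasurableSet B) (h : B ⊆ Ω) :
    (vol Ω).real B = (volume : Measure (Euc n)).real B := by
  rw [measureReal_def, measureReal_def, vol, Measure.restrict_apply hB, inter_eq_left.2 h]

lemma volume_real_closedBall (x : Euc n) {r : ℝ} (hr : 0 ≤ r) :
    (volume : Measure (Euc n)).real (Metric.closedBall x r) =
      r ^ (n : ℝ) * (volume : Measure (Euc n)).real (Metric.closedBall 0 1) := by
  rw [measureReal_def, measureReal_def, Measure.addHaar_closedBall' _ _ hr, ENNReal.toReal_mul,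
    ENNReal.toReal_ofReal (by positivity), finrank_euclideanSpace_fin, Real.rpow_natCast]

/-- Dominated convergence: the indicator of the moving ball is locally constant in its centre at
every y off the limiting sphere, which is a null set. -/
lemma continuousAt_integral_closedBall {u : Euc n → ℝ} (hu : Integrable u (vol Ω)) {r : ℝ}
    (hr : 0 < r) (x₀ : Euc n) :
    ContinuousAt (fun x => ∫ y in Metric.closedBall x r, u y ∂(vol Ω)) x₀ := by
  simp_rw [← integral_indicator Metric.isClosed_closedBall.measurableSet]
  refine continuousAt_of_dominated (bound := fun y => ‖u y‖) ?_ ?_ hu.norm ?_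
  · exact Eventually.of_forall fun x =>
      hu.aestronglyMeasurable.indicator Metric.isClosed_closedBall.measurableSet
  · exact Eventually.of_forall fun x => Eventually.of_forall fun y => norm_indicator_le_norm_self _ _
  · have h0 : ∀ᵐ y ∂(vol Ω), y ∉ Metric.sphere x₀ r := by
      refine ae_restrict_of_ae ?_
      exact measure_eq_zero_iff_ae_notMem.1 (Measure.addHaar_sphere_of_ne_zero _ _ hr.ne')
    filter_upwards [h0] with y hy
    have hc : ContinuousAt (fun x : Euc n => dist y x) x₀ := by fun_prop
    rcases lt_or_gt_of_ne (Metric.mem_sphere.not.1 hy) with h | h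
    · refine ContinuousAt.congr (f := fun _ => u y) continuousAt_const ?_
      filter_upwards [hc.eventually (gt_mem_nhds h)] with x hx
      rw [indicator_of_mem (Metric.mem_closedBall.2 hx.le)]
    · refine ContinuousAt.congr (f := fun _ => (0 : ℝ)) continuousAt_const ?_
      filter_upwards [hc.eventually (lt_mem_nhds h)] with x hx
      rw [indicator_of_notMem fun h' => absurd (Metric.mem_closedBall.1 h') (not_le.2 hx)]

/-- Interior Morrey embedding: for `s p > n` functions in `W^{s,p}(Ω)` have a representative that is
continuous in `Ω`. -/
theorem MemW.exists_continuousOn_rep (hopen : IsOpen Ω)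
    (hbdd : Bornology.IsBounded Ω) (hs0 : 0 < s) (hp : 1 < p) (hsp : (n : ℝ) < s * p)
    {u : Euc n → ℝ} (hu : MemW Ω s p u) : ∃ v, ContinuousOn v Ω ∧ v =ᵐ[vol Ω] u := by
  have := isFiniteMeasure_vol hbdd
  have hp0 : 0 < p := by linarith
  have hui := hu.integrable hbdd hp.le
  set ω := (volume : Measure (Euc n)).real (Metric.closedBall 0 1) with hω
  have hω0 : 0 < ω :=
    ENNReal.toReal_pos (Metric.measure_closedBall_pos _ _ one_pos).ne'
      (isCompact_closedBall _ _).measure_ne_top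
  set A : ℕ → Euc n → ℝ := fun j x => meanOn Ω u (Metric.closedBall x ((1 / 2 : ℝ) ^ j)) with hA
  set E := gagliardoEnergy Ω s p u with hE
  have hE0 : 0 ≤ E := gagliardoEnergy_nonneg _ _ _ _
  set C₀ := E * 2 ^ ((n : ℝ) + s * p) * 2 ^ (n : ℝ) / ω ^ 2 with hC₀
  have hC₀0 : 0 ≤ C₀ := by positivity
  set C := C₀ ^ (1 / p) with hC
  set θ := (1 / 2 : ℝ) ^ ((s * p - n) / p) with hθ
  have hθ0 : 0 < θ := by positivity
  have hθ1 : θ < 1 := Real.rpow_lt_one (by norm_num) (by norm_num) (div_pos (by linarith) hp0)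
  have hstep : ∀ j x, Metric.closedBall x ((1 / 2 : ℝ) ^ j) ⊆ Ω →
      |A j x - A (j + 1) x| ≤ C * θ ^ j := by
    intro j x hx
    set r := (1 / 2 : ℝ) ^ j with hr
    have hr0 : 0 < r := by positivity
    have hr' : (1 / 2 : ℝ) ^ (j + 1) = r / 2 := by rw [pow_succ]; ring
    have hx' : Metric.closedBall x (r / 2) ⊆ Ω :=
      (Metric.closedBall_subset_closedBall (by linarith)).trans hx
    have v1 : (vol Ω).real (Metric.closedBall x r) = r ^ (n : ℝ) * ω := by
      rw [vol_real_of_subset Metric.isClosed_closedBall.measurableSet hx,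
        volume_real_closedBall x hr0.le]
    have v2 : (vol Ω).real (Metric.closedBall x (r / 2)) = (r / 2) ^ (n : ℝ) * ω := by
      rw [vol_real_of_subset Metric.isClosed_closedBall.measurableSet hx',
        volume_real_closedBall x (by positivity)]
    have h := hu.mean_sub_mean_le hopen hbdd hs0 hp (A := Metric.closedBall x r)
      (B := Metric.closedBall x (r / 2)) Metric.isClosed_closedBall.measurableSet
      Metric.isClosed_closedBall.measurableSet (by rw [v1]; positivity) (by rw [v2]; positivity)
      (d := 2 * r) (by positivity) (fun y hy _ z hz _ => by
        have e1 := Metric.mem_closedBall.1 hy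
        have e2 := Metric.mem_closedBall'.1 hz
        rw [← dist_eq_norm]
        linarith [dist_triangle y x z])
    rw [v1, v2] at h
    -- Two ball volumes use up r^(2n), leaving the positive power r^(sp-n); consecutive dyadic means
    -- thus differ by a convergent geometric series.
    have e : (2 * r) ^ ((n : ℝ) + s * p) * E / (r ^ (n : ℝ) * ω * ((r / 2) ^ (n : ℝ) * ω)) =
        C₀ * r ^ (s * p - n) := by
      rw [hC₀, Real.mul_rpow zero_le_two hr0.le, Real.div_rpow hr0.le zero_le_two,
        Real.rpow_add hr0, Real.rpow_sub hr0]
      field_simp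
    rw [← hE, e] at h
    have h2 := Real.rpow_le_rpow (by positivity) h (z := 1 / p) (by positivity)
    rw [← Real.rpow_mul (abs_nonneg _), mul_one_div_cancel hp0.ne', Real.rpow_one,
      Real.mul_rpow hC₀0 (by positivity), ← Real.rpow_mul hr0.le, mul_one_div] at h2
    have e2 : r ^ ((s * p - n) / p) = θ ^ j := by
      rw [hr, hθ, ← Real.rpow_natCast, ← Real.rpow_natCast, ← Real.rpow_mul (by norm_num),
        ← Real.rpow_mul (by norm_num), mul_comm]
    rw [e2] at h2
    simp only [hA, hr']
    exact h2
  have hpow : Tendsto (fun j : ℕ => (1 / 2 : ℝ) ^ j) atTop (𝓝 0) :=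
    tendsto_pow_atTop_nhds_zero_of_lt_one (by norm_num) (by norm_num)
  set v : Euc n → ℝ := fun x => limUnder atTop (fun j => A j x) with hv
  -- locally uniform convergence of the dyadic means
  have hloc : ∀ x₀ ∈ Ω, ∃ ρ > 0, ∃ j₀, ∀ x ∈ Metric.ball x₀ ρ,
      (∀ j ≥ j₀, Metric.closedBall x ((1 / 2 : ℝ) ^ j) ⊆ Ω) := by
    intro x₀ hx₀
    obtain ⟨ρ, hρ, h⟩ := Metric.isOpen_iff.1 hopen x₀ hx₀
    obtain ⟨j₀, hj₀⟩ := eventually_atTop.1 (hpow.eventually_lt_const (by positivity : 0 < ρ / 2))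
    refine ⟨ρ / 2, by positivity, j₀, fun x hx j hj y hy => h ?_⟩
    have e1 := Metric.mem_closedBall.1 hy
    have e2 := Metric.mem_ball.1 hx
    rw [Metric.mem_ball]
    linarith [dist_triangle y x x₀, hj₀ j hj]
  have htend : ∀ j₀ x, (∀ j ≥ j₀, Metric.closedBall x ((1 / 2 : ℝ) ^ j) ⊆ Ω) →
      Tendsto (fun j => A j x) atTop (𝓝 (v x)) ∧
      ∀ j, dist (A (j + j₀) x) (v x) ≤ C * θ ^ j₀ * θ ^ j / (1 - θ) := by
    intro j₀ x hx
    have hs : ∀ j, dist (A (j + j₀) x) (A (j + 1 + j₀) x) ≤ C * θ ^ j₀ * θ ^ j := by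
      intro j
      rw [Real.dist_eq, show j + 1 + j₀ = j + j₀ + 1 by ring]
      refine (hstep (j + j₀) x (hx _ (by omega))).trans (le_of_eq ?_)
      rw [pow_add]; ring
    obtain ⟨a, ha⟩ := cauchySeq_tendsto_of_complete (cauchySeq_of_le_geometric θ _ hθ1 hs)
    have ha' : Tendsto (fun j => A j x) atTop (𝓝 a) := (tendsto_add_atTop_iff_nat j₀).1 ha
    have hva : v x = a := ha'.limUnder_eq
    rw [hva]
    exact ⟨ha', dist_le_of_le_geometric_of_tendsto θ _ hθ1 hs ha⟩
  refine ⟨v, ?_, ?_⟩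
  · intro x₀ hx₀
    obtain ⟨ρ, hρ, j₀, hj₀⟩ := hloc x₀ hx₀
    have hunif : TendstoUniformlyOn (fun j x => A (j + j₀) x) v atTop (Metric.ball x₀ ρ) := by
      rw [Metric.tendstoUniformlyOn_iff]
      intro ε hε
      have hg : Tendsto (fun j : ℕ => C * θ ^ j₀ * θ ^ j / (1 - θ)) atTop (𝓝 0) := by
        have := (tendsto_pow_atTop_nhds_zero_of_lt_one hθ0.le hθ1).const_mul (C * θ ^ j₀)
        simpa using this.div_const (1 - θ)
      filter_upwards [hg.eventually_lt_const hε] with j hj x hx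
      rw [dist_comm]
      exact ((htend j₀ x (hj₀ x hx)).2 j).trans_lt hj
    have hcont : ContinuousOn v (Metric.ball x₀ ρ) := by
      refine hunif.continuousOn (Frequently.of_forall fun j => ?_)
      intro x hx
      have hr0 : (0 : ℝ) < (1 / 2 : ℝ) ^ (j + j₀) := by positivity
      have h1 := (continuousAt_integral_closedBall hui hr0 x).continuousWithinAt
        (s := Metric.ball x₀ ρ)
      refine (h1.div_const (((1 / 2 : ℝ) ^ (j + j₀)) ^ (n : ℝ) * ω)).congr (fun y hy => ?_) ?_
      · simp only [hA, meanOn]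
        rw [vol_real_of_subset Metric.isClosed_closedBall.measurableSet (hj₀ y hy _ (by omega)),
          volume_real_closedBall y hr0.le]
      · simp only [hA, meanOn]
        rw [vol_real_of_subset Metric.isClosed_closedBall.measurableSet (hj₀ x hx _ (by omega)),
          volume_real_closedBall x hr0.le]
    exact (hcont.continuousAt (Metric.ball_mem_nhds x₀ hρ)).continuousWithinAt
  · have hind : Integrable (Ω.indicator u) (volume : Measure (Euc n)) :=
      (integrable_indicator_iff hopen.measurableSet).2 hui
    have hleb := IsUnifLocDoublingMeasure.ae_tendsto_average (μ := (volume : Measure (Euc n)))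
      hind.locallyIntegrable 1
    have hpow' : Tendsto (fun j : ℕ => (1 / 2 : ℝ) ^ j) atTop (𝓝[>] 0) :=
      tendsto_nhdsWithin_iff.2 ⟨hpow, Eventually.of_forall fun j => by
        simp only [mem_Ioi]; positivity⟩
    filter_upwards [ae_restrict_of_ae (s := Ω) hleb, ae_mem_vol hopen] with x hx hxΩ
    obtain ⟨ρ, hρ, j₀, hj₀⟩ := hloc x hxΩ
    have hb := hj₀ x (Metric.mem_ball_self hρ)
    have h1 := hx (fun _ : ℕ => x) (fun j => (1 / 2 : ℝ) ^ j) hpow'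
      (Eventually.of_forall fun j => Metric.mem_closedBall_self (by positivity))
    rw [indicator_of_mem hxΩ] at h1
    refine tendsto_nhds_unique ((htend j₀ x hb).1) (h1.congr' ?_)
    filter_upwards [eventually_ge_atTop j₀] with j hj
    have hsub := hb j hj
    have hm : MeasurableSet (Metric.closedBall x ((1 / 2 : ℝ) ^ j)) :=
      Metric.isClosed_closedBall.measurableSet
    simp only [hA, meanOn]
    rw [setAverage_eq, smul_eq_mul, vol_restrict_of_subset hm hsub, vol_real_of_subset hm hsub,
      setIntegral_congr_fun hm (fun y hy => indicator_of_mem (hsub hy) u)]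
    ring

/-! ### Touching functions and difference quotients -/

/-- A function touching the limit of minimizers from below cannot be a strict subsolution near the
contact point. -/
lemma no_strict_touching (hopen : IsOpen Ω) (hne : Ω.Nonempty)
    (hbdd : Bornology.IsBounded Ω) (hs0 : 0 < s) (hs1 : s < 1) {p : ℕ → ℝ}
    {u : ℕ → Euc n → ℝ} (hp : Tendsto p atTop atTop)
    (hu : ∀ k, IsNormalizedMinimizer Ω s (p k) (u k)) {f φ : Euc n → ℝ} (hf : Continuous f)
    (hunif : ∀ δ > 0, ∀ᶠ k in atTop, ∀ᵐ x ∂(vol Ω), |u k x - f x| ≤ δ)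
    (hφ : ContinuousOn φ (closure Ω)) {x₀ : Euc n} (hx₀ : x₀ ∈ Ω) (hφx : φ x₀ = f x₀)
    (hφf : ∀ x ∈ closure Ω, φ x ≤ f x) {η ρ : ℝ} (hη : 0 < η) (hρ : 0 < ρ) {w : Euc n → ℝ}
    (hw : ∀ x, w x = φ x - η * ‖x - x₀‖ ^ 2) {L H : ℝ} (hL0 : 0 ≤ L) (hH0 : 0 ≤ H)
    (hL : ∀ x ∈ Metric.ball x₀ ρ, x ∈ Ω → ∀ y ∈ Ω, |w x - w y| ≤ L * ‖x - y‖)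
    (hH : ∀ x ∈ Metric.ball x₀ ρ, x ∈ Ω → ∀ y ∈ Ω, w x - w y ≤ H * ‖x - y‖ ^ s)
    {G : Set (Euc n × Euc n)} (hG : MeasurableSet G) {γ : ℕ → ℝ}
    (hgain : ∀ᶠ k in atTop, ∀ x ∈ Metric.ball x₀ ρ, x ∈ Ω → ∀ y ∈ Ω, (x, y) ∈ G →
      oddPow (p k) (w x - w y) / ‖x - y‖ ^ ((n : ℝ) + s * p k) ≤ -γ k) {δ : ℝ} (hδ : 0 < δ)
    (hlt : ∀ᶠ k in atTop, ∀ x ∈ Metric.ball x₀ ρ, ∀ c, f x - δ ≤ c →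
      2 * (H ^ (p k - 1 - ((n : ℝ) + s) / (1 - s)) * L ^ (((n : ℝ) + s) / (1 - s)) *
        (vol Ω).real univ - γ k * (vol Ω).real {y | (x, y) ∈ G}) <
        eigenvalue Ω s (p k) * oddPow (p k) c) : False := by
  set m := ((n : ℝ) + s) / (1 - s) with hm
  -- The quadratic perturbation costs 2e outside the ball of radius ρ, so after raising w by e it is
  -- still below f by e there, but above f by e at x₀.
  set e := η * ρ ^ 2 / 2 with he
  have he0 : 0 < e := by positivity
  have hwc : ContinuousOn w (closure Ω) := by
    have : w = fun x => φ x - η * ‖x - x₀‖ ^ 2 := funext hw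
    rw [this]
    exact hφ.sub (Continuous.continuousOn (by fun_prop))
  set W : Euc n → ℝ := fun x => w x + e with hW
  have hWc : ContinuousOn W (closure Ω) := hwc.add continuousOn_const
  obtain ⟨M, hM⟩ := hbdd.isCompact_closure.exists_bound_of_continuousOn hWc
  have hdiff : ∀ x y, W x - W y = w x - w y := fun x y => by simp [hW]
  obtain ⟨k, hk1, hk2, ⟨hp2, hps, hpm⟩, hk3, hk4⟩ := ((hunif (min δ e) (by positivity)).and
    ((hunif (e / 4) (by positivity)).and ((hp.eventually (eventually_exponent n hs1 (m + 1))).and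
    (hgain.and hlt)))).exists
  have hp1 : 1 < p k := by linarith
  have hC0 : 0 ≤ H ^ (p k - 1 - m) * L ^ m := by positivity
  have hmain : ∀ᵐ x ∂(vol Ω), W x ≤ u k x := by
    -- Off the ball, closeness of the minimizer to f gives the required inequality. Intersecting
    -- with the set where it is close to f, which has full measure, makes the lower bound f - δ
    -- available pointwise.
    refine (hu k).comparison hopen hne hbdd hp2 hps
      (S := Metric.ball x₀ ρ ∩ {x | |u k x - f x| ≤ min δ e}) (L := L) (M := M)
      (C := H ^ (p k - 1 - m) * L ^ m) (G := G) (γ := fun _ => γ k)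
      ((hWc.mono subset_closure).aestronglyMeasurable hopen.measurableSet)
      (fun x _ hx => hM x (subset_closure hx)) ?_ ?_ ?_ hG ?_ ?_ ?_
    · intro x hx hxΩ y hy
      rw [hdiff]; exact hL x hx.1 hxΩ y hy
    · filter_upwards [hk1, ae_mem_vol hopen] with x hx hxΩ hxS
      have hxb : ρ ≤ ‖x - x₀‖ := by
        by_contra! h
        exact hxS ⟨by rwa [Metric.mem_ball, dist_eq_norm], hx⟩
      have h1 := (abs_le.1 hx).1
      have h2 := min_le_right δ e
      have h3 := hφf x (subset_closure hxΩ)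
      have h4 : η * ρ ^ 2 ≤ η * ‖x - x₀‖ ^ 2 := by gcongr
      have h5 : W x = φ x - η * ‖x - x₀‖ ^ 2 + e := by simp only [hW, hw]
      rw [h5]
      linarith
    · intro x hx hxΩ y hy
      rw [hdiff]
      exact oddPow_div_le hs0 hs1 hp1 (by linarith) (norm_nonneg _) hH0 hL0 (hH x hx.1 hxΩ y hy)
        ((le_abs_self _).trans (hL x hx.1 hxΩ y hy))
    · intro hψ
      exact (hψ.integrable hbdd hp1.le).const_mul _
    · intro x hx hxΩ y hy hxy hxu
      have h1 := hk3 x hx.1 hxΩ y hy hxy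
      rw [← hdiff] at h1
      refine ⟨fun _ => by linarith, fun hyu => ?_⟩
      refine le_trans ?_ (by linarith : -γ k ≤ H ^ (p k - 1 - m) * L ^ m - γ k)
      refine le_trans ?_ h1
      gcongr
      exact oddPow_mono hp1 (by linarith)
    · intro x hx hxΩ _
      refine hk4 x hx.1 (u k x) ?_
      have h1 := (abs_le.1 (show |u k x - f x| ≤ min δ e from hx.2)).1
      linarith [min_le_left δ e]
  have hae : ∀ᵐ x ∂(vol Ω), W x - f x ≤ e / 4 := by
    filter_upwards [hmain, hk2] with x h1 h2
    have := (abs_le.1 h2).2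
    linarith
  -- Comparison gives W ≤ f + e/4, first almost everywhere and then by continuity at x₀, where W = f
  -- + e.
  have h1 := le_of_ae_le hopen ((hWc.mono subset_closure).sub hf.continuousOn) hae hx₀
  have h2 : W x₀ = f x₀ + e := by simp [hW, hw, hφx]
  rw [Pi.sub_apply, h2] at h1
  linarith

/-- A `C¹` function is Lipschitz when one of the points is close to a given interior point. -/
lemma IsC1Closure.exists_lipschitz (hopen : IsOpen Ω) (hbdd : Bornology.IsBounded Ω)
    {φ : Euc n → ℝ} (hφ : IsC1Closure Ω φ) {x₀ : Euc n} (hx₀ : x₀ ∈ Ω) :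
    ∃ ρ > 0, ∃ L > 0, Metric.ball x₀ ρ ⊆ Ω ∧
      ∀ x ∈ Metric.ball x₀ ρ, ∀ y ∈ closure Ω, |φ x - φ y| ≤ L * ‖x - y‖ := by
  obtain ⟨hc, g, hg, hd⟩ := hφ
  obtain ⟨M, hM⟩ := hbdd.isCompact_closure.exists_bound_of_continuousOn hc
  obtain ⟨M', hM'⟩ := hbdd.isCompact_closure.exists_bound_of_continuousOn hg
  obtain ⟨r, hr, hrΩ⟩ := Metric.isOpen_iff.1 hopen x₀ hx₀
  have hM0 : 0 ≤ M := (norm_nonneg _).trans (hM x₀ (subset_closure hx₀))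
  have hM0' : 0 ≤ M' := (norm_nonneg _).trans (hM' x₀ (subset_closure hx₀))
  have hsub : Metric.ball x₀ (r / 2) ⊆ Metric.ball x₀ r := Metric.ball_subset_ball (by linarith)
  refine ⟨r / 2, by positivity, M' + 4 * M / r + 1, by positivity, hsub.trans hrΩ, ?_⟩
  intro x hx y hy
  -- Since Ω need not be convex, the mean value inequality is used only inside a ball. A point
  -- outside it is at distance at least r/2, where boundedness of φ suffices.
  by_cases hyb : y ∈ Metric.ball x₀ r
  · have h := (convex_ball x₀ r).norm_image_sub_le_of_norm_hasFDerivWithin_le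
      (fun z hz => (hd z (hrΩ hz)).hasFDerivWithinAt)
      (fun z hz => hM' z (subset_closure (hrΩ hz))) hyb (hsub hx)
    rw [Real.norm_eq_abs] at h
    refine h.trans ?_
    have : 0 ≤ 4 * M / r := by positivity
    gcongr
    linarith
  · have h1 : r / 2 ≤ ‖x - y‖ := by
      have e1 := Metric.mem_ball.1 hx
      have e2 := not_lt.1 (Metric.mem_ball.not.1 hyb)
      rw [← dist_eq_norm]
      linarith [dist_triangle y x x₀, dist_comm x y]
    have h2 : |φ x - φ y| ≤ M + M := by
      refine (abs_sub _ _).trans (add_le_add ?_ ?_)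
      · exact hM x (subset_closure (hrΩ (hsub hx)))
      · exact hM y hy
    have h3 : M + M ≤ 4 * M / r * ‖x - y‖ := by
      calc M + M = 4 * M / r * (r / 2) := by field_simp; ring
        _ ≤ _ := by gcongr
    have h4 : 4 * M / r * ‖x - y‖ ≤ (M' + 4 * M / r + 1) * ‖x - y‖ := by
      gcongr; linarith
    linarith

section Quotients

variable {φ : Euc n → ℝ} {x₀ : Euc n} {L : ℝ}

/-- As s < 1, the Lipschitz bound controls the quotients even near x₀; the infimum defining ℒ⁻ is
therefore a genuine one. -/
lemma abs_quotient_le (hbdd : Bornology.IsBounded Ω) (hs1 : s < 1) (hL : 0 ≤ L)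
    (hx₀ : x₀ ∈ Ω) (h : ∀ y ∈ closure Ω, |φ x₀ - φ y| ≤ L * ‖x₀ - y‖) {y : Euc n}
    (hy : y ∈ closure Ω \ {x₀}) :
    |(φ y - φ x₀) / ‖y - x₀‖ ^ s| ≤ L * Metric.diam Ω ^ (1 - s) := by
  have hpos : 0 < ‖y - x₀‖ := norm_pos_iff.2 (sub_ne_zero.2 hy.2)
  have hd : ‖y - x₀‖ ≤ Metric.diam Ω := by
    rw [← Metric.diam_closure]
    exact norm_sub_le_diam hbdd.closure hy.1 (subset_closure hx₀)
  have h1 := h y hy.1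
  rw [abs_sub_comm, norm_sub_rev] at h1
  rw [abs_div, abs_of_nonneg (a := ‖y - x₀‖ ^ s) (by positivity), div_le_iff₀ (by positivity)]
  refine h1.trans ?_
  have e : ‖y - x₀‖ = ‖y - x₀‖ ^ (1 - s) * ‖y - x₀‖ ^ s := by
    rw [← Real.rpow_add hpos]; simp
  calc L * ‖y - x₀‖ = L * ‖y - x₀‖ ^ (1 - s) * ‖y - x₀‖ ^ s := by rw [mul_assoc, ← e]
    _ ≤ _ := by
      gcongr

lemma Lminus_mul_le (hbdd : Bornology.IsBounded Ω) (hs0 : 0 < s) (hs1 : s < 1) (hL : 0 ≤ L)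
    (hx₀ : x₀ ∈ Ω) (h : ∀ y ∈ closure Ω, |φ x₀ - φ y| ≤ L * ‖x₀ - y‖) {y : Euc n}
    (hy : y ∈ closure Ω) : Lminus Ω s φ x₀ * ‖y - x₀‖ ^ s ≤ φ y - φ x₀ := by
  rcases eq_or_ne y x₀ with rfl | hne
  · simp [Real.zero_rpow hs0.ne']
  · have hpos : 0 < ‖y - x₀‖ := norm_pos_iff.2 (sub_ne_zero.2 hne)
    rw [← le_div_iff₀ (by positivity)]
    refine csInf_le ⟨-(L * Metric.diam Ω ^ (1 - s)), ?_⟩ ⟨y, ⟨hy, hne⟩, rfl⟩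
    rintro _ ⟨z, hz, rfl⟩
    exact neg_le_of_abs_le (abs_quotient_le hbdd hs1 hL hx₀ h hz)

/-- The quotients tend to 0 as y → x₀, because φ is Lipschitz there and s < 1. -/
lemma Lminus_nonpos (hn : 1 ≤ n) (hopen : IsOpen Ω) (hbdd : Bornology.IsBounded Ω) (hs0 : 0 < s)
    (hs1 : s < 1) (hL : 0 ≤ L) (hx₀ : x₀ ∈ Ω)
    (h : ∀ y ∈ closure Ω, |φ x₀ - φ y| ≤ L * ‖x₀ - y‖) : Lminus Ω s φ x₀ ≤ 0 := by
  have : Nonempty (Fin n) := ⟨⟨0, hn⟩⟩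
  by_contra! hpos
  have hlim : Tendsto (fun y : Euc n => L * ‖y - x₀‖ ^ (1 - s)) (𝓝 x₀) (𝓝 0) := by
    have hc : Continuous fun y : Euc n => L * ‖y - x₀‖ ^ (1 - s) :=
      continuous_const.mul (Continuous.rpow_const (continuous_id.sub continuous_const).norm
        fun _ => Or.inr (by linarith))
    have := hc.tendsto x₀
    simpa [Real.zero_rpow (by linarith : 1 - s ≠ 0)] using this
  have hev : ∀ᶠ y in 𝓝[≠] x₀, L * ‖y - x₀‖ ^ (1 - s) < Lminus Ω s φ x₀ ∧ y ∈ Ω ∧ y ≠ x₀ := by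
    have h1 := (hlim.eventually_lt_const hpos).and (hopen.mem_nhds hx₀)
    filter_upwards [nhdsWithin_le_nhds h1, self_mem_nhdsWithin] with y hy hy' using
      ⟨hy.1, hy.2, hy'⟩
  have : (𝓝[≠] x₀).NeBot := inferInstance
  obtain ⟨y, h1, hyΩ, hyne⟩ := hev.exists
  have hp : 0 < ‖y - x₀‖ := norm_pos_iff.2 (sub_ne_zero.2 hyne)
  have h2 := Lminus_mul_le hbdd hs0 hs1 hL hx₀ h (subset_closure hyΩ)
  have h3 := h y (subset_closure hyΩ)
  rw [abs_sub_comm, norm_sub_rev] at h3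
  have e : ‖y - x₀‖ = ‖y - x₀‖ ^ (1 - s) * ‖y - x₀‖ ^ s := by
    rw [← Real.rpow_add hp]; simp
  have h4 : L * ‖y - x₀‖ = L * ‖y - x₀‖ ^ (1 - s) * ‖y - x₀‖ ^ s := by rw [mul_assoc, ← e]
  have h5 : 0 < ‖y - x₀‖ ^ s := by positivity
  have h6 := mul_lt_mul_of_pos_right h1 h5
  linarith [le_abs_self (φ y - φ x₀)]

/-- Values below `ℒ⁺` are attained strictly by a quotient at a point of `Ω`. -/
lemma exists_lt_of_lt_Lplus (hφ : ContinuousOn φ (closure Ω)) (hne : (closure Ω \ {x₀}).Nonempty)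
    (hs0 : 0 < s) {b : ℝ} (hb : b < Lplus Ω s φ x₀) :
    ∃ y ∈ Ω, b * ‖y - x₀‖ ^ s < φ y - φ x₀ := by
  obtain ⟨_, ⟨y, hy, rfl⟩, hlt⟩ := exists_lt_of_lt_csSup (hne.image _) hb
  have hpos : 0 < ‖y - x₀‖ := norm_pos_iff.2 (sub_ne_zero.2 hy.2)
  simp only at hlt
  rw [lt_div_iff₀ (by positivity)] at hlt
  have hc : ContinuousOn (fun y => φ y - φ x₀ - b * ‖y - x₀‖ ^ s) (closure Ω) :=
    (hφ.sub continuousOn_const).sub (Continuous.continuousOn (continuous_const.mul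
      (Continuous.rpow_const (continuous_id.sub continuous_const).norm fun _ => Or.inr hs0.le)))
  have hev := (hc y hy.1).eventually (lt_mem_nhds (sub_pos.2 hlt))
  have hnb : (𝓝[Ω] y).NeBot := mem_closure_iff_nhdsWithin_neBot.1 hy.1
  have hev2 := (nhdsWithin_mono y subset_closure hev : ∀ᶠ z in 𝓝[Ω] y, _)
  obtain ⟨z, hz, hzΩ⟩ := (Filter.Eventually.and hev2 self_mem_nhdsWithin).exists
  exact ⟨z, hzΩ, by linarith⟩

end Quotients

lemma abs_sq_norm_sub_le (hbdd : Bornology.IsBounded Ω) {x₀ x y : Euc n} (hx₀ : x₀ ∈ Ω)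
    (hx : x ∈ Ω) (hy : y ∈ Ω) :
    |‖x - x₀‖ ^ 2 - ‖y - x₀‖ ^ 2| ≤ 2 * Metric.diam Ω * ‖x - y‖ := by
  have h1 := norm_sub_le_diam hbdd hx hx₀
  have h2 := norm_sub_le_diam hbdd hy hx₀
  have h3 := abs_norm_sub_norm_le (x - x₀) (y - x₀)
  rw [sub_sub_sub_cancel_right] at h3
  have e : ‖x - x₀‖ ^ 2 - ‖y - x₀‖ ^ 2 = (‖x - x₀‖ + ‖y - x₀‖) * (‖x - x₀‖ - ‖y - x₀‖) := by ring
  rw [e, abs_mul, abs_of_nonneg (by positivity : 0 ≤ ‖x - x₀‖ + ‖y - x₀‖)]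
  calc _ ≤ (Metric.diam Ω + Metric.diam Ω) * ‖x - y‖ := by gcongr
    _ = _ := by ring

/-- A smallness parameter for which the perturbation errors are below a given threshold. -/
lemma exists_small (hs0 : 0 < s) (A B : ℝ) {ε : ℝ} (hε : 0 < ε) {r : ℝ} (hr : 0 < r) :
    ∃ κ, 0 < κ ∧ κ ≤ r ∧ A * κ + B * κ ^ s ≤ ε := by
  have hc : Continuous fun κ : ℝ => A * κ + B * κ ^ s :=
    (continuous_const.mul continuous_id).add
      (continuous_const.mul (Real.continuous_rpow_const hs0.le))
  have h1 : Tendsto (fun κ : ℝ => A * κ + B * κ ^ s) (𝓝[>] 0) (𝓝 0) := by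
    have := (hc.tendsto 0).mono_left (nhdsWithin_le_nhds (s := Ioi 0))
    simpa [Real.zero_rpow hs0.ne'] using this
  obtain ⟨κ, h2, h3, h4⟩ := ((h1.eventually_le_const hε).and
    ((Ioc_mem_nhdsGT hr : Ioc 0 r ∈ 𝓝[>] (0 : ℝ)))).exists
  exact ⟨κ, h3, h4, h2⟩

/-- A one-sided Hölder bound at `x₀` persists for the perturbed function near `x₀`. -/
lemma perturbed_upper (hbdd : Bornology.IsBounded Ω) (hs0 : 0 < s) (hs1 : s < 1) {φ w : Euc n → ℝ}
    {x₀ : Euc n} (hx₀ : x₀ ∈ Ω) {η κ L a a₁ τ : ℝ} (hη0 : 0 ≤ η) (hηκ : η ≤ κ) (hL0 : 0 ≤ L)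
    (ha0 : 0 ≤ a) (haa : a ≤ a₁)
    (hw : ∀ x, w x = φ x - η * ‖x - x₀‖ ^ 2) (hτ0 : 0 < τ)
    {L' : ℝ} (hL'0 : 0 ≤ L') (hτ : L' * τ ^ (1 - s) ≤ a₁)
    (hsmall : (L + Metric.diam Ω ^ 2) * κ + a * κ ^ s ≤ (a₁ - a) * τ ^ s)
    (hLφ : ∀ x ∈ Metric.ball x₀ κ, |φ x - φ x₀| ≤ L * ‖x - x₀‖)
    (hLw : ∀ x ∈ Metric.ball x₀ κ, x ∈ Ω → ∀ y ∈ Ω, |w x - w y| ≤ L' * ‖x - y‖)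
    (ha : ∀ y ∈ Ω, φ x₀ - φ y ≤ a * ‖y - x₀‖ ^ s) :
    ∀ x ∈ Metric.ball x₀ κ, x ∈ Ω → ∀ y ∈ Ω, w x - w y ≤ a₁ * ‖x - y‖ ^ s := by
  intro x hx hxΩ y hyΩ
  have hxκ : ‖x - x₀‖ ≤ κ := by
    rw [← dist_eq_norm]; exact (Metric.mem_ball.1 hx).le
  -- Below the scale τ the Lipschitz bound already gives the Hölder constant a₁; beyond it, the
  -- slack (a₁ - a)τ^s absorbs the perturbation.
  rcases le_or_gt ‖x - y‖ τ with hcase | hcase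
  · rcases (norm_nonneg (x - y)).eq_or_lt with h0 | hpos
    · have : x = y := by rw [← sub_eq_zero]; exact norm_eq_zero.1 h0.symm
      rw [this, sub_self, sub_self, norm_zero, Real.zero_rpow hs0.ne', mul_zero]
    · have e : ‖x - y‖ = ‖x - y‖ ^ (1 - s) * ‖x - y‖ ^ s := by
        rw [← Real.rpow_add hpos]; simp
      calc w x - w y ≤ L' * ‖x - y‖ := (le_abs_self _).trans (hLw x hx hxΩ y hyΩ)
        _ = L' * ‖x - y‖ ^ (1 - s) * ‖x - y‖ ^ s := by rw [mul_assoc, ← e]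
        _ ≤ L' * τ ^ (1 - s) * ‖x - y‖ ^ s := by gcongr
        _ ≤ _ := by gcongr
  · have h1 : φ x - φ x₀ ≤ L * κ :=
      (le_abs_self _).trans ((hLφ x hx).trans (by gcongr))
    have h2 := ha y hyΩ
    have h3 : ‖y - x₀‖ ^ s ≤ ‖x - y‖ ^ s + κ ^ s := by
      refine rpow_le_rpow_add_rpow (norm_nonneg _) (norm_nonneg _) ((norm_nonneg _).trans hxκ)
        hs0.le hs1.le ?_
      have := norm_sub_le_norm_sub_add_norm_sub y x x₀
      rw [norm_sub_rev y x] at this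
      linarith
    have h4 : η * ‖y - x₀‖ ^ 2 ≤ κ * Metric.diam Ω ^ 2 := by
      have := hη0.trans hηκ
      gcongr
      exact norm_sub_le_diam hbdd hyΩ hx₀
    have h5 : 0 ≤ η * ‖x - x₀‖ ^ 2 := by positivity
    have h6 : (a₁ - a) * τ ^ s ≤ (a₁ - a) * ‖x - y‖ ^ s := by
      gcongr
    have h7 := mul_le_mul_of_nonneg_left h3 ha0
    rw [hw, hw]
    linarith

/-- A strict lower Hölder bound at `x₀` persists for the perturbed function. -/
lemma perturbed_lower (hbdd : Bornology.IsBounded Ω) (hs0 : 0 < s) (hs1 : s < 1) {φ w : Euc n → ℝ}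
    {x₀ : Euc n} (hx₀ : x₀ ∈ Ω) {η κ L b μ : ℝ} (hη0 : 0 ≤ η) (hηκ : η ≤ κ) (hL0 : 0 ≤ L)
    (hb0 : 0 ≤ b) (hw : ∀ x, w x = φ x - η * ‖x - x₀‖ ^ 2)
    (hsmall : (L + Metric.diam Ω ^ 2) * κ + b * κ ^ s ≤ μ)
    (hLφ : ∀ x ∈ Metric.ball x₀ κ, |φ x - φ x₀| ≤ L * ‖x - x₀‖) {y : Euc n} (hy : y ∈ Ω)
    (hby : b * ‖y - x₀‖ ^ s + μ < φ y - φ x₀) :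
    ∀ x ∈ Metric.ball x₀ κ, w x - w y < -(b * ‖x - y‖ ^ s) := by
  intro x hx
  have hxκ : ‖x - x₀‖ ≤ κ := by
    rw [← dist_eq_norm]; exact (Metric.mem_ball.1 hx).le
  have h1 : φ x - φ x₀ ≤ L * κ :=
    (le_abs_self _).trans ((hLφ x hx).trans (by gcongr))
  have h3 : ‖x - y‖ ^ s ≤ ‖y - x₀‖ ^ s + κ ^ s := by
    refine rpow_le_rpow_add_rpow (norm_nonneg _) (norm_nonneg _) ((norm_nonneg _).trans hxκ)
      hs0.le hs1.le ?_
    have := norm_sub_le_norm_sub_add_norm_sub y x₀ x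
    rw [norm_sub_rev y x, norm_sub_rev x₀ x] at this
    linarith
  have h4 : η * ‖y - x₀‖ ^ 2 ≤ κ * Metric.diam Ω ^ 2 := by
    have := hη0.trans hηκ
    gcongr
    exact norm_sub_le_diam hbdd hy hx₀
  have h5 : 0 ≤ η * ‖x - x₀‖ ^ 2 := by positivity
  have h7 := mul_le_mul_of_nonneg_left h3 hb0
  rw [hw, hw]
  linarith

/-! ### The limit equation -/

set_option maxHeartbeats 1000000 in
/-- The unified form of the supersolution property. -/
theorem limit_touching (hn : 1 ≤ n) (hopen : IsOpen Ω) (hne : Ω.Nonempty)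
    (hbdd : Bornology.IsBounded Ω) (hs0 : 0 < s) (hs1 : s < 1) {p : ℕ → ℝ}
    {u : ℕ → Euc n → ℝ} (hp : Tendsto p atTop atTop)
    (hu : ∀ k, IsNormalizedMinimizer Ω s (p k) (u k)) {f φ : Euc n → ℝ}
    (hf : IsHolder s (2 / Metric.diam Ω ^ s) f)
    (hunif : ∀ δ > 0, ∀ᶠ k in atTop, ∀ᵐ x ∂(vol Ω), |u k x - f x| ≤ δ)
    (hφ : IsC1Closure Ω φ) {x₀ : Euc n} (hx₀ : x₀ ∈ Ω) (hφx : φ x₀ = f x₀)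
    (hφf : ∀ x ∈ closure Ω, φ x ≤ f x) :
    Lminus Ω s φ x₀ ≤ 0 ∧
    max (Lplus Ω s φ x₀) (2 / Metric.diam Ω ^ s * max (φ x₀) 0) ≤
      max (-Lminus Ω s φ x₀) (2 / Metric.diam Ω ^ s * max (-φ x₀) 0) := by
  have := isFiniteMeasure_vol hbdd
  have hD := diam_pos hn hopen hne hbdd
  set D := Metric.diam Ω with hDdef
  set Λ := 2 / D ^ s with hΛ
  have hΛ0 : 0 < Λ := by positivity
  have hs' : 0 < 1 - s := by linarith
  obtain ⟨ρ₀, hρ₀, L, hL0, hball, hLip⟩ := hφ.exists_lipschitz hopen hbdd hx₀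
  have hLx₀ := hLip x₀ (Metric.mem_ball_self hρ₀)
  refine ⟨Lminus_nonpos hn hopen hbdd hs0 hs1 hL0.le hx₀ hLx₀, ?_⟩
  -- The rate of the terms that must be dominated: downward differences and the zero-order term
  -- where φ is negative. If the left side is larger, rates a < a₁ < b₁ can be fitted in between.
  set a := max (-Lminus Ω s φ x₀) (Λ * max (-φ x₀) 0) with ha
  by_contra! hab
  have ha0 : 0 ≤ a := le_trans (by positivity) (le_max_right _ _)
  obtain ⟨a₁, haa₁, ha₁b⟩ := exists_between hab
  obtain ⟨b₁, ha₁b₁, hb₁⟩ := exists_between ha₁b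
  have ha₁0 : 0 < a₁ := ha0.trans_lt haa₁
  have hb₁0 : 0 < b₁ := ha₁0.trans ha₁b₁
  have hφlow : ∀ y ∈ Ω, φ x₀ - φ y ≤ a * ‖y - x₀‖ ^ s := by
    intro y hy
    have h1 := Lminus_mul_le hbdd hs0 hs1 hL0.le hx₀ hLx₀ (subset_closure hy)
    have h2 : -Lminus Ω s φ x₀ * ‖y - x₀‖ ^ s ≤ a * ‖y - x₀‖ ^ s := by
      gcongr; exact le_max_left _ _
    linarith
  -- constants
  set L' := L + 2 * D with hL'
  have hL'0 : 0 < L' := by positivity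
  set τ := (a₁ / L') ^ (1 / (1 - s)) with hτ
  have hτ0 : 0 < τ := by positivity
  have hτs : L' * τ ^ (1 - s) ≤ a₁ := by
    rw [hτ, ← Real.rpow_mul (by positivity), one_div_mul_cancel hs'.ne', Real.rpow_one]
    exact le_of_eq (by field_simp)
  have hε : 0 < (a₁ - a) * τ ^ s := mul_pos (by linarith) (by positivity)
  set m := ((n : ℝ) + s) / (1 - s) with hm
  set V := (vol Ω).real univ with hV
  have hV0 : 0 ≤ V := measureReal_nonneg
  set C₃ := (L' / a₁) ^ m with hC₃
  have hCeq : ∀ q : ℝ, a₁ ^ (q - 1 - m) * L' ^ m = C₃ * a₁ ^ (q - 1) := fun q => by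
    rw [hC₃, Real.div_rpow hL'0.le ha₁0.le, Real.rpow_sub ha₁0]; ring
  have hp1 : Tendsto (fun k => p k - 1) atTop atTop := tendsto_atTop_add_const_right _ _ hp
  -- properties of the perturbed function for a small parameter
  have hpert : ∀ κ, 0 < κ → κ ≤ min ρ₀ 1 → ∀ w : Euc n → ℝ,
      (∀ x, w x = φ x - κ * ‖x - x₀‖ ^ 2) →
      (∀ x ∈ Metric.ball x₀ κ, |φ x - φ x₀| ≤ L * ‖x - x₀‖) ∧
      ∀ x ∈ Metric.ball x₀ κ, x ∈ Ω → ∀ y ∈ Ω, |w x - w y| ≤ L' * ‖x - y‖ := by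
    intro κ hκ0 hκ w hw
    have hsub : Metric.ball x₀ κ ⊆ Metric.ball x₀ ρ₀ :=
      Metric.ball_subset_ball (hκ.trans (min_le_left _ _))
    have hκ1 : κ ≤ 1 := hκ.trans (min_le_right _ _)
    refine ⟨fun x hx => hLip x (hsub hx) x₀ (subset_closure hx₀), fun x hx hxΩ y hy => ?_⟩
    have h1 := hLip x (hsub hx) y (subset_closure hy)
    have h2 := abs_sq_norm_sub_le hbdd hx₀ hxΩ hy
    have e : w x - w y = (φ x - φ y) - κ * (‖x - x₀‖ ^ 2 - ‖y - x₀‖ ^ 2) := by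
      rw [hw, hw]; ring
    have h3 : κ * |‖x - x₀‖ ^ 2 - ‖y - x₀‖ ^ 2| ≤ 1 * (2 * D * ‖x - y‖) := by gcongr
    rw [e]
    refine (abs_sub _ _).trans ?_
    rw [abs_mul, abs_of_pos hκ0, hL']
    linarith
  rcases lt_max_iff.1 hb₁ with hcase | hcase
  · -- a quotient above `a`
    have hclne : (closure Ω \ {x₀}).Nonempty := by
      have : Nonempty (Fin n) := ⟨⟨0, hn⟩⟩
      by_contra hemp
      rw [Set.not_nonempty_iff_eq_empty, Set.sdiff_eq_empty] at hemp
      have h1 : Ω.Subsingleton := subsingleton_singleton.anti (subset_closure.trans hemp)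
      exact (hopen.measure_pos volume hne).ne' (h1.measure_zero volume)
    obtain ⟨y₁, hy₁, hlt₁⟩ := exists_lt_of_lt_Lplus hφ.1 hclne hs0 hcase
    obtain ⟨μ, hμ0, hμ⟩ := exists_between (sub_pos.2 hlt₁)
    have hnear : ∀ᶠ y in 𝓝 y₁, b₁ * ‖y - x₀‖ ^ s + μ < φ y - φ x₀ ∧ y ∈ Ω := by
      have hc : ContinuousAt (fun y => φ y - φ x₀ - b₁ * ‖y - x₀‖ ^ s) y₁ := by
        have h1 : ContinuousAt φ y₁ := (hφ.1.mono subset_closure).continuousAt (hopen.mem_nhds hy₁)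
        have h2 : Continuous fun y : Euc n => b₁ * ‖y - x₀‖ ^ s :=
          continuous_const.mul (Continuous.rpow_const (continuous_id.sub continuous_const).norm
            fun _ => Or.inr hs0.le)
        exact (h1.sub continuousAt_const).sub h2.continuousAt
      filter_upwards [hc.eventually (lt_mem_nhds hμ), hopen.mem_nhds hy₁] with y h1 h2
      exact ⟨by linarith, h2⟩
    obtain ⟨r, hr, hry⟩ := Metric.eventually_nhds_iff_ball.1 hnear
    have hrΩ : Metric.ball y₁ r ⊆ Ω := fun y hy => (hry y hy).2
    set β := (vol Ω).real (Metric.ball y₁ r) with hβ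
    have hβ0 : 0 < β := vol_real_ball_pos hbdd hr hrΩ
    -- control of the zero order term
    obtain ⟨σ, hσ0, -, hσ⟩ := exists_small (s := 1) one_pos (Λ + max (-φ x₀) 0 + 1) 0
      (ε := min 1 (a₁ - Λ * max (-φ x₀) 0))
      (lt_min one_pos (by linarith [le_max_right (-Lminus Ω s φ x₀) (Λ * max (-φ x₀) 0)])) one_pos
    rw [zero_mul, add_zero] at hσ
    set N := max (-φ x₀) 0 with hN
    have hN0 : 0 ≤ N := le_max_right _ _
    have hσ1 : σ ≤ 1 := by
      have : (Λ + N + 1) * σ ≤ 1 := hσ.trans (min_le_left _ _)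
      nlinarith [mul_nonneg hΛ0.le hσ0.le, mul_nonneg hN0 hσ0.le]
    have hσ2 : (Λ + σ) * (N + σ) ≤ a₁ := by
      have : (Λ + N + 1) * σ ≤ a₁ - Λ * N := hσ.trans (min_le_right _ _)
      nlinarith [mul_le_mul_of_nonneg_left hσ1 hσ0.le]
    obtain ⟨κ₁, hκ₁0, hκ₁r, hκ₁⟩ := exists_small hs0 (L + D ^ 2) (b₁ + Λ)
      (ε := min ((a₁ - a) * τ ^ s) (min μ (σ / 2))) (by positivity)
      (r := min ρ₀ 1) (by positivity)
    have hκs : 0 ≤ κ₁ ^ s := by positivity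
    have hκL : 0 ≤ (L + D ^ 2) * κ₁ := by positivity
    have hsm1 : (L + D ^ 2) * κ₁ + a * κ₁ ^ s ≤ (a₁ - a) * τ ^ s := by
      refine le_trans ?_ (hκ₁.trans (min_le_left _ _))
      gcongr
      linarith
    have hsm2 : (L + D ^ 2) * κ₁ + b₁ * κ₁ ^ s ≤ μ := by
      refine le_trans ?_ (hκ₁.trans ((min_le_right _ _).trans (min_le_left _ _)))
      gcongr
      linarith
    have hsm3 : Λ * κ₁ ^ s ≤ σ / 2 := by
      refine le_trans ?_ (hκ₁.trans ((min_le_right _ _).trans (min_le_right _ _)))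
      have : Λ * κ₁ ^ s ≤ (b₁ + Λ) * κ₁ ^ s := by gcongr; linarith
      linarith
    set w : Euc n → ℝ := fun x => φ x - κ₁ * ‖x - x₀‖ ^ 2 with hw
    obtain ⟨hLφ, hLw⟩ := hpert κ₁ hκ₁0 hκ₁r w fun _ => rfl
    have hup := perturbed_upper hbdd hs0 hs1 hx₀ hκ₁0.le le_rfl hL0.le ha0 haa₁.le (w := w)
      (fun _ => rfl) hτ0 hL'0.le hτs hsm1 hLφ hLw hφlow
    have hgrow : ∀ᶠ q : ℝ in atTop,
        (2 * V * C₃ + (Λ + σ)) * a₁ ^ q < 2 * (β / D ^ ((n : ℝ) + s)) * b₁ ^ q :=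
      eventually_mul_rpow_lt ha₁0 ha₁b₁ (by positivity)
    -- The gain comes from a fixed ball around y₁, where φ exceeds φ x₀ at the rate b₁. The operator
    -- bound and the negative zero-order term grow only at the rate a₁.
    refine no_strict_touching hopen hne hbdd hs0 hs1 hp hu (hf.continuous hs0) hunif hφ.1 hx₀ hφx
      hφf hκ₁0 hκ₁0 (w := w) (fun _ => rfl) hL'0.le ha₁0.le hLw hup
      (G := univ ×ˢ Metric.ball y₁ r) (MeasurableSet.univ.prod Metric.isOpen_ball.measurableSet)
      (γ := fun k => b₁ ^ (p k - 1) / D ^ ((n : ℝ) + s)) ?_ (δ := σ / 2) (by positivity) ?_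
    · filter_upwards [hp.eventually (eventually_gt_atTop 1)] with k hpk x hx hxΩ y hyΩ hxy
      have hy := hry y hxy.2
      have hlow := perturbed_lower hbdd hs0 hs1 hx₀ hκ₁0.le le_rfl hL0.le hb₁0.le (w := w)
        (fun _ => rfl) hsm2 hLφ hyΩ hy.1 x hx
      have hpos : 0 < ‖x - y‖ := by
        refine norm_pos_iff.2 (sub_ne_zero.2 ?_)
        rintro rfl
        rw [sub_self, sub_self, norm_zero, Real.zero_rpow hs0.ne', mul_zero, neg_zero] at hlow
        exact lt_irrefl _ hlow
      have h1 := oddPow_mono hpk hlow.le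
      rw [oddPow_neg, oddPow_of_nonneg hpk (show 0 ≤ b₁ * ‖x - y‖ ^ s by positivity),
        Real.mul_rpow hb₁0.le (by positivity), ← Real.rpow_mul hpos.le] at h1
      have e : ‖x - y‖ ^ ((n : ℝ) + s * p k) =
          ‖x - y‖ ^ (s * (p k - 1)) * ‖x - y‖ ^ ((n : ℝ) + s) := by
        rw [← Real.rpow_add hpos]; congr 1; ring
      have hd : ‖x - y‖ ^ ((n : ℝ) + s) ≤ D ^ ((n : ℝ) + s) := by
        gcongr
        exact norm_sub_le_diam hbdd hxΩ hyΩ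
      rw [div_le_iff₀ (by positivity)]
      refine h1.trans ?_
      rw [neg_mul, neg_le_neg_iff, e]
      calc b₁ ^ (p k - 1) / D ^ ((n : ℝ) + s) *
            (‖x - y‖ ^ (s * (p k - 1)) * ‖x - y‖ ^ ((n : ℝ) + s))
          ≤ b₁ ^ (p k - 1) / D ^ ((n : ℝ) + s) *
            (‖x - y‖ ^ (s * (p k - 1)) * D ^ ((n : ℝ) + s)) := by gcongr
        _ = _ := by field_simp
    · filter_upwards [hp.eventually (eventually_gt_atTop 1), hp1.eventually hgrow,
        hp.eventually (eventually_eigenvalue_le hn hopen hne hbdd hs0 hs1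
          (show 2 / Metric.diam Ω ^ s < Λ + σ by linarith))] with k hpk hgr hlam x hx c hc
      have hsec : {y | (x, y) ∈ (univ : Set (Euc n)) ×ˢ Metric.ball y₁ r} = Metric.ball y₁ r := by
        ext y; simp
      rw [hsec, ← hβ, hCeq]
      have hxκ : ‖x - x₀‖ ^ s ≤ κ₁ ^ s := by
        gcongr
        rw [← dist_eq_norm]; exact (Metric.mem_ball.1 hx).le
      have h1 : -(N + σ) ≤ c := by
        have e1 := (abs_le.1 (hf.abs_sub_le x x₀)).1
        have e2 := mul_le_mul_of_nonneg_left hxκ hΛ0.le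
        have e3 : -N ≤ φ x₀ := by rw [hN]; linarith [le_max_left (-φ x₀) 0]
        linarith
      have h2 := oddPow_mono hpk h1
      rw [oddPow_neg, oddPow_of_nonneg hpk (by positivity)] at h2
      have h3 : eigenvalue Ω s (p k) * (N + σ) ^ (p k - 1) ≤ (Λ + σ) * a₁ ^ (p k - 1) := by
        calc _ ≤ (Λ + σ) ^ p k * (N + σ) ^ (p k - 1) := by gcongr
          _ = (Λ + σ) * ((Λ + σ) * (N + σ)) ^ (p k - 1) := by
              rw [Real.mul_rpow (by positivity) (by positivity),
                Real.rpow_sub_one (by positivity : (Λ + σ) ≠ 0)]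
              field_simp
          _ ≤ _ := by
              gcongr
      have h4 := mul_le_mul_of_nonneg_left h2 (eigenvalue_nonneg Ω s (p k))
      have h5 : 2 * (β / D ^ ((n : ℝ) + s)) * b₁ ^ (p k - 1) =
        2 * (b₁ ^ (p k - 1) / D ^ ((n : ℝ) + s) * β) := by ring
      linarith
  · -- the zero order term is above `a`
    have hφpos : 0 < φ x₀ := by
      by_contra! h
      rw [max_eq_right h, mul_zero] at hcase
      linarith
    rw [max_eq_left hφpos.le] at hcase
    obtain ⟨σ, hσ0, -, hσ⟩ := exists_small (s := 1) one_pos (Λ + φ x₀) 0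
      (ε := min (Λ * φ x₀ - b₁) (Λ * φ x₀ / 2)) (by
        have : 0 < Λ * φ x₀ := by positivity
        exact lt_min (by linarith) (by linarith)) one_pos
    rw [zero_mul, add_zero] at hσ
    have hσ1 : (Λ + φ x₀) * σ ≤ Λ * φ x₀ - b₁ := hσ.trans (min_le_left _ _)
    have hσ2 : (Λ + φ x₀) * σ ≤ Λ * φ x₀ / 2 := hσ.trans (min_le_right _ _)
    have hσΛ : σ < Λ := by
      by_contra! h
      nlinarith [mul_le_mul_of_nonneg_left h hφpos.le, mul_pos hΛ0 hσ0]
    have hσφ : σ < φ x₀ := by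
      by_contra! h
      nlinarith [mul_le_mul_of_nonneg_left h hΛ0.le, mul_pos hφpos hσ0]
    have hσb : b₁ ≤ (Λ - σ) * (φ x₀ - σ) := by nlinarith [mul_pos hσ0 hσ0]
    obtain ⟨κ₁, hκ₁0, hκ₁r, hκ₁⟩ := exists_small hs0 (L + D ^ 2) (a + Λ)
      (ε := min ((a₁ - a) * τ ^ s) (σ / 2)) (by positivity)
      (r := min ρ₀ 1) (by positivity)
    have hκs : 0 ≤ κ₁ ^ s := by positivity
    have hκL : 0 ≤ (L + D ^ 2) * κ₁ := by positivity
    have hsm1 : (L + D ^ 2) * κ₁ + a * κ₁ ^ s ≤ (a₁ - a) * τ ^ s := by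
      refine le_trans ?_ (hκ₁.trans (min_le_left _ _))
      gcongr
      linarith
    have hsm3 : Λ * κ₁ ^ s ≤ σ / 2 := by
      refine le_trans ?_ (hκ₁.trans (min_le_right _ _))
      have : Λ * κ₁ ^ s ≤ (a + Λ) * κ₁ ^ s := by gcongr; linarith
      linarith
    set w : Euc n → ℝ := fun x => φ x - κ₁ * ‖x - x₀‖ ^ 2 with hw
    obtain ⟨hLφ, hLw⟩ := hpert κ₁ hκ₁0 hκ₁r w fun _ => rfl
    have hup := perturbed_upper hbdd hs0 hs1 hx₀ hκ₁0.le le_rfl hL0.le ha0 haa₁.le (w := w)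
      (fun _ => rfl) hτ0 hL'0.le hτs hsm1 hLφ hLw hφlow
    have hgrow : ∀ᶠ q : ℝ in atTop, (2 * V * C₃) * a₁ ^ q < (Λ - σ) * b₁ ^ q :=
      eventually_mul_rpow_lt ha₁0 ha₁b₁ (by linarith)
    -- No gain from the operator is needed, so G is empty: the zero-order term itself has rate at
    -- least b₁, against a₁ for the operator.
    refine no_strict_touching hopen hne hbdd hs0 hs1 hp hu (hf.continuous hs0) hunif hφ.1 hx₀ hφx
      hφf hκ₁0 hκ₁0 (w := w) (fun _ => rfl) hL'0.le ha₁0.le hLw hup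
      (G := ∅) MeasurableSet.empty (γ := fun _ => 0) (Eventually.of_forall ?_) (δ := σ / 2)
      (by positivity) ?_
    · intro k x _ _ y _ h
      exact absurd h (notMem_empty _)
    · filter_upwards [hp.eventually (eventually_gt_atTop 1), hp1.eventually hgrow,
        hp.eventually (eventually_le_eigenvalue hn hopen hne hbdd hs0 hs1
          (show 0 ≤ Λ - σ by linarith)
          (show Λ - σ < 2 / Metric.diam Ω ^ s by linarith))] with k hpk hgr hlam x hx c hc
      rw [hCeq, zero_mul, sub_zero]
      have hxκ : ‖x - x₀‖ ^ s ≤ κ₁ ^ s := by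
        gcongr
        rw [← dist_eq_norm]; exact (Metric.mem_ball.1 hx).le
      have h1 : φ x₀ - σ ≤ c := by
        have e1 := (abs_le.1 (hf.abs_sub_le x x₀)).1
        have e2 := mul_le_mul_of_nonneg_left hxκ hΛ0.le
        linarith
      have h2 := oddPow_mono hpk h1
      have hφσ : 0 < φ x₀ - σ := by linarith
      have hΛσ : 0 < Λ - σ := by linarith
      rw [oddPow_of_nonneg hpk hφσ.le] at h2
      have h3 : (Λ - σ) * b₁ ^ (p k - 1) ≤ eigenvalue Ω s (p k) * (φ x₀ - σ) ^ (p k - 1) := by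
        calc _ ≤ (Λ - σ) * ((Λ - σ) * (φ x₀ - σ)) ^ (p k - 1) := by
              gcongr
          _ = (Λ - σ) ^ p k * (φ x₀ - σ) ^ (p k - 1) := by
              rw [Real.mul_rpow hΛσ.le hφσ.le, Real.rpow_sub_one hΛσ.ne']
              field_simp
          _ ≤ _ := by gcongr
      have h4 := mul_le_mul_of_nonneg_left h2 (eigenvalue_nonneg Ω s (p k))
      linarith

lemma neg_image_quotient (Ω : Set (Euc n)) (s : ℝ) (u : Euc n → ℝ) (x : Euc n) :
    (fun y => (-u y - -u x) / ‖y - x‖ ^ s) '' (closure Ω \ {x}) =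
      -((fun y => (u y - u x) / ‖y - x‖ ^ s) '' (closure Ω \ {x})) := by
  rw [← Set.image_neg_eq_neg, Set.image_image]
  refine Set.image_congr fun y _ => ?_
  ring

lemma Lplus_neg (Ω : Set (Euc n)) (s : ℝ) (u : Euc n → ℝ) (x : Euc n) :
    Lplus Ω s (fun y => -u y) x = -Lminus Ω s u x := by
  rw [Lplus, Lminus, neg_image_quotient, Real.sSup_neg]

lemma Lminus_neg (Ω : Set (Euc n)) (s : ℝ) (u : Euc n → ℝ) (x : Euc n) :
    Lminus Ω s (fun y => -u y) x = -Lplus Ω s u x := by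
  rw [Lplus, Lminus, neg_image_quotient, Real.sInf_neg]

lemma IsC1Closure.neg {φ : Euc n → ℝ} (h : IsC1Closure Ω φ) :
    IsC1Closure Ω (fun x => -φ x) := by
  obtain ⟨h1, g, h2, h3⟩ := h
  exact ⟨h1.neg, fun x => -g x, h2.neg, fun x hx => (h3 x hx).fun_neg⟩

/-- For φ x₀ ≥ 0 the right side of the unified inequality is -ℒ⁻φ, because ℒ⁻φ ≤ 0. For φ x₀ < 0 the
maximum on the right becomes the alternative expressed by the minimum in the equation. -/
theorem isViscositySuper_of_limit (hn : 1 ≤ n) (hopen : IsOpen Ω) (hne : Ω.Nonempty)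
    (hbdd : Bornology.IsBounded Ω) (hs0 : 0 < s) (hs1 : s < 1) {p : ℕ → ℝ}
    {u : ℕ → Euc n → ℝ} (hp : Tendsto p atTop atTop)
    (hu : ∀ k, IsNormalizedMinimizer Ω s (p k) (u k)) {f : Euc n → ℝ}
    (hf : IsHolder s (2 / Metric.diam Ω ^ s) f)
    (hunif : ∀ δ > 0, ∀ᶠ k in atTop, ∀ᵐ x ∂(vol Ω), |u k x - f x| ≤ δ) :
    IsViscositySuper Ω s (2 / Metric.diam Ω ^ s) f := by
  intro x₀ hx₀ φ hφ hφx hφf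
  obtain ⟨hM, hmax⟩ :=
    limit_touching hn hopen hne hbdd hs0 hs1 hp hu hf hunif hφ hx₀ hφx hφf
  have h1 := (le_max_left _ _).trans hmax
  have h2 := (le_max_right _ _).trans hmax
  rw [holderLaplacian]
  refine ⟨fun h => ?_, fun h => ?_, fun h => ?_⟩
  · rw [max_eq_right (by linarith : -φ x₀ ≤ 0), mul_zero,
      max_eq_left (by linarith : 0 ≤ -Lminus Ω s φ x₀)] at h1 h2
    rw [max_eq_left h.le] at h2
    exact max_le (by linarith) (by linarith)
  · rw [h, neg_zero, max_self, mul_zero, max_eq_left (by linarith)] at h1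
    linarith
  · rw [max_eq_left (by linarith : 0 ≤ -φ x₀)] at h1
    rcases le_max_iff.1 h1 with h3 | h3
    · exact min_le_of_left_le (by linarith)
    · exact min_le_of_right_le (by linarith)

/-- The equation is odd: u ↦ -u exchanges ℒ⁺ with -ℒ⁻, the maximum with the minimum, and the two
sign cases. -/
lemma IsViscositySuper.neg {Λ : ℝ} {u : Euc n → ℝ}
    (h : IsViscositySuper Ω s Λ (fun x => -u x)) : IsViscositySub Ω s Λ u := by
  intro x₀ hx₀ φ hφ hφx hφu
  obtain ⟨h1, h2, h3⟩ := h x₀ hx₀ (fun x => -φ x) hφ.neg (by rw [hφx])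
    (fun x hx => neg_le_neg (hφu x hx))
  simp only [holderLaplacian, Lplus_neg, Lminus_neg] at h1 h2 h3 ⊢
  refine ⟨fun h => ?_, fun h => ?_, fun h => ?_⟩
  · rcases min_le_iff.1 (h3 (by linarith)) with h4 | h4
    · exact le_max_of_le_left (by linarith)
    · exact le_max_of_le_right (by linarith)
  · have := h2 (by linarith)
    linarith
  · obtain ⟨h4, h5⟩ := max_le_iff.1 (h1 (by linarith))
    exact le_min (by linarith) (by linarith)

theorem isViscositySolution_of_limit (hn : 1 ≤ n) (hopen : IsOpen Ω) (hne : Ω.Nonempty)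
    (hbdd : Bornology.IsBounded Ω) (hs0 : 0 < s) (hs1 : s < 1) {p : ℕ → ℝ}
    {u : ℕ → Euc n → ℝ} (hp : Tendsto p atTop atTop)
    (hu : ∀ k, IsNormalizedMinimizer Ω s (p k) (u k)) {f : Euc n → ℝ}
    (hf : IsHolder s (2 / Metric.diam Ω ^ s) f)
    (hunif : ∀ δ > 0, ∀ᶠ k in atTop, ∀ᵐ x ∂(vol Ω), |u k x - f x| ≤ δ) :
    IsViscositySolution Ω s (2 / Metric.diam Ω ^ s) f := by
  refine ⟨(hf.continuous hs0).continuousOn,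
    isViscositySuper_of_limit hn hopen hne hbdd hs0 hs1 hp hu hf hunif,
    (isViscositySuper_of_limit hn hopen hne hbdd hs0 hs1 hp (u := fun k x => -u k x)
      (fun k => (hu k).neg) hf.neg fun δ hδ => ?_).neg⟩
  filter_upwards [hunif δ hδ] with k hk
  filter_upwards [hk] with x hx
  rwa [neg_sub_neg, abs_sub_comm]

/-! ### Continuous representatives and the theorem -/

/-- An almost everywhere bound between functions continuous on an open set holds everywhere. -/
lemma abs_sub_le_of_ae (hopen : IsOpen Ω) {v f : Euc n → ℝ} (hv : ContinuousOn v Ω)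
    (hf : Continuous f) {δ : ℝ} (h : ∀ᵐ x ∂(vol Ω), |v x - f x| ≤ δ) {x : Euc n} (hx : x ∈ Ω) :
    |v x - f x| ≤ δ :=
  le_of_ae_le hopen (hv.sub hf.continuousOn).abs h hx

/-- A representative that is continuous on `Ω`, on the closure as soon as some representative
is, and that is as close to `f` on the closure as `u` is on `Ω`. -/
lemma exists_good_rep (hopen : IsOpen Ω) {u f : Euc n → ℝ} (hf : Continuous f)
    (hu : ∃ v, ContinuousOn v Ω ∧ v =ᵐ[vol Ω] u) :
    ∃ v, v =ᵐ[vol Ω] u ∧ ContinuousOn v Ω ∧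
      ((∃ w, ContinuousOn w (closure Ω) ∧ w =ᵐ[vol Ω] u) → ContinuousOn v (closure Ω)) ∧
      ∀ δ, 0 ≤ δ → (∀ᵐ x ∂(vol Ω), |u x - f x| ≤ δ) → ∀ x ∈ closure Ω, |v x - f x| ≤ δ := by
  by_cases hw : ∃ w, ContinuousOn w (closure Ω) ∧ w =ᵐ[vol Ω] u
  · obtain ⟨w, hwc, hwu⟩ := hw
    refine ⟨w, hwu, hwc.mono subset_closure, fun _ => hwc, fun δ _ h x hx => ?_⟩
    have h' : ∀ᵐ x ∂(vol Ω), |w x - f x| ≤ δ := by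
      filter_upwards [h, hwu] with x h1 h2
      rwa [h2]
    exact le_on_closure (fun y hy => abs_sub_le_of_ae hopen (hwc.mono subset_closure) hf h' hy)
      (hwc.sub hf.continuousOn).abs continuousOn_const hx
  · classical
    obtain ⟨v, hvc, hvu⟩ := hu
    -- Without a representative continuous up to the boundary, the values outside Ω are free; those
    -- of f make the estimate trivial there.
    have heq : EqOn (Ω.piecewise v f) v Ω := fun x hx => piecewise_eq_of_mem _ _ _ hx
    refine ⟨Ω.piecewise v f, ?_, hvc.congr heq, fun h => absurd h hw, fun δ hδ h x _ => ?_⟩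
    · filter_upwards [hvu, ae_restrict_mem hopen.measurableSet] with x h1 h2
      rw [heq h2, h1]
    · by_cases hx : x ∈ Ω
      · rw [heq hx]
        refine abs_sub_le_of_ae hopen hvc hf ?_ hx
        filter_upwards [h, hvu] with x h1 h2
        rwa [h2]
      · rw [piecewise_eq_of_notMem _ _ _ hx, sub_self, abs_zero]
        exact hδ

end HolderInfinity

end

theorem theorem1p2 {n : ℕ} (hn : 1 ≤ n) (Ω : Set (EuclideanSpace ℝ (Fin n)))
    (hopen : IsOpen Ω) (hconn : IsConnected Ω) (hbdd : Bornology.IsBounded Ω)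
    (s : ℝ) (hs0 : 0 < s) (hs1 : s < 1) :
    Tendsto (fun p : ℝ => HolderInfinity.eigenvalue Ω s p ^ (1 / p)) atTop
        (𝓝 (2 / Metric.diam Ω ^ s)) ∧
      2 / Metric.diam Ω ^ s = HolderInfinity.eigenvalueInfty Ω s ∧
      ∀ (p : ℕ → ℝ) (u : ℕ → EuclideanSpace ℝ (Fin n) → ℝ),
        (∀ k, 1 < p k) → Tendsto p atTop atTop →
        (∀ k, HolderInfinity.IsNormalizedMinimizer Ω s (p k) (u k)) →
        ∃ (j : ℕ → ℕ) (v : ℕ → EuclideanSpace ℝ (Fin n) → ℝ)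
          (uInf : EuclideanSpace ℝ (Fin n) → ℝ),
          StrictMono j ∧
          -- `v k` is the continuous representative of `u (j k)`
          (∀ k, v k =ᵐ[HolderInfinity.vol Ω] u (j k)) ∧
          (∀ k, ContinuousOn (v k) Ω) ∧
          (∀ k, (∃ w, ContinuousOn w (closure Ω) ∧ w =ᵐ[HolderInfinity.vol Ω] u (j k)) →
            ContinuousOn (v k) (closure Ω)) ∧
          ContinuousOn uInf (closure Ω) ∧
          TendstoUniformlyOn v uInf atTop (closure Ω) ∧
          HolderInfinity.IsMinimizerInfty Ω s uInf ∧
          HolderInfinity.IsViscositySolution Ω s (HolderInfinity.eigenvalueInfty Ω s) uInf := by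
  have hne := hconn.nonempty
  have hΛ := HolderInfinity.eigenvalueInfty_eq hn hopen hne hbdd hs0 hs1
  refine ⟨HolderInfinity.tendsto_eigenvalue hn hopen hne hbdd hs0 hs1, hΛ.symm, ?_⟩
  intro p u hp1 hp hu
  rw [hΛ]
  -- Dropping the first K terms ensures s p > n, so that every remaining minimizer has a
  -- representative continuous in Ω.
  obtain ⟨K, hK⟩ := eventually_atTop.1 (hp.eventually (eventually_gt_atTop ((n : ℝ) / s)))
  obtain ⟨i, f, hi, hf, hmeas⟩ :=
    HolderInfinity.exists_subseq_tendstoInMeasure hn hopen hne hbdd hs0 hs1 (p := fun k => p (k + K))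
      (u := fun k => u (k + K)) (fun k => hp1 _) (hp.comp (tendsto_add_atTop_nat K))
      (fun k => hu _)
  have hj : StrictMono fun k => i k + K := fun a b hab => Nat.add_lt_add_right (hi hab) K
  have hpj : Tendsto (fun k => p (i k + K)) atTop atTop := hp.comp hj.tendsto_atTop
  have huj := fun k => hu (i k + K)
  have hfc := hf.continuous hs0
  have hunif : ∀ δ > 0, ∀ᶠ k in atTop, ∀ᵐ x ∂(HolderInfinity.vol Ω),
      |u (i k + K) x - f x| ≤ δ := fun δ hδ =>
    HolderInfinity.eventually_abs_sub_le hn hopen hne hbdd hs0 hs1 hpj huj hf hmeas hδ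
  have hrep : ∀ k, ∃ v, ContinuousOn v Ω ∧ v =ᵐ[HolderInfinity.vol Ω] u (i k + K) := fun k =>
    HolderInfinity.MemW.exists_continuousOn_rep hopen hbdd hs0 (hp1 _)
      (by have := hK (i k + K) (Nat.le_add_left _ _); rwa [div_lt_iff₀' hs0] at this) (huj k).1.1
  choose v hvu hvc hvcl hvf using fun k => HolderInfinity.exists_good_rep hopen hfc (hrep k)
  refine ⟨fun k => i k + K, v, f, hj, hvu, hvc, hvcl, hfc.continuousOn, ?_,
    HolderInfinity.isMinimizerInfty_of_limit hn hopen hne hbdd hs0 hs1 hpj huj hf hunif,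
    HolderInfinity.isViscositySolution_of_limit hn hopen hne hbdd hs0 hs1 hpj huj hf hunif⟩
  rw [Metric.tendstoUniformlyOn_iff]
  intro ε hε
  filter_upwards [hunif (ε / 2) (by linarith)] with k hk x hx
  rw [dist_comm, Real.dist_eq]
  exact (hvf k (ε / 2) (by linarith) hk x hx).trans_lt (by linarith)
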